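/- Let $m\ge 1$ and $n\ge 3$. Let $K$ be either (i) $\mathbb R$ or $\mathbb C$, "function" meaning smooth (for $\mathbb C$: holomorphic) function, with $x$ ranging over an open set $I\subseteq K$ and $(x,y_1,\dots,y_m)$ over a nonempty connected open set $M\subseteq I\times K^m$; or (ii) an arbitrary field of characteristic zero, "function" meaning formal power series in $x$, respectively in $x,y_1,\dots,y_m$. Consider the isotropic linear system $$\mathbf y^{(n)}+A_n^2\,\mathbf y^{(n-2)}+\dots+A_n^n\,\mathbf y=0,\qquad \mathbf y=(y_1,\dots,y_m),$$ with scalar coefficients $A_n^j=A_n^j(x)$. Assume that it is the normal form of a system in the canonical class of $\mathbf y^{(n)}=0$: in case (i) near every point of $I$, in case (ii) formally at $x=0$ with $f(0)=0$, there is an invertible change of variable $x=f(z)$ such that the scalar equation $y^{(n)}+A_n^2y^{(n-2)}+\dots+A_n^ny=0$ is the transform of $w^{(n)}=0$ under $x=f(z)$, $y=f'(z)^{(n-1)/2}w$, and, with the same $f$, the source equation $y''+\mathfrak q\,y=0$ is the transform of $w''=0$ under $x=f(z)$, $y=f'(z)^{1/2}w$. Here $\mathfrak q=\mathfrak q(x)$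 is a given function (defined on all of $I$ in case (i)), and a square root of $f'$ is assumed to exist. Let $u,v$ be solutions of $y''+\mathfrak q\,y=0$ (on all of $I$ in case (i)) with Wronskian $uv'-u'v=1$, and put $s_k=u^{n-1-k}v^k$ for $0\le k\le n-1$ and $\partial_j=\partial/\partial y_j$. Let $\mathfrak g$ be the set of Lie point symmetries of the system, i.e. of the vector fields $\mathbf v=\xi(x,\mathbf y)\partial_x+\sum_i\eta_i(x,\mathbf y)\partial_i$ whose $n$-th prolongation satisfies $\mathbf v^{(n)}(\Delta_i)|_{\Delta=0}=0$ for all $i$, where $\Delta_i$ is the left side of the $i$-th equation. Put $$F_p=v^2\partial_x+(n-1)vv'\sum_i y_i\partial_i,\quad F_m=-u^2\partial_x-(n-1)uu'\sum_i y_i\partial_i,\quad F_z=2uv\,\partial_x+(n-1)(uv'+u'v)\sum_i y_i\partial_i,$$ and let $\mathfrak g_F$ be the span of $F_p,F_m,F_z$, $\mathfrak g_H$ the span of the fields $H_{ij}=y_i\partial_j$, $\mathfrak g_S$ the span of the fields $s_k\partial_j$, $\mathfrak s_H$ the span of the $H_{ij}$ with $i\ne j$ and of the $H_{ii}-H_{i+1,i+1}$,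 and $H_0=\sum_iH_{ii}$. Then $\mathfrak g$ is a Lie algebra over $K$ under the bracket of vector fields, it contains all these spans, and: (a) $\mathfrak g_F$ is a three-dimensional subalgebra of $\mathfrak g$, isomorphic to $\mathfrak{sl}_2(K)$; the sum $\mathfrak g_H+\mathfrak g_S$ is direct (as vector spaces) and is a subalgebra of $\mathfrak g$, and $\mathfrak g_F$ is a complementary subspace of it in $\mathfrak g$. (b) $\dim_K\mathfrak g=m^2+nm+3$, and $\mathfrak g$ has the Levi decomposition $$\mathfrak g=(\mathfrak g_F\oplus\mathfrak s_H)\ltimes(\mathfrak g_S\dotplus K H_0).$$ Here $\mathfrak s_H\cong\mathfrak{sl}_m(K)$ is a subalgebra, $\mathfrak g_F\oplus\mathfrak s_H$ is a direct sum of Lie algebras and is a semisimple subalgebra (the Levi factor), $\mathfrak g_S$ is an abelian ideal of $\mathfrak g$, $\mathfrak g_S\dotplus KH_0$ (direct sum of vector spaces) is the solvable radical of $\mathfrak g$, and $\mathfrak g$ is the vector space direct sum of the Levi factor and the radical. -/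

import Mathlib

open scoped ContDiff

noncomputable section

namespace PointSym

/-! ### Vector fields, jets, prolongation and point symmetries

`O` is a `K`-algebra of functions of `(x, y_1, …, y_m)`; the two algebras used below are the smooth
functions on an open subset of `K × K^m` and the formal power series in `x, y_1, …, y_m`. -/

/-- The coordinate data on an algebra of functions `O` of `(x, y_1, …, y_m)`: the partial
derivatives `∂/∂x`, `∂/∂y_i` and the coordinate functions `y_i`. -/
structure Coordinates (K O : Type*) [Field K] [CommRing O] [Algebra K O] (m : ℕ) where
  dx : Derivation K O O
  dy : Fin m → Derivation K O O
  y : Fin m → O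

section Jets

variable {K O : Type*} [Field K] [CommRing O] [Algebra K O] {m : ℕ}

/-- Differential functions that are polynomial in the derivatives `y_i^(k)`, `k ≥ 1`, with
coefficients that are functions of `(x, y)`. The variable `(i, k)` stands for `y_i^(k+1)`. -/
abbrev Jet (O : Type*) [CommRing O] (m : ℕ) : Type _ := MvPolynomial (Fin m × ℕ) O

/-- Apply an operator on functions of `(x, y)` to every coefficient of a differential function. -/
def mapCoeff (δ : O → O) (P : Jet O m) : Jet O m :=
  ∑ s ∈ P.support, MvPolynomial.monomial s (δ (P.coeff s))

/-- The jet coordinate `y_i^(k)`. -/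
def Coordinates.jet (c : Coordinates K O m) (i : Fin m) : ℕ → Jet O m
  | 0 => MvPolynomial.C (c.y i)
  | k + 1 => MvPolynomial.X (i, k)

/-- The total derivative
`D_x = ∂/∂x + ∑ i, y_i^(1) ∂/∂y_i + ∑ i, ∑ k ≥ 1, y_i^(k+1) ∂/∂y_i^(k)`. -/
def Coordinates.totalDeriv (c : Coordinates K O m) (P : Jet O m) : Jet O m :=
  mapCoeff c.dx P + ∑ i, c.jet i 1 * mapCoeff (c.dy i) P
    + MvPolynomial.mkDerivation O (fun p : Fin m × ℕ => c.jet p.1 (p.2 + 2)) P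

/-- The vector field `ξ ∂/∂x + ∑ i, η_i ∂/∂y_i`, as an operator on functions. The Lie bracket of
vector fields is the commutator of derivations. -/
def Coordinates.field (c : Coordinates K O m) (ξ : O) (η : Fin m → O) : Derivation K O O :=
  ξ • c.dx + ∑ i, η i • c.dy i

/-- The coefficient of `∂/∂y_i^(k)` in the prolongation of `ξ ∂/∂x + ∑ i, η_i ∂/∂y_i`:
`η_i^(0) = η_i` and `η_i^(k+1) = D_x η_i^(k) - y_i^(k+1) D_x ξ`. -/
def Coordinates.prolCoeff (c : Coordinates K O m) (ξ : O) (η : Fin m → O) (i : Fin m) :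
    ℕ → Jet O m
  | 0 => MvPolynomial.C (η i)
  | k + 1 => c.totalDeriv (Coordinates.prolCoeff c ξ η i k)
      - c.jet i (k + 1) * c.totalDeriv (MvPolynomial.C ξ)

/-- The prolongation of `ξ ∂/∂x + ∑ i, η_i ∂/∂y_i`, acting on differential functions. -/
def Coordinates.prolong (c : Coordinates K O m) (ξ : O) (η : Fin m → O) (P : Jet O m) : Jet O m :=
  mapCoeff (c.field ξ η) P
    + MvPolynomial.mkDerivation O (fun p : Fin m × ℕ => c.prolCoeff ξ η p.1 (p.2 + 1)) P

/-- The lower order part `∑_{j=2}^n A_j y_i^(n-j)` of the `i`-th equation. -/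
def Coordinates.lowerPart (c : Coordinates K O m) (n : ℕ) (A : ℕ → O) (i : Fin m) : Jet O m :=
  ∑ j ∈ Finset.Icc 2 n, MvPolynomial.C (A j) * c.jet i (n - j)

/-- The left side `Δ_i = y_i^(n) + ∑_{j=2}^n A_j y_i^(n-j)` of the `i`-th equation of the isotropic
system. -/
def Coordinates.equation (c : Coordinates K O m) (n : ℕ) (A : ℕ → O) (i : Fin m) : Jet O m :=
  c.jet i n + c.lowerPart n A i

/-- Restriction of a differential function of order at most `n` to the locus `Δ = 0` in the `n`-th
jet space: every `y_i^(n)` is replaced by `- ∑_{j=2}^n A_j y_i^(n-j)`. -/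
def Coordinates.onShell (c : Coordinates K O m) (n : ℕ) (A : ℕ → O) : Jet O m →ₐ[O] Jet O m :=
  MvPolynomial.aeval fun p : Fin m × ℕ =>
    if p.2 + 1 = n then - c.lowerPart n A p.1 else MvPolynomial.X p

/-- `X` is (the infinitesimal generator of) a Lie point symmetry of the isotropic system `Δ = 0`:
it is a vector field whose prolongation satisfies the infinitesimal criterion of invariance. -/
def Coordinates.IsPointSymmetry (c : Coordinates K O m) (n : ℕ) (A : ℕ → O)
    (X : Derivation K O O) : Prop :=
  ∃ (ξ : O) (η : Fin m → O), X = c.field ξ η ∧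
    ∀ i, c.onShell n A (c.prolong ξ η (c.equation n A i)) = 0

/-- `H_ij = y_i ∂/∂y_j`. -/
def Coordinates.H (c : Coordinates K O m) (i j : Fin m) : Derivation K O O := c.y i • c.dy j

/-- `S_kj = s_k ∂/∂y_j` with `s_k = u^(n-1-k) v^k`. -/
def Coordinates.S (c : Coordinates K O m) (n : ℕ) (u v : O) (k : Fin n) (j : Fin m) :
    Derivation K O O :=
  (u ^ (n - 1 - (k : ℕ)) * v ^ (k : ℕ)) • c.dy j

/-- `F_p = v² ∂/∂x + (n-1) v v' ∑ i, y_i ∂/∂y_i`. -/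
def Coordinates.Fp (c : Coordinates K O m) (n : ℕ) (v : O) : Derivation K O O :=
  c.field (v ^ 2) fun i => ((n : O) - 1) * (v * c.dx v) * c.y i

/-- `F_m = -u² ∂/∂x - (n-1) u u' ∑ i, y_i ∂/∂y_i`. -/
def Coordinates.Fm (c : Coordinates K O m) (n : ℕ) (u : O) : Derivation K O O :=
  c.field (-u ^ 2) fun i => -(((n : O) - 1) * (u * c.dx u) * c.y i)

/-- `F_z = 2 u v ∂/∂x + (n-1) (u v' + u' v) ∑ i, y_i ∂/∂y_i`. -/
def Coordinates.Fz (c : Coordinates K O m) (n : ℕ) (u v : O) : Derivation K O O :=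
  c.field (2 * u * v) fun i => ((n : O) - 1) * (u * c.dx v + c.dx u * v) * c.y i

/-- The structure of the Lie point symmetry algebra `g` of the isotropic system of order `n` in `m`
dependent variables with coefficients `A_2, …, A_n`, where `u, v` are the chosen solutions of the
source equation. -/
def Coordinates.SymmetryAlgebraStructure (c : Coordinates K O m) (n : ℕ) (A : ℕ → O) (u v : O) :
    Prop :=
  -- the point symmetries form a Lie algebra `g` of vector fields, of the stated dimension
  ∃ g : LieSubalgebra K (Derivation K O O),
    (∀ X, X ∈ g ↔ c.IsPointSymmetry n A X) ∧
    Module.finrank K g = m ^ 2 + n * m + 3 ∧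
    -- the subalgebras of `g` named in the decomposition, spanned by the stated vector fields
    ∃ (gF gH sH gHS levi : LieSubalgebra K g) (gS : LieIdeal K g) (KH₀ : Submodule K g),
      gF.toSubmodule.map g.toSubmodule.subtype
        = Submodule.span K {c.Fp n v, c.Fm n u, c.Fz n u v} ∧
      gH.toSubmodule.map g.toSubmodule.subtype
        = Submodule.span K {X | ∃ i j, X = c.H i j} ∧
      gS.toSubmodule.map g.toSubmodule.subtype
        = Submodule.span K {X | ∃ k j, X = c.S n u v k j} ∧
      sH.toSubmodule.map g.toSubmodule.subtype
        = Submodule.span K ({X | ∃ i j, i ≠ j ∧ X = c.H i j} ∪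
            {X | ∃ i j : Fin m, (j : ℕ) = i + 1 ∧ X = c.H i i - c.H j j}) ∧
      KH₀.map g.toSubmodule.subtype = Submodule.span K {∑ i, c.H i i} ∧
      -- `g_F` is three-dimensional, isomorphic to `sl_2`, and complementary in `g` to the
      -- subalgebra `g_H ∔ g_S`
      Module.finrank K gF = 3 ∧
      Nonempty (gF ≃ₗ⁅K⁆ LieAlgebra.SpecialLinear.sl (Fin 2) K) ∧
      Disjoint gH.toSubmodule gS.toSubmodule ∧
      gHS.toSubmodule = gH.toSubmodule ⊔ gS.toSubmodule ∧
      IsCompl gF.toSubmodule gHS.toSubmodule ∧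
      -- `s_H` is isomorphic to `sl_m`, and `g_S` is an abelian ideal
      Nonempty (sH ≃ₗ⁅K⁆ LieAlgebra.SpecialLinear.sl (Fin m) K) ∧
      IsLieAbelian gS ∧
      -- the Levi factor is semisimple and is the direct sum of the Lie algebras `g_F` and `s_H`
      levi.toSubmodule = gF.toSubmodule ⊔ sH.toSubmodule ∧
      Disjoint gF.toSubmodule sH.toSubmodule ∧
      (∀ X ∈ gF, ∀ Y ∈ sH, ⁅X, Y⁆ = 0) ∧
      LieAlgebra.IsSemisimple K levi ∧
      -- the radical is the direct sum of the vector spaces `g_S` and `K H_0`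
      (LieAlgebra.radical K g).toSubmodule = gS.toSubmodule ⊔ KH₀ ∧
      Disjoint gS.toSubmodule KH₀ ∧
      -- `g` is the semidirect sum of the Levi factor and the radical
      IsCompl levi.toSubmodule (LieAlgebra.radical K g).toSubmodule

end Jets

/-! ### Smooth functions -/

section Smooth

variable {K : Type*} [RCLike K]

/-- The scalar operator `y ↦ y^(n) + ∑_{j=2}^n A_j y^(n-j)`. -/
def linOp (n : ℕ) (A : ℕ → K → K) (y : K → K) (x : K) : K :=
  iteratedDeriv n y x + ∑ j ∈ Finset.Icc 2 n, A j x * iteratedDeriv (n - j) y x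

/-- `x = f z` is an invertible smooth change of the independent variable from `J` onto `I`, and `r`
is a smooth square root of `f'`. -/
structure IsCoordinateChange (f r : K → K) (J I : Set K) : Prop where
  isOpen_source : IsOpen J
  isOpen_target : IsOpen I
  smooth : ContDiffOn K ∞ f J
  smooth_root : ContDiffOn K ∞ r J
  bijOn : Set.BijOn f J I
  deriv_eq : ∀ z ∈ J, deriv f z = r z ^ 2
  root_ne_zero : ∀ z ∈ J, r z ≠ 0

/-- The equation `y^(n) + ∑_{j=2}^n A_j y^(n-j) = 0` on `I` is the transform of the equation
`w^(n) = 0` on `J` under `x = f z`, `y = f'(z)^((n-1)/2) w`, where `f' = r²`. -/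
def IsTransformOfTrivial (n : ℕ) (A : ℕ → K → K) (f r : K → K) (J I : Set K) : Prop :=
  ∀ y w : K → K, ContDiffOn K ∞ y I → ContDiffOn K ∞ w J →
    (∀ z ∈ J, y (f z) = r z ^ (n - 1) * w z) →
    ((∀ z ∈ J, iteratedDeriv n w z = 0) ↔ ∀ x ∈ I, linOp n A y x = 0)

/-- Near every point of `I`, the equation `y^(n) + ∑_{j=2}^n A_j y^(n-j) = 0` and its source
equation `y'' + q y = 0` are the transforms of `w^(n) = 0` and of `w'' = 0` under the changes of
variables `x = f z`, `y = f'(z)^((n-1)/2) w` and `x = f z`, `y = f'(z)^(1/2) w`, with the same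
`f`. -/
def InCanonicalClass (n : ℕ) (A : ℕ → K → K) (q : K → K) (I : Set K) : Prop :=
  ∀ x₀ ∈ I, ∃ (f r : K → K) (J I' : Set K), x₀ ∈ I' ∧ I' ⊆ I ∧ IsCoordinateChange f r J I' ∧
    IsTransformOfTrivial n A f r J I' ∧ IsTransformOfTrivial 2 (fun _ => q) f r J I'

variable {m : ℕ}

/-- The functions on `M`, extended by zero, which are smooth on `M`. -/
def smoothFunctions (M : TopologicalSpace.Opens (K × (Fin m → K))) : Subalgebra K (M → K) where
  carrier := {f | ContDiffOn K ∞ (Function.extend Subtype.val f 0) M}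
  mul_mem' {f g} hf hg := (ContDiffOn.mul hf hg).congr fun p hp => by
    have h (a : M → K) : Function.extend Subtype.val a 0 p = a ⟨p, hp⟩ :=
      Subtype.val_injective.extend_apply a 0 (⟨p, hp⟩ : M)
    simp [h]
  add_mem' {f g} hf hg := (ContDiffOn.add hf hg).congr fun p hp => by
    have h (a : M → K) : Function.extend Subtype.val a 0 p = a ⟨p, hp⟩ :=
      Subtype.val_injective.extend_apply a 0 (⟨p, hp⟩ : M)
    simp [h]
  algebraMap_mem' r := (contDiffOn_const (c := r)).congr fun p hp => by
    have h (a : M → K) : Function.extend Subtype.val a 0 p = a ⟨p, hp⟩ :=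
      Subtype.val_injective.extend_apply a 0 (⟨p, hp⟩ : M)
    simp [h]

/-- The restriction to `M` of a function that is smooth on `M`. -/
def restrict (M : TopologicalSpace.Opens (K × (Fin m → K))) (F : K × (Fin m → K) → K)
    (hF : ContDiffOn K ∞ F M) : smoothFunctions M :=
  ⟨fun p => F p, hF.congr fun p hp =>
    Subtype.val_injective.extend_apply (fun p : M => F p) 0 (⟨p, hp⟩ : M)⟩

lemma extend_eq {M : TopologicalSpace.Opens (K × (Fin m → K))} (a : M → K) (p : M) :
    Function.extend Subtype.val a 0 (p : K × (Fin m → K)) = a p :=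
  Subtype.val_injective.extend_apply a 0 p

lemma differentiableAt_extend {M : TopologicalSpace.Opens (K × (Fin m → K))}
    (a : smoothFunctions M) (p : M) :
    DifferentiableAt K (Function.extend Subtype.val (a : M → K) 0) (p : K × (Fin m → K)) :=
  ((a.2 : ContDiffOn K ∞ _ _).contDiffAt (M.isOpen.mem_nhds p.2)).differentiableAt (by simp)

lemma extend_eventuallyEq {M : TopologicalSpace.Opens (K × (Fin m → K))} (a : M → K)
    (F : K × (Fin m → K) → K) (h : ∀ p : M, a p = F p) (p : M) :
    Function.extend Subtype.val a 0 =ᶠ[nhds (p : K × (Fin m → K))] F := by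
  filter_upwards [M.isOpen.mem_nhds p.2] with z hz
  rw [extend_eq a ⟨z, hz⟩, h]

/-- The derivative in the direction of the constant vector `w`. -/
def dirDeriv (M : TopologicalSpace.Opens (K × (Fin m → K))) (w : K × (Fin m → K)) :
    Derivation K (smoothFunctions M) (smoothFunctions M) :=
  Derivation.mk'
    { toFun := fun a => restrict M
        (fun p => fderiv K (Function.extend Subtype.val (a : M → K) 0) p w)
        (((a.2 : ContDiffOn K ∞ _ _).fderiv_of_isOpen M.isOpen (by simp)).clm_apply
          contDiffOn_const)
      map_add' := fun a b => by
        ext p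
        change fderiv K (Function.extend Subtype.val ((a + b : smoothFunctions M) : M → K) 0)
          (p : K × (Fin m → K)) w
          = fderiv K (Function.extend Subtype.val (a : M → K) 0) (p : K × (Fin m → K)) w
          + fderiv K (Function.extend Subtype.val (b : M → K) 0) (p : K × (Fin m → K)) w
        rw [(extend_eventuallyEq _ (Function.extend Subtype.val (a : M → K) 0
          + Function.extend Subtype.val (b : M → K) 0) (fun z => by simp) p).fderiv_eq,
          fderiv_add (differentiableAt_extend a p) (differentiableAt_extend b p)]
        rfl
      map_smul' := fun r a => by
        ext p
        change fderiv K (Function.extend Subtype.val ((r • a : smoothFunctions M) : M → K) 0)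
          (p : K × (Fin m → K)) w
          = r • fderiv K (Function.extend Subtype.val (a : M → K) 0) (p : K × (Fin m → K)) w
        rw [(extend_eventuallyEq _ (r • Function.extend Subtype.val (a : M → K) 0)
          (fun z => by simp) p).fderiv_eq,
          fderiv_const_smul (differentiableAt_extend a p)]
        rfl }
    (fun a b => by
      ext p
      change fderiv K _ (p : K × (Fin m → K)) w
        = (a : M → K) p * fderiv K _ _ w + (b : M → K) p * fderiv K _ _ w
      rw [(extend_eventuallyEq _ (Function.extend Subtype.val (a : M → K) 0
          * Function.extend Subtype.val (b : M → K) 0)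
          (fun z => by simp) p).fderiv_eq,
          fderiv_mul (differentiableAt_extend a p) (differentiableAt_extend b p)]
      simp)

/-- The coordinates `(x, y_1, …, y_m)` on an open subset `M` of `K × K^m`. -/
def smoothCoordinates (M : TopologicalSpace.Opens (K × (Fin m → K))) :
    Coordinates K (smoothFunctions M) m where
  dx := dirDeriv M (1, 0)
  dy i := dirDeriv M (0, Pi.single i 1)
  y i := restrict M (fun p => p.2 i) (by fun_prop)

/-- A smooth function `a(x)` on `I`, as a function on `M ⊆ I × K^m`. -/
def ofBase (M : TopologicalSpace.Opens (K × (Fin m → K))) {I : Set K}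
    (hM : ∀ p ∈ M, p.1 ∈ I) (a : K → K) (ha : ContDiffOn K ∞ a I) : smoothFunctions M :=
  restrict M (fun p => a p.1) (ha.comp contDiff_fst.contDiffOn hM)

end Smooth

/-! ### Formal power series -/

section Formal

open PowerSeries

variable {K : Type*} [Field K]

/-- The scalar operator `y ↦ y^(n) + ∑_{j=2}^n A_j y^(n-j)` on formal power series. -/
def formalLinOp (n : ℕ) (A : ℕ → K⟦X⟧) (y : K⟦X⟧) : K⟦X⟧ :=
  (derivative K)^[n] y + ∑ j ∈ Finset.Icc 2 n, A j * (derivative K)^[n - j] y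

/-- The equation `y^(n) + ∑_{j=2}^n A_j y^(n-j) = 0` is the transform of the equation `w^(n) = 0`
under `x = f z`, `y = f'(z)^((n-1)/2) w`, where `f' = r²`. -/
def IsFormalTransformOfTrivial (n : ℕ) (A : ℕ → K⟦X⟧) (f r : K⟦X⟧) : Prop :=
  ∀ y w : K⟦X⟧, y.subst f = r ^ (n - 1) * w →
    ((derivative K)^[n] w = 0 ↔ formalLinOp n A y = 0)

/-- The equation `y^(n) + ∑_{j=2}^n A_j y^(n-j) = 0` and its source equation `y'' + q y = 0` are the
transforms of `w^(n) = 0` and of `w'' = 0` under the formal changes of variables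
`x = f z`, `y = f'(z)^((n-1)/2) w` and `x = f z`, `y = f'(z)^(1/2) w`, with the same `f`. -/
def InFormalCanonicalClass (n : ℕ) (A : ℕ → K⟦X⟧) (q : K⟦X⟧) : Prop :=
  ∃ f r : K⟦X⟧, constantCoeff f = 0 ∧ constantCoeff r ≠ 0 ∧ derivative K f = r ^ 2 ∧
    IsFormalTransformOfTrivial n A f r ∧ IsFormalTransformOfTrivial 2 (fun _ => q) f r

/-- The coordinates `x` (the variable `none`) and `y_i` (the variable `some i`) on the algebra of
formal power series. -/
def formalCoordinates (K : Type*) [Field K] (m : ℕ) :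
    Coordinates K (MvPowerSeries (Option (Fin m)) K) m where
  dx := MvPowerSeries.pderiv K none
  dy i := MvPowerSeries.pderiv K (some i)
  y i := MvPowerSeries.X (some i)

/-- A power series in `x`, as a power series in `(x, y_1, …, y_m)`. -/
def ofFormalBase (m : ℕ) (a : K⟦X⟧) : MvPowerSeries (Option (Fin m)) K :=
  PowerSeries.subst (MvPowerSeries.X none : MvPowerSeries (Option (Fin m)) K) a

end Formal

end PointSym

end

/-!
The symmetries are computed over any ring of functions of `(x, y)` with commuting partial
derivatives whose common kernel consists of the constants (`Coordinates.IsRegular`). The canonical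
class enters only through `Coordinates.IsCanonical`: the products `s_k = u^(n-1-k) v^k` solve the
scalar equation, because in the variable `z` they are products of `n - 1` affine functions, up to
the factor `f'^((n-1)/2)` (`linOp_pow_mul_pow`, `formalLinOp_pow_mul_pow`).

Let `L` be the scalar operator and `Q_i = η_i - ξ y_i'` the characteristic of a vector field. Then
`v^(n)(Δ_i) = L(D_x) Q_i + ξ D_x Δ_i` (`prolong_equation`). Since the equations have no terms of
order `n - 1`, differentiation by `y_j^(n-1)` commutes with the restriction to `Δ = 0`, and it turns
the invariance condition into `n D_x (∂Q_i/∂y_j) + (n choose 2) D_x² (∂Q_i/∂y_j') = 0`. This forces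
`ξ = ξ(x)` and `η_i = (n-1)/2 ξ' y_i + ∑ j, M_ji y_j + b_i(x)` with a constant matrix `M`
(`determining_equations`). What remains of the condition is `L b_i = 0` and the vanishing of a
linear form `∑_{l<n} ρ_l y_i^(l)`, where `ρ_(n-2)` is a third order linear operator applied to `ξ`
(`exists_residue`).

Everything else follows from the Wronskian matrix of the `s_k` being invertible
(`isUnit_det_wronskian`), which is read off from the kernel `(u(x) v(t) - v(x) u(t))^(n-1)`: its
derivatives of order less than `n - 1` vanish on the diagonal, and those of order `n - 1` are
units. The `b_i` are combinations of the `s_k` (`exists_coefficients`). For `ξ` in the span of `u²`,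
`uv`, `v²` the operator `(n-1)/2 ξ' - ξ d/dx` preserves the span of the `s_k`
(`density_mem_symSpan`), so that `∑ ρ_l d^l` annihilates all `s_k` and therefore vanishes. In
particular `u²`, `uv`, `v²` solve the third order equation `ρ_(n-2) = 0`, and variation of constants
for `n = 3` shows that its solutions are their combinations. This is
`Coordinates.IsCanonical.invariance_iff`.

The brackets show that the symmetries form an algebra `(sl₂ ⊕ gl_m) ⋉ W` with `W` abelian. Its
radical is `K 1 ⋉ W`: this ideal is solvable, and the quotients `sl₂` and `sl_m` have trivial
radical (`BracketRelations.exists_levi_decomposition`).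
-/

noncomputable section

namespace PointSym

/-! ### Lie algebras of the form `(sl₂ ⊕ gl_m) ⋉ W` -/

section SpecialLinear

open LieAlgebra LieAlgebra.SpecialLinear

variable {K ι : Type*} [Field K] [CharZero K] [Fintype ι] [DecidableEq ι]

/-- An abelian ideal of `sl` consists of diagonal matrices: for `i ≠ j` the double bracket of `X`
with `E_ij` is `-2 X_ji E_ij`, and an ideal containing `E_ij` also contains
`⁅E_ij, E_ji⁆`, which does not commute with `E_ij`. -/
lemma sl_apply_eq_zero_of_mem_abelian {I : LieIdeal K (sl ι K)} (hI : IsLieAbelian I)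
    {X : sl ι K} (hX : X ∈ I) {i j : ι} (hij : i ≠ j) : X.val j i = 0 := by
  by_contra h
  set E : sl ι K := single i j hij 1 with hE
  set F : sl ι K := single j i hij.symm 1 with hF
  have habel : ∀ Y ∈ I, ∀ Z ∈ I, ⁅Y, Z⁆ = 0 := fun Y hY Z hZ => by
    have := hI.trivial ⟨Y, hY⟩ ⟨Z, hZ⟩
    simpa [Subtype.ext_iff] using this
  have hE1 : ⁅E, ⁅E, X⁆⁆ ∈ I := lie_mem_right K _ I _ _ (lie_mem_right K _ I _ _ hX)
  have hEE : ⁅E, ⁅E, X⁆⁆ = (-2 * X.val j i) • E := by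
    have h0 : Matrix.single i j (1 : K) * Matrix.single i j 1 = 0 :=
      Matrix.single_mul_single_of_ne _ _ _ _ hij.symm _
    have h1 : Matrix.single i j (1 : K) * X.val * Matrix.single i j 1
        = X.val j i • Matrix.single i j 1 := by
      rw [Matrix.single_mul_mul_single]
      simp
    apply Subtype.ext
    rw [sl_bracket, sl_bracket]
    change Matrix.single i j (1 : K) * (Matrix.single i j 1 * X.val - X.val * Matrix.single i j 1)
      - (Matrix.single i j (1 : K) * X.val - X.val * Matrix.single i j 1) * Matrix.single i j 1
      = (-2 * X.val j i) • Matrix.single i j (1 : K)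
    rw [Matrix.mul_sub, Matrix.sub_mul, ← Matrix.mul_assoc, ← Matrix.mul_assoc, h0,
      Matrix.mul_assoc X.val, h0, h1, Matrix.zero_mul, Matrix.mul_zero]
    module
  have hEI : E ∈ I := by
    have h2 : (-2 * X.val j i) ≠ 0 := mul_ne_zero (by norm_num) h
    rw [hEE] at hE1
    have := I.smul_mem (-2 * X.val j i)⁻¹ hE1
    rwa [smul_smul, inv_mul_cancel₀ h2, one_smul] at this
  have h1 : ⁅⁅F, E⁆, E⁆ = 0 := habel _ (lie_mem_right K _ I _ _ hEI) _ hEI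
  have hFE : ⁅F, E⁆.val = Matrix.single j j 1 - Matrix.single i i 1 := by
    rw [sl_bracket]
    simp [hE, hF]
  have h2 := congrArg (fun Y : sl ι K => Y.val i j) h1
  simp only [sl_bracket] at h2
  rw [← sl_bracket, hFE] at h2
  simp [hE, Matrix.sub_mul, Matrix.mul_sub, hij.symm] at h2
  norm_num at h2

/-- The special linear Lie algebra over a field of characteristic zero has trivial radical. -/
theorem sl_hasTrivialRadical : HasTrivialRadical K (sl ι K) := by
  rw [hasTrivialRadical_iff_no_abelian_ideals]
  intro I hI
  rw [LieSubmodule.eq_bot_iff]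
  intro X hX
  have hoff : ∀ i j : ι, i ≠ j → X.val j i = 0 := fun i j hij =>
    sl_apply_eq_zero_of_mem_abelian hI hX hij
  have hdiag : ∀ i j : ι, X.val i i = X.val j j := by
    intro i j
    by_cases hij : i = j
    · rw [hij]
    have h1 : ⁅X, single i j hij (1 : K)⁆ ∈ I := lie_mem_left K _ I _ _ hX
    have h2 := sl_apply_eq_zero_of_mem_abelian hI h1 (Ne.symm hij)
    rw [sl_bracket] at h2
    simpa [sub_eq_zero] using h2
  have htr : ∑ i, X.val i i = 0 := X.2
  apply Subtype.ext
  ext i j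
  by_cases hij : i = j
  · subst hij
    rw [Finset.sum_congr rfl fun k _ => hdiag k i] at htr
    have : (Fintype.card ι : K) ≠ 0 := by
      have := Fintype.card_pos_iff.2 ⟨i⟩
      exact_mod_cast this.ne'
    simpa [this] using htr
  · simpa using hoff j i (Ne.symm hij)

end SpecialLinear

section Radical

open LieAlgebra

variable {K L L' : Type*} [CommRing K] [LieRing L] [LieAlgebra K L] [LieRing L'] [LieAlgebra K L']

lemma isSolvable_map {f : L →ₗ⁅K⁆ L'} (hf : Function.Surjective f) (I : LieIdeal K L)
    [IsSolvable I] : IsSolvable (I.map f) := by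
  let F : I →ₗ⁅K⁆ I.map f :=
    { toFun := fun x => ⟨f x, LieIdeal.mem_map x.2⟩
      map_add' := fun x y => Subtype.ext (by simp)
      map_smul' := fun r x => Subtype.ext (by simp)
      map_lie' := fun {x y} => Subtype.ext (by simp) }
  have hF : Function.Surjective F := by
    rintro ⟨y, hy⟩
    obtain ⟨x, hx⟩ := LieIdeal.mem_map_of_surjective hf hy
    exact ⟨x, Subtype.ext hx⟩
  exact hF.lieAlgebra_isSolvable

/-- A surjection onto a Lie algebra with trivial radical annihilates the radical. -/
lemma apply_eq_zero_of_mem_radical [IsNoetherian K L] [HasTrivialRadical K L'] {f : L →ₗ⁅K⁆ L'}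
    (hf : Function.Surjective f) {x : L} (hx : x ∈ radical K L) : f x = 0 := by
  have := isSolvable_map hf (radical K L)
  have h := HasTrivialRadical.eq_bot_of_isSolvable ((radical K L).map f)
  have hx' := LieIdeal.mem_map (f := f) hx
  rwa [h, LieSubmodule.mem_bot] at hx'

end Radical

section Levi

-- The bracket of matrices is the commutator.
attribute [local instance 100] LieRing.ofAssociativeRing

open LieAlgebra LieAlgebra.SpecialLinear

variable {K D : Type*} [Field K] [LieRing D] [LieAlgebra K D] {m n : ℕ}

/-- The bracket relations of a Lie algebra of the form `(sl₂ ⊕ gl_m) ⋉ W` with `W` abelian, inside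
an ambient Lie algebra `D`; the three linear maps `ρ`, `σ`, `τ` are jointly injective. -/
structure BracketRelations (ρ : sl (Fin 2) K →ₗ[K] D) (σ : Matrix (Fin m) (Fin m) K →ₗ[K] D)
    (τ : (Fin n → Fin m → K) →ₗ[K] D) : Prop where
  lie_ρ_ρ : ∀ x y, ⁅ρ x, ρ y⁆ = ρ ⁅x, y⁆
  lie_σ_σ : ∀ a b, ⁅σ a, σ b⁆ = σ (a * b - b * a)
  lie_ρ_σ : ∀ x a, ⁅ρ x, σ a⁆ = 0
  lie_ρ_τ : ∀ x w, ∃ w', ⁅ρ x, τ w⁆ = τ w'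
  lie_σ_τ : ∀ a w, ∃ w', ⁅σ a, τ w⁆ = τ w'
  lie_τ_τ : ∀ w w', ⁅τ w, τ w'⁆ = 0
  injective : ∀ x a w, ρ x + σ a + τ w = 0 → x = 0 ∧ a = 0 ∧ w = 0

namespace BracketRelations

variable {ρ : sl (Fin 2) K →ₗ[K] D} {σ : Matrix (Fin m) (Fin m) K →ₗ[K] D}
  {τ : (Fin n → Fin m → K) →ₗ[K] D}

/-- The vector space `sl₂ × gl_m × W` underlying the Lie algebra. -/
abbrev Carrier (K : Type*) [Field K] (m n : ℕ) : Type _ :=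
  sl (Fin 2) K × Matrix (Fin m) (Fin m) K × (Fin n → Fin m → K)

/-- The joint map `(x, a, w) ↦ ρ x + σ a + τ w`. -/
def total (ρ : sl (Fin 2) K →ₗ[K] D) (σ : Matrix (Fin m) (Fin m) K →ₗ[K] D)
    (τ : (Fin n → Fin m → K) →ₗ[K] D) : Carrier K m n →ₗ[K] D :=
  ρ.coprod (σ.coprod τ)

lemma total_apply (x : Carrier K m n) : total ρ σ τ x = ρ x.1 + σ x.2.1 + τ x.2.2 := by
  simp [total, add_assoc]

variable (h : BracketRelations ρ σ τ)
include h

lemma total_injective : Function.Injective (total ρ σ τ) := by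
  rw [injective_iff_map_eq_zero]
  intro x hx
  rw [total_apply] at hx
  obtain ⟨h1, h2, h3⟩ := h.injective _ _ _ hx
  exact Prod.ext h1 (Prod.ext h2 h3)

lemma lie_total (x y : Carrier K m n) : ∃ w, ⁅total ρ σ τ x, total ρ σ τ y⁆
    = total ρ σ τ (⁅x.1, y.1⁆, x.2.1 * y.2.1 - y.2.1 * x.2.1, w) := by
  obtain ⟨w1, h1⟩ := h.lie_ρ_τ x.1 y.2.2
  obtain ⟨w2, h2⟩ := h.lie_σ_τ x.2.1 y.2.2
  obtain ⟨w3, h3⟩ := h.lie_ρ_τ y.1 x.2.2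
  obtain ⟨w4, h4⟩ := h.lie_σ_τ y.2.1 x.2.2
  refine ⟨w1 + w2 - w3 - w4, ?_⟩
  have h5 : ⁅σ x.2.1, ρ y.1⁆ = 0 := by rw [← lie_skew, h.lie_ρ_σ, neg_zero]
  have h6 : ⁅τ x.2.2, ρ y.1⁆ = - τ w3 := by rw [← lie_skew, h3]
  have h7 : ⁅τ x.2.2, σ y.2.1⁆ = - τ w4 := by rw [← lie_skew, h4]
  simp only [total_apply, lie_add, add_lie, h.lie_ρ_ρ, h.lie_σ_σ, h.lie_ρ_σ, h.lie_τ_τ, h1, h2, h5,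
    h6, h7, map_add, map_sub]
  abel

/-- The Lie algebra `ρ(sl₂) + σ(gl_m) + τ(W)`. -/
def algebra : LieSubalgebra K D where
  toSubmodule := LinearMap.range (total ρ σ τ)
  lie_mem' := by
    rintro _ _ ⟨x, rfl⟩ ⟨y, rfl⟩
    obtain ⟨w, hw⟩ := h.lie_total x y
    exact ⟨_, hw.symm⟩

/-- The identification of `sl₂ × gl_m × W` with the Lie algebra. -/
def equiv : Carrier K m n ≃ₗ[K] h.algebra :=
  LinearEquiv.ofInjective (total ρ σ τ) h.total_injective

lemma lie_equiv (x y : Carrier K m n) : ∃ w, ⁅h.equiv x, h.equiv y⁆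
    = h.equiv (⁅x.1, y.1⁆, x.2.1 * y.2.1 - y.2.1 * x.2.1, w) := by
  obtain ⟨w, hw⟩ := h.lie_total x y
  exact ⟨w, Subtype.ext hw⟩

lemma map_map_subtype (P : Submodule K (Carrier K m n)) :
    (P.map h.equiv.toLinearMap).map h.algebra.toSubmodule.subtype = P.map (total ρ σ τ) := by
  rw [← Submodule.map_comp]
  rfl

/-- The subalgebra corresponding to a subspace of `sl₂ × gl_m × W` closed under the bracket. -/
def subalgebra (P : Submodule K (Carrier K m n))
    (hP : ∀ x ∈ P, ∀ y ∈ P, ⁅h.equiv x, h.equiv y⁆ ∈ P.map h.equiv.toLinearMap) :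
    LieSubalgebra K h.algebra where
  toSubmodule := P.map h.equiv.toLinearMap
  lie_mem' := by
    rintro _ _ ⟨x, hx, rfl⟩ ⟨y, hy, rfl⟩
    exact hP x hx y hy

/-- The ideal corresponding to a subspace of `sl₂ × gl_m × W` stable under the bracket. -/
def ideal (P : Submodule K (Carrier K m n))
    (hP : ∀ x, ∀ y ∈ P, ⁅h.equiv x, h.equiv y⁆ ∈ P.map h.equiv.toLinearMap) :
    LieIdeal K h.algebra where
  toSubmodule := P.map h.equiv.toLinearMap
  lie_mem := by
    rintro x _ ⟨y, hy, rfl⟩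
    obtain ⟨x, rfl⟩ := h.equiv.surjective x
    exact hP x y hy

lemma lie_mem_map {P : Submodule K (Carrier K m n)} {x y : Carrier K m n}
    (hP : ∀ w, (⁅x.1, y.1⁆, x.2.1 * y.2.1 - y.2.1 * x.2.1, w) ∈ P) :
    ⁅h.equiv x, h.equiv y⁆ ∈ P.map h.equiv.toLinearMap := by
  obtain ⟨w, hw⟩ := h.lie_equiv x y
  rw [hw]
  exact Submodule.mem_map_of_mem (hP w)

/-- The bracket of two elements of the Levi factor has no component in `W`. -/
lemma lie_equiv_levi (x x' : sl (Fin 2) K) (a a' : Matrix (Fin m) (Fin m) K) :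
    ⁅h.equiv (x, a, 0), h.equiv (x', a', 0)⁆ = h.equiv (⁅x, x'⁆, a * a' - a' * a, 0) := by
  apply Subtype.ext
  have h5 : ⁅σ a, ρ x'⁆ = 0 := by rw [← lie_skew, h.lie_ρ_σ, neg_zero]
  change ⁅total ρ σ τ (x, a, 0), total ρ σ τ (x', a', 0)⁆ = total ρ σ τ _
  simp [total_apply, h.lie_ρ_ρ, h.lie_σ_σ, h.lie_ρ_σ, h5]

/-- The quotient map onto `sl₂`. -/
def toSlTwo : h.algebra →ₗ⁅K⁆ sl (Fin 2) K where
  toLinearMap := LinearMap.fst K _ _ ∘ₗ h.equiv.symm.toLinearMap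
  map_lie' := by
    intro x y
    obtain ⟨x, rfl⟩ := h.equiv.surjective x
    obtain ⟨y, rfl⟩ := h.equiv.surjective y
    obtain ⟨w, hw⟩ := h.lie_equiv x y
    simp [hw]

lemma toSlTwo_equiv (x : Carrier K m n) : h.toSlTwo (h.equiv x) = x.1 := by
  change (h.equiv.symm (h.equiv x)).1 = _
  rw [LinearEquiv.symm_apply_apply]

end BracketRelations

/-- The projection of a matrix to its traceless part. -/
def tracelessPart (K : Type*) [Field K] [CharZero K] (m : ℕ) :
    Matrix (Fin m) (Fin m) K →ₗ[K] sl (Fin m) K :=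
  LinearMap.codRestrict (sl (Fin m) K).toSubmodule
    (LinearMap.id - (Matrix.traceLinearMap (Fin m) K K).smulRight
      ((m : K)⁻¹ • (1 : Matrix (Fin m) (Fin m) K))) (fun a => by
    change Matrix.trace (n := Fin m) (R := K) _ = 0
    rcases Nat.eq_zero_or_pos m with rfl | hm
    · simp [Matrix.trace]
    · have : (m : K) ≠ 0 := by exact_mod_cast hm.ne'
      simp [Matrix.trace_sub, Matrix.trace_smul, this])

lemma tracelessPart_val [CharZero K] (a : Matrix (Fin m) (Fin m) K) :
    (tracelessPart K m a).val = a - (a.trace * (m : K)⁻¹) • 1 := by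
  change a - a.trace • ((m : K)⁻¹ • (1 : Matrix (Fin m) (Fin m) K)) = _
  rw [smul_smul]

lemma tracelessPart_of_mem [CharZero K] (a : sl (Fin m) K) : tracelessPart K m a.val = a := by
  apply Subtype.ext
  have h : a.val.trace = 0 := a.2
  rw [tracelessPart_val, h, zero_mul, zero_smul, sub_zero]

lemma tracelessPart_lie [CharZero K] (a b : Matrix (Fin m) (Fin m) K) :
    tracelessPart K m (a * b - b * a) = ⁅tracelessPart K m a, tracelessPart K m b⁆ := by
  apply Subtype.ext
  rw [sl_bracket, tracelessPart_val, tracelessPart_val, tracelessPart_val, Matrix.trace_sub,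
    Matrix.trace_mul_comm a b]
  simp only [sub_self, zero_mul, zero_smul, sub_zero, Matrix.sub_mul, Matrix.mul_sub,
    Matrix.smul_mul, Matrix.mul_smul, Matrix.one_mul, Matrix.mul_one]
  module

lemma mem_span_one_of_tracelessPart_eq_zero [CharZero K] {a : Matrix (Fin m) (Fin m) K}
    (ha : tracelessPart K m a = 0) : a ∈ Submodule.span K {(1 : Matrix (Fin m) (Fin m) K)} := by
  have := congrArg Subtype.val ha
  rw [tracelessPart_val] at this
  rw [sub_eq_zero.1 this]
  exact Submodule.smul_mem _ _ (Submodule.mem_span_singleton_self _)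

lemma isCompl_sl_span_one [CharZero K] (hm : 0 < m) :
    IsCompl (sl (Fin m) K).toSubmodule (Submodule.span K {(1 : Matrix (Fin m) (Fin m) K)}) := by
  have hm' : (m : K) ≠ 0 := by exact_mod_cast hm.ne'
  constructor
  · rw [Submodule.disjoint_def]
    intro a ha h1
    obtain ⟨r, rfl⟩ := Submodule.mem_span_singleton.1 h1
    have : Matrix.trace (r • (1 : Matrix (Fin m) (Fin m) K)) = 0 := ha
    have hr : r = 0 := by simpa [Matrix.trace_smul, hm'] using this
    rw [hr, zero_smul]
  · rw [codisjoint_iff, eq_top_iff]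
    intro a _
    have h : a = (tracelessPart K m a).val + (a.trace * (m : K)⁻¹) • 1 := by
      rw [tracelessPart_val]; abel
    rw [h]
    exact Submodule.add_mem_sup (tracelessPart K m a).2
      (Submodule.smul_mem _ _ (Submodule.mem_span_singleton_self _))

namespace BracketRelations

variable {ρ : sl (Fin 2) K →ₗ[K] D} {σ : Matrix (Fin m) (Fin m) K →ₗ[K] D}
  {τ : (Fin n → Fin m → K) →ₗ[K] D}

/-- The quotient map onto `sl_m`. -/
def toSl [CharZero K] (h : BracketRelations ρ σ τ) : h.algebra →ₗ⁅K⁆ sl (Fin m) K where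
  toLinearMap := tracelessPart K m ∘ₗ LinearMap.fst K _ _ ∘ₗ LinearMap.snd K _ _ ∘ₗ
    h.equiv.symm.toLinearMap
  map_lie' := by
    intro x y
    obtain ⟨x, rfl⟩ := h.equiv.surjective x
    obtain ⟨y, rfl⟩ := h.equiv.surjective y
    obtain ⟨w, hw⟩ := h.lie_equiv x y
    simp [hw, ← tracelessPart_lie]

lemma toSl_equiv [CharZero K] (h : BracketRelations ρ σ τ) (x : Carrier K m n) :
    h.toSl (h.equiv x) = tracelessPart K m x.2.1 := by
  change tracelessPart K m (h.equiv.symm (h.equiv x)).2.1 = _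
  rw [LinearEquiv.symm_apply_apply]

open Submodule in
/-- The Levi decomposition of a Lie algebra `(sl₂ ⊕ gl_m) ⋉ W` with `W` abelian. -/
theorem exists_levi_decomposition [CharZero K] (h : BracketRelations ρ σ τ) (hm : 0 < m) :
    ∃ g : LieSubalgebra K D,
      g.toSubmodule = LinearMap.range (total ρ σ τ) ∧
      Module.finrank K g = m ^ 2 + n * m + 3 ∧
      ∃ (gF gH sH gHS levi : LieSubalgebra K g) (gS : LieIdeal K g) (KH₀ : Submodule K g),
        gF.toSubmodule.map g.toSubmodule.subtype = LinearMap.range ρ ∧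
        gH.toSubmodule.map g.toSubmodule.subtype = LinearMap.range σ ∧
        gS.toSubmodule.map g.toSubmodule.subtype = LinearMap.range τ ∧
        sH.toSubmodule.map g.toSubmodule.subtype = (sl (Fin m) K).toSubmodule.map σ ∧
        KH₀.map g.toSubmodule.subtype = Submodule.span K {σ 1} ∧
        Module.finrank K gF = 3 ∧
        Nonempty (gF ≃ₗ⁅K⁆ sl (Fin 2) K) ∧
        Disjoint gH.toSubmodule gS.toSubmodule ∧
        gHS.toSubmodule = gH.toSubmodule ⊔ gS.toSubmodule ∧
        IsCompl gF.toSubmodule gHS.toSubmodule ∧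
        Nonempty (sH ≃ₗ⁅K⁆ sl (Fin m) K) ∧
        IsLieAbelian gS ∧
        levi.toSubmodule = gF.toSubmodule ⊔ sH.toSubmodule ∧
        Disjoint gF.toSubmodule sH.toSubmodule ∧
        (∀ X ∈ gF, ∀ Y ∈ sH, ⁅X, Y⁆ = 0) ∧
        LieAlgebra.IsSemisimple K levi ∧
        (LieAlgebra.radical K g).toSubmodule = gS.toSubmodule ⊔ KH₀ ∧
        Disjoint gS.toSubmodule KH₀ ∧
        IsCompl levi.toSubmodule (LieAlgebra.radical K g).toSubmodule := by
  -- All subspaces are images under `e` of products of subspaces of `sl₂`, `gl_m` and `W`.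
  let e := h.equiv
  have : Module.Finite K h.algebra := Module.Finite.equiv e
  let sm := (sl (Fin m) K).toSubmodule
  let o := span K {(1 : Matrix (Fin m) (Fin m) K)}
  let PF : Submodule K (Carrier K m n) := Submodule.prod ⊤ ⊥
  let PH : Submodule K (Carrier K m n) := Submodule.prod ⊥ (Submodule.prod ⊤ ⊥)
  let PS : Submodule K (Carrier K m n) := Submodule.prod ⊥ (Submodule.prod ⊥ ⊤)
  let PsH : Submodule K (Carrier K m n) := Submodule.prod ⊥ (Submodule.prod sm ⊥)
  let PO : Submodule K (Carrier K m n) := Submodule.prod ⊥ (Submodule.prod o ⊥)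
  let PHS : Submodule K (Carrier K m n) := Submodule.prod ⊥ ⊤
  let PL : Submodule K (Carrier K m n) := Submodule.prod ⊤ (Submodule.prod sm ⊥)
  let PR : Submodule K (Carrier K m n) := Submodule.prod ⊥ (Submodule.prod o ⊤)
  have hsm : ∀ a b : Matrix (Fin m) (Fin m) K, a * b - b * a ∈ sm := fun a b => by
    change Matrix.trace (a * b - b * a) = 0
    rw [Matrix.trace_sub, Matrix.trace_mul_comm, sub_self]
  have hcompl := isCompl_sl_span_one (K := K) hm
  have hsl2 : Module.finrank K (sl (Fin 2) K) = 3 := by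
    have h1 := finrank_add_eq_of_isCompl (isCompl_sl_span_one (K := K) (m := 2) (by norm_num))
    rw [finrank_span_singleton one_ne_zero, Module.finrank_matrix] at h1
    simp only [Fintype.card_fin, Module.finrank_self] at h1
    exact (by omega : Module.finrank K (sl (Fin 2) K).toSubmodule = 3)
  have levi_mem (S : Submodule K (Carrier K m n)) (x x' : sl (Fin 2) K)
      (a a' : Matrix (Fin m) (Fin m) K) (hS : (⁅x, x'⁆, a * a' - a' * a, 0) ∈ S) :
      ⁅e (x, a, 0), e (x', a', 0)⁆ ∈ S.map e.toLinearMap := by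
    rw [h.lie_equiv_levi]
    exact mem_map_of_mem hS
  let gF := h.subalgebra PF (by
    rintro ⟨x, y⟩ ⟨-, rfl : y = 0⟩ ⟨x', y'⟩ ⟨-, rfl : y' = 0⟩
    exact levi_mem PF x x' 0 0 (by simp [PF, Prod.ext_iff]))
  let gH := h.subalgebra PH (by
    rintro ⟨x, a, w⟩ ⟨rfl : x = 0, -, rfl : w = 0⟩ ⟨x', a', w'⟩ ⟨rfl : x' = 0, -, rfl : w' = 0⟩
    exact levi_mem PH 0 0 a a' (by simp [PH]))
  let sH := h.subalgebra PsH (by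
    rintro ⟨x, a, w⟩ ⟨rfl : x = 0, -, rfl : w = 0⟩ ⟨x', a', w'⟩ ⟨rfl : x' = 0, -, rfl : w' = 0⟩
    exact levi_mem PsH 0 0 a a' (by simp [PsH, hsm]))
  let levi := h.subalgebra PL (by
    rintro ⟨x, a, w⟩ ⟨-, -, rfl : w = 0⟩ ⟨x', a', w'⟩ ⟨-, -, rfl : w' = 0⟩
    exact levi_mem PL x x' a a' (by simp [PL, hsm]))
  let gHS := h.subalgebra PHS (by
    rintro ⟨x, y⟩ ⟨rfl : x = 0, -⟩ ⟨x', y'⟩ ⟨rfl : x' = 0, -⟩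
    exact h.lie_mem_map fun w => by simp [PHS])
  let gS := h.ideal PS (by
    rintro ⟨x, a, w⟩ ⟨x', a', w'⟩ ⟨rfl : x' = 0, rfl : a' = 0, -⟩
    exact h.lie_mem_map fun w => by simp [PS])
  let R := h.ideal PR (by
    rintro ⟨x, a, w⟩ ⟨x', a', w'⟩ ⟨rfl : x' = 0, ho : a' ∈ o, -⟩
    obtain ⟨r, rfl⟩ := mem_span_singleton.1 ho
    exact h.lie_mem_map fun w => by simp [PR])
  have hmap_sup (P Q : Submodule K (Carrier K m n)) :
      (P ⊔ Q).map e.toLinearMap = P.map e.toLinearMap ⊔ Q.map e.toLinearMap := map_sup _ _ _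
  have hdisj {P Q : Submodule K (Carrier K m n)} (hPQ : Disjoint P Q) :
      Disjoint (P.map e.toLinearMap) (Q.map e.toLinearMap) :=
    disjoint_map e.injective hPQ
  have hcod {P Q : Submodule K (Carrier K m n)} (hPQ : IsCompl P Q) :
      IsCompl (P.map e.toLinearMap) (Q.map e.toLinearMap) := by
    refine ⟨hdisj hPQ.1, ?_⟩
    rw [codisjoint_iff, ← hmap_sup, hPQ.sup_eq_top, Submodule.map_top, LinearMap.range_eq_top]
    exact e.surjective
  have hprod {P Q : Submodule K (sl (Fin 2) K)}
      {P' Q' : Submodule K (Matrix (Fin m) (Fin m) K × (Fin n → Fin m → K))}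
      (h1 : Disjoint P Q) (h2 : Disjoint P' Q') : Disjoint (P.prod P') (Q.prod Q') := by
    rw [disjoint_iff, prod_inf_prod, h1.eq_bot, h2.eq_bot, prod_bot]
  have hprod' {P Q : Submodule K (Matrix (Fin m) (Fin m) K)}
      {P' Q' : Submodule K (Fin n → Fin m → K)}
      (h1 : Disjoint P Q) (h2 : Disjoint P' Q') : Disjoint (P.prod P') (Q.prod Q') := by
    rw [disjoint_iff, prod_inf_prod, h1.eq_bot, h2.eq_bot, prod_bot]
  have hS_abel : IsLieAbelian gS := by
    refine ⟨?_⟩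
    rintro ⟨_, ⟨x, a, w⟩, ⟨rfl : x = 0, rfl : a = 0, -⟩, rfl⟩
      ⟨_, ⟨x', a', w'⟩, ⟨rfl : x' = 0, rfl : a' = 0, -⟩, rfl⟩
    apply Subtype.ext
    apply Subtype.ext
    change ⁅total ρ σ τ (0, 0, w), total ρ σ τ (0, 0, w')⁆ = 0
    simp [total_apply, h.lie_τ_τ]
  have hlieR : ∀ x ∈ R, ∀ y ∈ R, ⁅x, y⁆ ∈ gS := by
    rintro _ ⟨⟨x, a, w⟩, ⟨rfl : x = 0, ha : a ∈ o, -⟩, rfl⟩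
      _ ⟨⟨x', a', w'⟩, ⟨rfl : x' = 0, ha' : a' ∈ o, -⟩, rfl⟩
    obtain ⟨r, rfl⟩ := mem_span_singleton.1 ha
    obtain ⟨r', rfl⟩ := mem_span_singleton.1 ha'
    refine h.lie_mem_map (P := PS) fun w => ?_
    simp [PS, smul_smul, mul_comm]
  -- `[R, R] ⊆ W` and `W` is abelian, so that the second derived ideal of `R` vanishes.
  have hR_solv : IsSolvable R := by
    rw [isSolvable_iff K]
    refine ⟨2, ?_⟩
    rw [LieIdeal.derivedSeries_eq_bot_iff, derivedSeriesOfIdeal_succ, derivedSeriesOfIdeal_succ,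
      derivedSeriesOfIdeal_zero, eq_bot_iff]
    have h1 : ⁅R, R⁆ ≤ gS := by
      rw [LieSubmodule.lie_le_iff]
      exact hlieR
    refine (LieSubmodule.mono_lie h1 h1).trans ?_
    rw [LieSubmodule.lie_le_iff]
    intro x hx y hy
    have := hS_abel.trivial ⟨x, hx⟩ ⟨y, hy⟩
    rw [LieSubmodule.mem_bot]
    exact congrArg Subtype.val this
  -- Conversely the radical is annihilated by the quotient maps onto `sl₂` and `sl_m`, whose common
  -- kernel is `R`.
  have hrad : radical K h.algebra = R := by
    apply le_antisymm
    · intro X hX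
      obtain ⟨⟨x, a, w⟩, rfl⟩ := e.surjective X
      have := sl_hasTrivialRadical (K := K) (ι := Fin 2)
      have := sl_hasTrivialRadical (K := K) (ι := Fin m)
      have h1 := apply_eq_zero_of_mem_radical (f := h.toSlTwo)
        (fun x => ⟨e (x, 0, 0), h.toSlTwo_equiv _⟩) hX
      have h2 := apply_eq_zero_of_mem_radical (f := h.toSl)
        (fun a => ⟨e (0, a.val, 0), (h.toSl_equiv _).trans (tracelessPart_of_mem a)⟩) hX
      rw [h.toSlTwo_equiv] at h1
      rw [h.toSl_equiv] at h2
      exact mem_map_of_mem (p := PR) ⟨h1, mem_span_one_of_tracelessPart_eq_zero h2, trivial⟩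
    · exact (LieIdeal.solvable_iff_le_radical K h.algebra R).1 hR_solv
  -- The same quotient maps are jointly injective on the Levi factor; semisimplicity follows from
  -- the trivial radical in characteristic zero.
  have hlevi_triv : HasTrivialRadical K levi := by
    refine ⟨?_⟩
    rw [LieSubmodule.eq_bot_iff]
    intro X hX
    obtain ⟨⟨x, a, w⟩, ⟨-, ha, hw⟩, hXe⟩ := X.2
    obtain rfl : w = 0 := hw
    replace hXe : e (x, a, 0) = X.val := hXe
    have := sl_hasTrivialRadical (K := K) (ι := Fin 2)
    have := sl_hasTrivialRadical (K := K) (ι := Fin m)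
    have h1 := apply_eq_zero_of_mem_radical (f := h.toSlTwo.comp levi.incl)
      (fun x => ⟨⟨e (x, 0, 0), mem_map_of_mem (p := PL) (by simp [PL])⟩, h.toSlTwo_equiv _⟩) hX
    have h2 := apply_eq_zero_of_mem_radical (f := h.toSl.comp levi.incl)
      (fun a => ⟨⟨e (0, a.val, 0), mem_map_of_mem (p := PL) ⟨trivial, a.2, rfl⟩⟩,
        (h.toSl_equiv _).trans (tracelessPart_of_mem a)⟩) hX
    change h.toSlTwo X.val = 0 at h1
    change h.toSl X.val = 0 at h2
    rw [← hXe, h.toSlTwo_equiv] at h1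
    rw [← hXe, h.toSl_equiv] at h2
    have h3 := (tracelessPart_of_mem ⟨a, ha⟩).symm.trans h2
    have h4 : a = 0 := congrArg Subtype.val h3
    obtain rfl : x = 0 := h1
    subst h4
    apply Subtype.ext
    rw [← hXe]
    exact map_zero e
  let eF : sl (Fin 2) K ≃ₗ⁅K⁆ gF := LieEquiv.ofBijective
    { toFun := fun x => ⟨e (x, 0, 0), mem_map_of_mem (p := PF) (by simp [PF])⟩
      map_add' := fun x y => Subtype.ext (by
        change e _ = e _ + e _
        rw [← map_add]; simp)
      map_smul' := fun r x => Subtype.ext (by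
        change e _ = r • e _
        rw [← map_smul]; simp)
      map_lie' := fun {x y} => Subtype.ext (by
        change e _ = ⁅e _, e _⁆
        rw [h.lie_equiv_levi]; simp [e]) }
    ⟨fun x y hxy => by
        have := e.injective (congrArg Subtype.val hxy)
        exact congrArg Prod.fst this,
      by
        rintro ⟨_, ⟨x, y⟩, ⟨-, rfl : y = 0⟩, rfl⟩
        exact ⟨x, rfl⟩⟩
  let eH : sl (Fin m) K ≃ₗ⁅K⁆ sH := LieEquiv.ofBijective
    { toFun := fun a => ⟨e (0, a.val, 0), mem_map_of_mem (p := PsH) ⟨rfl, a.2, rfl⟩⟩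
      map_add' := fun x y => Subtype.ext (by
        change e _ = e _ + e _
        rw [← map_add]; simp)
      map_smul' := fun r x => Subtype.ext (by
        change e _ = r • e _
        rw [← map_smul]; simp)
      map_lie' := fun {x y} => Subtype.ext (by
        change e _ = ⁅e _, e _⁆
        rw [h.lie_equiv_levi, sl_bracket]; simp [e]) }
    ⟨fun x y hxy => by
        have := e.injective (congrArg Subtype.val hxy)
        exact Subtype.ext (congrArg (fun z => z.2.1) this),
      by
        rintro ⟨_, ⟨x, a, w⟩, ⟨rfl : x = 0, ha, rfl : w = 0⟩, rfl⟩
        exact ⟨⟨a, ha⟩, rfl⟩⟩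
  refine ⟨h.algebra, rfl, ?_, gF, gH, sH, gHS, levi, gS, PO.map e.toLinearMap, ?_, ?_, ?_, ?_, ?_,
    ?_, ⟨eF.symm⟩, ?_, ?_, ?_, ⟨eH.symm⟩, hS_abel, ?_, ?_, ?_, inferInstance, ?_, ?_, ?_⟩
  · rw [← e.finrank_eq, Module.finrank_prod, Module.finrank_prod, hsl2, Module.finrank_matrix,
      Module.finrank_pi_fintype]
    simp only [Fintype.card_fin, Module.finrank_self, Module.finrank_fintype_fun_eq_card,
      Finset.sum_const, Finset.card_univ, smul_eq_mul]
    ring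
  · refine (h.map_map_subtype PF).trans (Submodule.ext fun X => ⟨?_, ?_⟩)
    · rintro ⟨⟨x, y⟩, ⟨-, rfl : y = 0⟩, rfl⟩
      exact ⟨x, by simp [total_apply]⟩
    · rintro ⟨x, rfl⟩
      exact ⟨(x, 0, 0), by simp [PF], by simp [total_apply]⟩
  · refine (h.map_map_subtype PH).trans (Submodule.ext fun X => ⟨?_, ?_⟩)
    · rintro ⟨⟨x, a, w⟩, ⟨rfl : x = 0, -, rfl : w = 0⟩, rfl⟩
      exact ⟨a, by simp [total_apply]⟩
    · rintro ⟨a, rfl⟩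
      exact ⟨(0, a, 0), by simp [PH], by simp [total_apply]⟩
  · refine (h.map_map_subtype PS).trans (Submodule.ext fun X => ⟨?_, ?_⟩)
    · rintro ⟨⟨x, a, w⟩, ⟨rfl : x = 0, rfl : a = 0, -⟩, rfl⟩
      exact ⟨w, by simp [total_apply]⟩
    · rintro ⟨w, rfl⟩
      exact ⟨(0, 0, w), by simp [PS], by simp [total_apply]⟩
  · refine (h.map_map_subtype PsH).trans (Submodule.ext fun X => ⟨?_, ?_⟩)
    · rintro ⟨⟨x, a, w⟩, ⟨rfl : x = 0, ha, rfl : w = 0⟩, rfl⟩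
      exact ⟨a, ha, by simp [total_apply]⟩
    · rintro ⟨a, ha, rfl⟩
      exact ⟨(0, a, 0), ⟨rfl, ha, rfl⟩, by simp [total_apply]⟩
  · refine (h.map_map_subtype PO).trans ?_
    rw [← Set.image_singleton, ← map_span]
    refine Submodule.ext fun X => ⟨?_, ?_⟩
    · rintro ⟨⟨x, a, w⟩, ⟨rfl : x = 0, ha, rfl : w = 0⟩, rfl⟩
      exact ⟨a, ha, by simp [total_apply]⟩
    · rintro ⟨a, ha, rfl⟩
      exact ⟨(0, a, 0), ⟨rfl, ha, rfl⟩, by simp [total_apply]⟩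
  · rw [← hsl2]
    exact eF.symm.toLinearEquiv.finrank_eq
  · exact hdisj (hprod disjoint_bot_left (hprod' disjoint_bot_right disjoint_bot_left))
  · refine Eq.trans ?_ (hmap_sup PH PS)
    simp only [PH, PS, prod_sup_prod, bot_sup_eq, sup_bot_eq, prod_top]
    rfl
  · refine hcod ⟨hprod disjoint_bot_right disjoint_bot_left, ?_⟩
    rw [codisjoint_iff, prod_sup_prod, sup_bot_eq, bot_sup_eq, prod_top]
  · refine Eq.trans ?_ (hmap_sup PF PsH)
    simp only [PF, PsH, prod_sup_prod, bot_sup_eq, sup_bot_eq]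
    rfl
  · exact hdisj (hprod disjoint_bot_right disjoint_bot_left)
  · rintro _ ⟨⟨x, y⟩, ⟨-, rfl : y = 0⟩, rfl⟩ _ ⟨⟨x', a, w⟩, ⟨rfl : x' = 0, -, rfl : w = 0⟩, rfl⟩
    refine (h.lie_equiv_levi x 0 0 a).trans ?_
    simp only [lie_zero, zero_mul, mul_zero, sub_zero]
    exact map_zero e.toLinearMap
  · rw [hrad]
    refine Eq.trans ?_ (hmap_sup PS PO)
    simp only [PS, PO, prod_sup_prod, bot_sup_eq, top_sup_eq]
    rfl
  · exact hdisj (hprod disjoint_bot_left (hprod' disjoint_bot_left disjoint_bot_right))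
  · rw [hrad]
    refine hcod ⟨hprod disjoint_bot_right (hprod' hcompl.1 disjoint_bot_left), ?_⟩
    rw [codisjoint_iff, prod_sup_prod, prod_sup_prod, sup_bot_eq, bot_sup_eq, hcompl.sup_eq_top,
      prod_top, prod_top]

end BracketRelations

end Levi

/-! ### Total derivatives, prolongation and characteristics -/

section JetCalculus

variable {K O : Type*} [Field K] [CommRing O] [Algebra K O] {m : ℕ}

/-- The properties of the partial derivatives and coordinate functions on which the classification
of point symmetries rests; functions with vanishing partial derivatives are constant. -/
structure Coordinates.IsRegular (c : Coordinates K O m) : Prop where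
  dx_y : ∀ i, c.dx (c.y i) = 0
  dy_y : ∀ i j, c.dy i (c.y j) = if i = j then 1 else 0
  dx_dy : ∀ i f, c.dx (c.dy i f) = c.dy i (c.dx f)
  dy_dy : ∀ i j f, c.dy i (c.dy j f) = c.dy j (c.dy i f)
  exists_const : ∀ f, c.dx f = 0 → (∀ i, c.dy i f = 0) → ∃ k : K, f = algebraMap K O k

lemma coeff_mapCoeff (δ : Derivation K O O) (P : Jet O m) (s : Fin m × ℕ →₀ ℕ) :
    (mapCoeff δ P).coeff s = δ (P.coeff s) := by
  classical
  rw [mapCoeff, MvPolynomial.coeff_sum]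
  simp only [MvPolynomial.coeff_monomial]
  rw [Finset.sum_ite_eq']
  split_ifs with h
  · rfl
  · rw [MvPolynomial.notMem_support_iff.1 h, map_zero]

/-- The coefficientwise action of a derivation of the functions of `(x, y)`, as a derivation of the
differential functions. -/
def coeffDeriv (δ : Derivation K O O) : Derivation K (Jet O m) (Jet O m) :=
  Derivation.mk'
    { toFun := mapCoeff δ
      map_add' := fun P Q => by
        ext s
        simp [coeff_mapCoeff]
      map_smul' := fun r P => by
        ext s
        simp [coeff_mapCoeff] }
    (fun P Q => by
      classical
      ext s
      simp only [LinearMap.coe_mk, AddHom.coe_mk, smul_eq_mul, coeff_mapCoeff,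
        MvPolynomial.coeff_add, MvPolynomial.coeff_mul, map_sum, Derivation.leibniz,
        Finset.sum_add_distrib]
      congr 1
      exact Finset.sum_equiv (Equiv.prodComm _ _)
        (by simp [add_comm]) (by simp))

lemma coeffDeriv_apply (δ : Derivation K O O) (P : Jet O m) : coeffDeriv δ P = mapCoeff δ P := rfl

@[simp] lemma coeffDeriv_C (δ : Derivation K O O) (f : O) :
    coeffDeriv δ (MvPolynomial.C f : Jet O m) = MvPolynomial.C (δ f) := by
  classical
  ext s
  rw [coeffDeriv_apply, coeff_mapCoeff, MvPolynomial.coeff_C, MvPolynomial.coeff_C]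
  split_ifs <;> simp

@[simp] lemma coeffDeriv_X (δ : Derivation K O O) (p : Fin m × ℕ) :
    coeffDeriv δ (MvPolynomial.X p : Jet O m) = 0 := by
  classical
  ext s
  rw [coeffDeriv_apply, coeff_mapCoeff, MvPolynomial.coeff_X]
  split_ifs <;> simp

/-- A derivation of the differential functions is determined by its values on the functions of
`(x, y)` and on the derivatives `y_i^(k)`, `k ≥ 1`. -/
lemma jetDerivation_ext {d d' : Derivation K (Jet O m) (Jet O m)}
    (hC : ∀ f : O, d (MvPolynomial.C f) = d' (MvPolynomial.C f))
    (hX : ∀ p, d (MvPolynomial.X p) = d' (MvPolynomial.X p)) : d = d' := by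
  ext1 P
  induction P using MvPolynomial.induction_on with
  | C f => exact hC f
  | add P Q hP hQ => rw [map_add, map_add, hP, hQ]
  | mul_X P p hP => rw [Derivation.leibniz, Derivation.leibniz, hP, hX]

namespace Coordinates

/-- The total derivative `D_x`, as a derivation. -/
def D (c : Coordinates K O m) : Derivation K (Jet O m) (Jet O m) :=
  coeffDeriv c.dx + ∑ i, c.jet i 1 • coeffDeriv (c.dy i)
    + (MvPolynomial.mkDerivation O fun p : Fin m × ℕ => c.jet p.1 (p.2 + 2)).restrictScalars K

variable {c : Coordinates K O m}

lemma sum_derivation_apply {R ι : Type*} [CommRing R] [Algebra K R] (s : Finset ι)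
    (d : ι → Derivation K R R) (P : R) : (∑ i ∈ s, d i) P = ∑ i ∈ s, d i P := by
  rw [← Derivation.coeFnAddMonoidHom_apply, map_sum, Finset.sum_apply]
  rfl

lemma D_apply (P : Jet O m) : c.D P = c.totalDeriv P := by
  simp only [D, totalDeriv, Derivation.add_apply, sum_derivation_apply, Derivation.smul_apply,
    smul_eq_mul, coeffDeriv_apply]
  rfl

@[simp] lemma D_C (f : O) : c.D (MvPolynomial.C f)
    = MvPolynomial.C (c.dx f) + ∑ i, MvPolynomial.X (i, 0) * MvPolynomial.C (c.dy i f) := by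
  simp only [D, Derivation.add_apply, sum_derivation_apply, Derivation.smul_apply, coeffDeriv_C,
    smul_eq_mul, Derivation.restrictScalars_apply, MvPolynomial.derivation_C, add_zero]
  rfl

@[simp] lemma D_X (p : Fin m × ℕ) :
    c.D (MvPolynomial.X p) = MvPolynomial.X (p.1, p.2 + 1) := by
  simp only [D, Derivation.add_apply, sum_derivation_apply, Derivation.smul_apply, coeffDeriv_X,
    smul_zero, Finset.sum_const_zero, Derivation.restrictScalars_apply,
    MvPolynomial.mkDerivation_X, zero_add]
  rfl

lemma D_C_of_base {f : O} (hf : ∀ i, c.dy i f = 0) :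
    c.D (MvPolynomial.C f) = MvPolynomial.C (c.dx f) := by
  simp [hf]

lemma D_jet (hc : c.IsRegular) (i : Fin m) (k : ℕ) : c.D (c.jet i k) = c.jet i (k + 1) := by
  cases k with
  | zero => simp [jet, hc.dx_y, hc.dy_y]
  | succ k => simp [jet]

/-- The vertical derivation `∂/∂y_j^(k)`. -/
def vert (c : Coordinates K O m) (j : Fin m) : ℕ → Derivation K (Jet O m) (Jet O m)
  | 0 => coeffDeriv (c.dy j)
  | k + 1 => (MvPolynomial.pderiv (j, k)).restrictScalars K

@[simp] lemma vert_zero_C (j : Fin m) (f : O) :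
    c.vert j 0 (MvPolynomial.C f) = MvPolynomial.C (c.dy j f) := coeffDeriv_C _ _

@[simp] lemma vert_zero_X (j : Fin m) (p : Fin m × ℕ) : c.vert j 0 (MvPolynomial.X p) = 0 :=
  coeffDeriv_X _ _

@[simp] lemma vert_succ_C (j : Fin m) (k : ℕ) (f : O) :
    c.vert j (k + 1) (MvPolynomial.C f) = 0 := by
  simp [vert]

lemma vert_succ_X (j : Fin m) (k : ℕ) (p : Fin m × ℕ) :
    c.vert j (k + 1) (MvPolynomial.X p) = if p = (j, k) then 1 else 0 := by
  classical
  simp [vert, MvPolynomial.pderiv_X, Pi.single_apply]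

lemma vert_zero_D (hc : c.IsRegular) (j : Fin m) (P : Jet O m) :
    c.vert j 0 (c.D P) = c.D (c.vert j 0 P) := by
  have h : ⁅c.vert j 0, c.D⁆ = 0 := jetDerivation_ext
    (fun f => by
      simp [Derivation.commutator_apply, hc.dx_dy, hc.dy_dy j])
    (fun p => by simp [Derivation.commutator_apply])
  have := congrArg (fun d => d P) h
  simpa [Derivation.commutator_apply, sub_eq_zero] using this

/-- The commutation rule `[∂/∂y_j^(k+1), D_x] = ∂/∂y_j^(k)`. -/
lemma vert_succ_D (j : Fin m) (k : ℕ) (P : Jet O m) :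
    c.vert j (k + 1) (c.D P) = c.D (c.vert j (k + 1) P) + c.vert j k P := by
  have h : ⁅c.vert j (k + 1), c.D⁆ = c.vert j k := jetDerivation_ext
    (fun f => by
      cases k with
      | zero => simp [Derivation.commutator_apply, vert_succ_X, Finset.sum_ite_eq']
      | succ k => simp [Derivation.commutator_apply, vert_succ_X])
    (fun p => by
      cases k with
      | zero => simp [Derivation.commutator_apply, vert_succ_X, apply_ite c.D]
      | succ k =>
        simp [Derivation.commutator_apply, vert_succ_X, Prod.ext_iff, apply_ite c.D])
  have := congrArg (fun d => d P) h
  simp only [Derivation.commutator_apply] at this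
  rw [← this]
  ring

/-- The prolongation of `ξ ∂/∂x + ∑ i, η_i ∂/∂y_i`, as a derivation. -/
def prol (c : Coordinates K O m) (ξ : O) (η : Fin m → O) : Derivation K (Jet O m) (Jet O m) :=
  coeffDeriv (c.field ξ η)
    + (MvPolynomial.mkDerivation O fun p : Fin m × ℕ =>
        c.prolCoeff ξ η p.1 (p.2 + 1)).restrictScalars K

lemma prol_apply (ξ : O) (η : Fin m → O) (P : Jet O m) : c.prol ξ η P = c.prolong ξ η P := rfl

lemma field_apply (ξ : O) (η : Fin m → O) (f : O) :
    c.field ξ η f = ξ * c.dx f + ∑ i, η i * c.dy i f := by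
  simp [field, sum_derivation_apply]

lemma field_y (hc : c.IsRegular) (ξ : O) (η : Fin m → O) (i : Fin m) :
    c.field ξ η (c.y i) = η i := by
  simp [field_apply, hc.dx_y, hc.dy_y]

lemma prol_C (ξ : O) (η : Fin m → O) (f : O) :
    c.prol ξ η (MvPolynomial.C f) = MvPolynomial.C (c.field ξ η f) := by
  simp [prol]

/-- The characteristic `Q_i = η_i - ξ y_i^(1)` of a vector field. -/
def char (ξ : O) (η : Fin m → O) (i : Fin m) : Jet O m :=
  MvPolynomial.C (η i) - MvPolynomial.C ξ * MvPolynomial.X (i, 0)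

/-- The prolongation in characteristic form. -/
lemma prolCoeff_eq (ξ : O) (η : Fin m → O) (i : Fin m) (k : ℕ) :
    c.prolCoeff ξ η i k = c.D^[k] (char ξ η i) + MvPolynomial.C ξ * c.jet i (k + 1) := by
  induction k with
  | zero => simp [prolCoeff, char, jet]
  | succ k ih =>
    rw [prolCoeff, ← D_apply, ← D_apply, ih, map_add, Function.iterate_succ_apply',
      Derivation.leibniz]
    have : c.D (c.jet i (k + 1)) = c.jet i (k + 2) := by simp [jet]
    rw [this, smul_eq_mul, smul_eq_mul]
    ring

lemma prol_jet (hc : c.IsRegular) (ξ : O) (η : Fin m → O) (i : Fin m) (k : ℕ) :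
    c.prol ξ η (c.jet i k) = c.D^[k] (char ξ η i) + MvPolynomial.C ξ * c.jet i (k + 1) := by
  rw [← prolCoeff_eq]
  cases k with
  | zero => simp [jet, prol_C, field_y hc, prolCoeff]
  | succ k => simp [jet, prol]

end Coordinates

/-- The operator `P ↦ d^n P + ∑_{j=2}^n a_j d^(n-j) P` attached to a derivation `d`. -/
def derivOp {R : Type*} [CommRing R] [Algebra K R] (d : Derivation K R R) (n : ℕ) (a : ℕ → R)
    (P : R) : R :=
  d^[n] P + ∑ j ∈ Finset.Icc 2 n, a j * d^[n - j] P

section derivOp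

variable {R : Type*} [CommRing R] [Algebra K R] (d : Derivation K R R) (n : ℕ) (a : ℕ → R)

lemma iterate_eq_pow (k : ℕ) (P : R) : d^[k] P = ((d : R →ₗ[K] R) ^ k) P := by
  rw [Module.End.pow_apply]
  rfl

/-- `derivOp` as a linear map. -/
def derivOpₗ : R →ₗ[K] R :=
  (d : R →ₗ[K] R) ^ n + ∑ j ∈ Finset.Icc 2 n, LinearMap.mulLeft K (a j) ∘ₗ (d : R →ₗ[K] R) ^ (n - j)

lemma derivOpₗ_apply (P : R) : derivOpₗ d n a P = derivOp d n a P := by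
  simp [derivOpₗ, derivOp, iterate_eq_pow]

end derivOp

namespace Coordinates

variable {c : Coordinates K O m}

lemma D_iterate_y (hc : c.IsRegular) (i : Fin m) (k : ℕ) :
    c.D^[k] (MvPolynomial.C (c.y i)) = c.jet i k := by
  induction k with
  | zero => rfl
  | succ k ih => rw [Function.iterate_succ_apply', ih, D_jet hc]

lemma equation_eq_derivOp (hc : c.IsRegular) (n : ℕ) (A : ℕ → O) (i : Fin m) :
    c.equation n A i
      = derivOp c.D n (fun j => MvPolynomial.C (A j)) (MvPolynomial.C (c.y i)) := by
  simp only [equation, lowerPart, derivOp, D_iterate_y hc]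

/-- The invariance condition in characteristic form: `v^(n)(Δ_i) = L(D_x) Q_i + ξ D_x Δ_i`. -/
lemma prolong_equation (hc : c.IsRegular) (n : ℕ) {A : ℕ → O} (hA : ∀ j i, c.dy i (A j) = 0)
    (ξ : O) (η : Fin m → O) (i : Fin m) :
    c.prolong ξ η (c.equation n A i)
      = derivOp c.D n (fun j => MvPolynomial.C (A j)) (char ξ η i)
        + MvPolynomial.C ξ * c.D (c.equation n A i) := by
  rw [← prol_apply, equation, lowerPart, map_add, map_sum, prol_jet hc, map_add, map_sum,
    D_jet hc, derivOp, mul_add, Finset.mul_sum]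
  have h : ∀ j, c.prol ξ η (MvPolynomial.C (A j) * c.jet i (n - j))
      = MvPolynomial.C (A j) * c.D^[n - j] (char ξ η i)
        + MvPolynomial.C ξ * c.D (MvPolynomial.C (A j) * c.jet i (n - j)) := fun j => by
    rw [Derivation.leibniz, Derivation.leibniz, prol_jet hc, prol_C, D_jet hc,
      D_C_of_base (hA j), field_apply]
    simp only [hA, mul_zero, Finset.sum_const_zero, add_zero, smul_eq_mul, map_mul]
    ring
  simp only [h, Finset.sum_add_distrib]
  ring

end Coordinates

end JetCalculus

/-! ### Products of solutions of a second order equation and their Wronskian -/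

section Wronskian

variable {K R : Type*} [Field K] [CommRing R] [Algebra K R]

/-- The `i`-th derivative of `e^N` to leading order in `e`. -/
lemma exists_iterate_pow_eq (d : Derivation K R R) (e : R) (N i : ℕ) (hi : i ≤ N) :
    ∃ r, d^[i] (e ^ N) = N.descFactorial i * (e ^ (N - i) * d e ^ i) + e ^ (N - i + 1) * r := by
  induction i with
  | zero => exact ⟨0, by simp⟩
  | succ i ih =>
    obtain ⟨r, hr⟩ := ih (by omega)
    obtain ⟨M, rfl⟩ : ∃ M, N = M + (i + 1) := ⟨N - (i + 1), by omega⟩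
    have h1 : M + (i + 1) - i = M + 1 := by omega
    have h2 : M + (i + 1) - (i + 1) = M := by omega
    rw [h1] at hr
    refine ⟨(M + (i + 1)).descFactorial i * (i * d e ^ (i - 1) * d (d e))
      + (M + 2) * d e * r + e * d r, ?_⟩
    rw [Function.iterate_succ_apply', hr, h2, Nat.descFactorial_succ, h1]
    simp only [map_add, Derivation.leibniz, Derivation.leibniz_pow, smul_eq_mul,
      Derivation.map_natCast, nsmul_eq_mul, mul_zero, add_zero, Nat.add_sub_cancel]
    push_cast
    ring

lemma iterate_sum {ι : Type*} (d : Derivation K R R) (i : ℕ) (s : Finset ι) (f : ι → R) :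
    d^[i] (∑ k ∈ s, f k) = ∑ k ∈ s, d^[i] (f k) := by
  simp only [iterate_eq_pow, map_sum]

lemma iterate_mul_of_const (d : Derivation K R R) (i : ℕ) (f : R) {g : R} (hg : d g = 0) :
    d^[i] (f * g) = d^[i] f * g := by
  induction i with
  | zero => rfl
  | succ i ih =>
    rw [Function.iterate_succ_apply', ih, Function.iterate_succ_apply', Derivation.leibniz, hg]
    simp [mul_comm]

lemma iterate_coeffDeriv_C (d : Derivation K R R) (i : ℕ) (f : R) :
    (coeffDeriv d)^[i] (MvPolynomial.C f : Jet R 1) = MvPolynomial.C (d^[i] f) := by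
  induction i with
  | zero => rfl
  | succ i ih => rw [Function.iterate_succ_apply', ih, Function.iterate_succ_apply', coeffDeriv_C]

/-- The mixed derivative `∂_x^i ∂_t^j` of the kernel `(u(x) v(t) - v(x) u(t))^N` on the diagonal
`t = x`. -/
def green (d : Derivation K R R) (N : ℕ) (u v : R) (i j : ℕ) : R :=
  ∑ k ∈ Finset.range (N + 1), (-1) ^ k * (N.choose k : R) *
    (d^[i] (u ^ (N - k) * v ^ k) * d^[j] (u ^ k * v ^ (N - k)))

variable {d : Derivation K R R} {u v : R}

/-- The kernel vanishes to order `N` on the diagonal. Treating the second argument as a pair of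
indeterminate constants makes this the statement about powers `exists_iterate_pow_eq`. -/
lemma green_zero_right (hW : u * d v - d u * v = 1) (N i : ℕ) (hi : i ≤ N) :
    green d N u v i 0 = if i = N then (N.factorial : R) * (-1) ^ N else 0 := by
  let p : Jet R 1 := MvPolynomial.X (0, 0)
  let q : Jet R 1 := MvPolynomial.X (0, 1)
  let e : Jet R 1 := MvPolynomial.C u * p - MvPolynomial.C v * q
  -- `ev` restricts to the diagonal: `p` and `q` stand for `v(t)` and `u(t)`.
  let ev : Jet R 1 →ₐ[R] R := MvPolynomial.aeval fun x => if x.2 = 0 then v else u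
  have hp : coeffDeriv d p = 0 := coeffDeriv_X d _
  have hq : coeffDeriv d q = 0 := coeffDeriv_X d _
  have hev_C (f : R) : ev (MvPolynomial.C f) = f := MvPolynomial.aeval_C _ _
  have hev_p : ev p = v := by simp [ev, p]
  have hev_q : ev q = u := by simp [ev, q]
  have hev_e : ev e = 0 := by
    simp only [e, map_sub, map_mul, hev_C, hev_p, hev_q]
    ring
  have hev_de : ev (coeffDeriv d e) = -1 := by
    have : coeffDeriv d e = MvPolynomial.C (d u) * p - MvPolynomial.C (d v) * q := by
      simp only [e, map_sub, Derivation.leibniz, hp, hq, coeffDeriv_C, smul_eq_mul, mul_zero,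
        zero_add]
      ring
    rw [this]
    simp only [map_sub, map_mul, hev_C, hev_p, hev_q]
    linear_combination -hW
  have hgreen : green d N u v i 0 = ev ((coeffDeriv d)^[i] (e ^ N)) := by
    have h1 : e ^ N = ∑ k ∈ Finset.range (N + 1),
        MvPolynomial.C (u ^ (N - k) * v ^ k) *
          ((-1) ^ k * (N.choose k : Jet R 1) * (p ^ (N - k) * q ^ k)) := by
      rw [show e = -(MvPolynomial.C v * q) + MvPolynomial.C u * p by ring, add_pow]
      refine Finset.sum_congr rfl fun k _ => ?_
      simp only [map_mul, map_pow, neg_pow (MvPolynomial.C v * q) k]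
      ring
    have h2 (k : ℕ) : coeffDeriv d
        ((-1) ^ k * (N.choose k : Jet R 1) * (p ^ (N - k) * q ^ k)) = 0 := by
      simp [Derivation.leibniz, Derivation.leibniz_pow, hp, hq]
    rw [h1, iterate_sum, map_sum, green]
    refine Finset.sum_congr rfl fun k _ => ?_
    rw [iterate_mul_of_const _ _ _ (h2 k), iterate_coeffDeriv_C]
    simp only [map_mul, map_pow, map_neg, map_one, map_natCast, hev_C, hev_p, hev_q,
      Function.iterate_zero, id]
    ring
  obtain ⟨r, hr⟩ := exists_iterate_pow_eq (coeffDeriv d) e N i hi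
  rw [hgreen, hr]
  simp only [map_add, map_mul, map_pow, map_natCast, hev_e, hev_de]
  split_ifs with h
  · subst h
    simp [Nat.descFactorial_self]
  · simp [Nat.sub_ne_zero_of_lt (lt_of_le_of_ne hi h)]

lemma green_succ_right (N i j : ℕ) :
    green d N u v i (j + 1) = d (green d N u v i j) - green d N u v (i + 1) j := by
  simp only [green, map_sum, ← Finset.sum_sub_distrib]
  refine Finset.sum_congr rfl fun k _ => ?_
  have h : d ((-1) ^ k * (N.choose k : R)) = 0 := by
    simp [Derivation.leibniz, Derivation.leibniz_pow]
  rw [Derivation.leibniz _ ((-1) ^ k * (N.choose k : R)), h, Derivation.leibniz,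
    Function.iterate_succ_apply', Function.iterate_succ_apply']
  simp only [smul_eq_mul]
  ring

lemma green_eq (hW : u * d v - d u * v = 1) (N j i : ℕ) (hij : i + j ≤ N) :
    green d N u v i j
      = if i + j = N then (-1) ^ j * ((N.factorial : R) * (-1) ^ N) else 0 := by
  induction j generalizing i with
  | zero => simpa using green_zero_right hW N i hij
  | succ j ih =>
    rw [green_succ_right, ih i (by omega), ih (i + 1) (by omega), if_neg (by omega), map_zero,
      show i + 1 + j = i + (j + 1) by ring]
    split_ifs
    · ring
    · ring

/-- The Wronskian matrix of the functions `u^(N-k) v^k`, `0 ≤ k ≤ N`. -/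
def wronskian (d : Derivation K R R) (N : ℕ) (u v : R) : Matrix (Fin (N + 1)) (Fin (N + 1)) R :=
  fun l k => d^[(l : ℕ)] (u ^ (N - (k : ℕ)) * v ^ (k : ℕ))

/-- The Wronskian matrix is invertible: its product with a suitable matrix of derivatives of the
same functions is triangular with units on the diagonal, by `green_eq`. -/
lemma isUnit_det_wronskian [CharZero K] (hW : u * d v - d u * v = 1) (N : ℕ) :
    IsUnit (wronskian d N u v).det := by
  let V : Matrix (Fin (N + 1)) (Fin (N + 1)) R := fun k j =>
    (-1) ^ (k : ℕ) * (N.choose k : R) * d^[N - (j : ℕ)] (u ^ (k : ℕ) * v ^ (N - (k : ℕ)))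
  have hmul (i j : Fin (N + 1)) :
      (wronskian d N u v * V) i j = green d N u v i (N - (j : ℕ)) := by
    rw [Matrix.mul_apply, green, ← Fin.sum_univ_eq_sum_range (fun k => (-1) ^ k * (N.choose k : R) *
      (d^[i] (u ^ (N - k) * v ^ k) * d^[N - (j : ℕ)] (u ^ k * v ^ (N - k))))]
    refine Finset.sum_congr rfl fun k _ => ?_
    simp only [wronskian, V]
    ring
  have htri : (wronskian d N u v * V).det
      = ∏ i : Fin (N + 1), (-1) ^ (N - (i : ℕ)) * ((N.factorial : R) * (-1) ^ N) := by
    rw [Matrix.det_of_isLowerTriangular]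
    · refine Finset.prod_congr rfl fun i _ => ?_
      have := i.2
      rw [hmul, green_eq hW _ _ _ (by omega), if_pos (by omega)]
    · intro i j hij
      have hij' : (i : ℕ) < j := hij
      have := j.2
      rw [hmul, green_eq hW _ _ _ (by omega), if_neg (by omega)]
  have hfact : IsUnit (N.factorial : R) := by
    have h : IsUnit (N.factorial : K) := by
      rw [isUnit_iff_ne_zero]
      exact_mod_cast N.factorial_ne_zero
    simpa using h.map (algebraMap K R)
  have hneg (k : ℕ) : IsUnit ((-1 : R) ^ k) := (isUnit_one.neg).pow k
  have hunit : IsUnit (wronskian d N u v * V).det := by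
    rw [htri]
    refine Finset.prod_induction _ IsUnit (fun _ _ => IsUnit.mul) isUnit_one fun i _ => ?_
    exact (hneg _).mul (hfact.mul (hneg _))
  rw [Matrix.det_mul] at hunit
  exact isUnit_of_mul_isUnit_left hunit

/-- A linear differential expression of order at most `N` that annihilates all `u^(N-k) v^k` is
zero. -/
lemma eq_zero_of_annihilates [CharZero K] (hW : u * d v - d u * v = 1) (N : ℕ)
    (b : Fin (N + 1) → R)
    (hb : ∀ k : Fin (N + 1), ∑ l, b l * d^[(l : ℕ)] (u ^ (N - (k : ℕ)) * v ^ (k : ℕ)) = 0) :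
    b = 0 := by
  have h : Matrix.vecMul b (wronskian d N u v) = 0 := funext hb
  have := congrArg (fun x => Matrix.vecMul x (wronskian d N u v)⁻¹) h
  simpa [Matrix.vecMul_vecMul, Matrix.mul_nonsing_inv _ (isUnit_det_wronskian hW N)] using this

/-- The functions `u^(N-k) v^k` are linearly independent over the constants of `d`. -/
lemma eq_zero_of_sum_eq_zero [CharZero K] (hW : u * d v - d u * v = 1) (N : ℕ)
    (φ : Fin (N + 1) → R) (hφ : ∀ k, d (φ k) = 0)
    (h : ∑ k : Fin (N + 1), (u ^ (N - (k : ℕ)) * v ^ (k : ℕ)) * φ k = 0) : φ = 0 := by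
  have h1 : (wronskian d N u v).mulVec φ = 0 := funext fun l => by
    change ∑ k : Fin (N + 1), d^[(l : ℕ)] (u ^ (N - (k : ℕ)) * v ^ (k : ℕ)) * φ k = 0
    simp only [← iterate_mul_of_const d l _ (hφ _)]
    rw [← iterate_sum, h, iterate_eq_pow, map_zero]
  have := congrArg (wronskian d N u v)⁻¹.mulVec h1
  simpa [Matrix.mulVec_mulVec, Matrix.nonsing_inv_mul _ (isUnit_det_wronskian hW N)] using this

/-- Variation of constants: a solution `f` of a linear equation of order `N + 1` solved by all
`u^(N-k) v^k` is a combination of these with coefficients that are constant for `d` and for every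
further derivation `δ` that annihilates `u`, `v`, `f` and commutes with `d`. -/
lemma exists_coefficients [CharZero K] (hW : u * d v - d u * v = 1) (N : ℕ) (a : ℕ → R)
    (hs : ∀ k : Fin (N + 1), derivOp d (N + 1) a (u ^ (N - (k : ℕ)) * v ^ (k : ℕ)) = 0)
    {f : R} (hf : derivOp d (N + 1) a f = 0) :
    ∃ φ : Fin (N + 1) → R, f = ∑ k, φ k * (u ^ (N - (k : ℕ)) * v ^ (k : ℕ)) ∧
      (∀ k, d (φ k) = 0) ∧
      ∀ δ : Derivation K R R, (∀ g, d (δ g) = δ (d g)) → δ u = 0 → δ v = 0 → δ f = 0 →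
        ∀ k, δ (φ k) = 0 := by
  set s : Fin (N + 1) → R := fun k => u ^ (N - (k : ℕ)) * v ^ (k : ℕ) with hs_def
  set W := wronskian d N u v with hW_def
  have hu := isUnit_det_wronskian hW N
  rw [← hW_def] at hu
  let F : Fin (N + 1) → R := fun l => d^[(l : ℕ)] f
  let φ := W⁻¹.mulVec F
  have hφ : W.mulVec φ = F := by
    simp [φ, Matrix.mulVec_mulVec, Matrix.mul_nonsing_inv _ hu]
  have hinj : ∀ ψ : Fin (N + 1) → R, W.mulVec ψ = 0 → ψ = 0 := fun ψ hψ => by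
    have := congrArg W⁻¹.mulVec hψ
    simpa [Matrix.mulVec_mulVec, Matrix.nonsing_inv_mul _ hu] using this
  have hφ' (l : ℕ) (hl : l < N + 1) : ∑ k, d^[l] (s k) * φ k = d^[l] f :=
    congrFun hφ ⟨l, hl⟩
  -- The relation persists for the derivative of order `N + 1`, by the equation.
  have htop : ∑ k, d^[N + 1] (s k) * φ k = d^[N + 1] f := by
    have h1 (g : R) (hg : derivOp d (N + 1) a g = 0) :
        d^[N + 1] g = -∑ j ∈ Finset.Icc 2 (N + 1), a j * d^[N + 1 - j] g :=
      eq_neg_of_add_eq_zero_left hg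
    rw [h1 f hf, Finset.sum_congr rfl fun k _ => by rw [h1 (s k) (hs k)]]
    simp only [neg_mul, Finset.sum_neg_distrib, Finset.sum_mul]
    rw [Finset.sum_comm]
    congr 1
    refine Finset.sum_congr rfl fun j hj => ?_
    rw [Finset.mem_Icc] at hj
    rw [← hφ' (N + 1 - j) (by omega), Finset.mul_sum]
    exact Finset.sum_congr rfl fun k _ => by ring
  refine ⟨φ, ?_, ?_, ?_⟩
  · rw [← Function.iterate_zero_apply d f, ← hφ' 0 (by omega)]
    exact Finset.sum_congr rfl fun k _ => mul_comm _ _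
  · refine congrFun (hinj (fun k => d (φ k)) (funext fun l => ?_))
    have h1 : ∑ k, d^[(l : ℕ) + 1] (s k) * φ k = d^[(l : ℕ) + 1] f := by
      rcases Nat.lt_or_ge ((l : ℕ) + 1) (N + 1) with h | h
      · exact hφ' _ h
      · rw [show (l : ℕ) + 1 = N + 1 by omega]
        exact htop
    have h2 := congrArg d (hφ' l l.2)
    rw [← Function.iterate_succ_apply' d, ← h1, map_sum] at h2
    simp only [Derivation.leibniz, smul_eq_mul, ← Function.iterate_succ_apply' d,
      Finset.sum_add_distrib] at h2
    have h3 : ∑ k, φ k * d^[(l : ℕ).succ] (s k) = ∑ k, d^[(l : ℕ) + 1] (s k) * φ k :=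
      Finset.sum_congr rfl fun k _ => mul_comm _ _
    rw [h3] at h2
    exact add_eq_right.1 h2
  · intro δ hδ hδu hδv hδf
    have hit (l : ℕ) (g : R) (hg : δ g = 0) : δ (d^[l] g) = 0 := by
      induction l with
      | zero => exact hg
      | succ l ih => rw [Function.iterate_succ_apply', ← hδ, ih, map_zero]
    have hδs (k : Fin (N + 1)) : δ (s k) = 0 := by
      simp [hs_def, Derivation.leibniz, Derivation.leibniz_pow, hδu, hδv]
    refine congrFun (hinj (fun k => δ (φ k)) (funext fun l => ?_))
    have h2 := congrArg δ (hφ' l l.2)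
    rw [hit _ _ hδf, map_sum] at h2
    simp only [Derivation.leibniz, smul_eq_mul, hit _ _ (hδs _), mul_zero, add_zero] at h2
    exact h2

end Wronskian

/-! ### The determining equations -/

section DeterminingEquations

variable {K O : Type*} [Field K] [CommRing O] [Algebra K O] {m : ℕ}

lemma eq_zero_of_natCast_mul {R : Type*} [CommRing R] (K : Type*) [Field K] [CharZero K]
    [Algebra K R] {k : ℕ} (hk : k ≠ 0) {x : R} (h : (k : R) * x = 0) : x = 0 := by
  have hk' : (k : K) ≠ 0 := by exact_mod_cast hk
  have h1 : algebraMap K R (k : K)⁻¹ * (k : R) = 1 := by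
    rw [← map_natCast (algebraMap K R), ← map_mul, inv_mul_cancel₀ hk', map_one]
  rw [← one_mul x, ← h1, mul_assoc, h, mul_zero]

namespace Coordinates

variable {c : Coordinates K O m}

@[simp] lemma onShell_C (n : ℕ) (A : ℕ → O) (f : O) :
    c.onShell n A (MvPolynomial.C f) = MvPolynomial.C f :=
  MvPolynomial.aeval_C _ _

lemma onShell_X_of_ne {n : ℕ} (A : ℕ → O) {p : Fin m × ℕ} (hp : p.2 + 1 ≠ n) :
    c.onShell n A (MvPolynomial.X p) = MvPolynomial.X p := by
  rw [onShell, MvPolynomial.aeval_X, if_neg hp]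

lemma onShell_jet_of_lt {n l : ℕ} (A : ℕ → O) (i : Fin m) (hl : l < n) :
    c.onShell n A (c.jet i l) = c.jet i l := by
  cases l with
  | zero => exact onShell_C _ _ _
  | succ l => exact onShell_X_of_ne A (ne_of_lt hl)

lemma onShell_equation {n : ℕ} (hn : n ≠ 0) (A : ℕ → O) (i : Fin m) :
    c.onShell n A (c.equation n A i) = 0 := by
  obtain ⟨n, rfl⟩ := Nat.exists_eq_succ_of_ne_zero hn
  have h1 : c.onShell (n + 1) A (c.lowerPart (n + 1) A i) = c.lowerPart (n + 1) A i := by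
    rw [lowerPart, map_sum]
    refine Finset.sum_congr rfl fun j hj => ?_
    rw [Finset.mem_Icc] at hj
    rw [map_mul, onShell_C, onShell_jet_of_lt A i (by omega)]
  rw [equation, map_add, h1]
  simp [jet, onShell]

lemma vert_jet_succ (j i : Fin m) (k l : ℕ) :
    c.vert j (k + 1) (c.jet i l) = if i = j ∧ l = k + 1 then 1 else 0 := by
  cases l with
  | zero => simp [jet]
  | succ l => simp [jet, vert_succ_X, Prod.ext_iff]

lemma vert_C_mul_succ (j : Fin m) (k : ℕ) (f : O) (P : Jet O m) :
    c.vert j (k + 1) (MvPolynomial.C f * P) = MvPolynomial.C f * c.vert j (k + 1) P := by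
  simp [Derivation.leibniz]

/-- The lower part has no terms of order `n - 1`. -/
lemma vert_lowerPart (k : ℕ) (A : ℕ → O) (i j : Fin m) :
    c.vert j (k + 1) (c.lowerPart (k + 2) A i) = 0 := by
  rw [lowerPart, map_sum]
  refine Finset.sum_eq_zero fun l hl => ?_
  rw [Finset.mem_Icc] at hl
  rw [vert_C_mul_succ, vert_jet_succ, if_neg (by omega), mul_zero]

/-- Differentiation by `y_j^(n-1)` commutes with the restriction to `Δ = 0`, because the system has
no terms of order `n - 1`. -/
lemma vert_onShell (k : ℕ) (A : ℕ → O) (j : Fin m) (P : Jet O m) :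
    c.vert j (k + 1) (c.onShell (k + 2) A P) = c.onShell (k + 2) A (c.vert j (k + 1) P) := by
  induction P using MvPolynomial.induction_on with
  | C f => simp
  | add P Q hP hQ => simp only [map_add, hP, hQ]
  | mul_X P p hP =>
    have h : c.vert j (k + 1) (c.onShell (k + 2) A (MvPolynomial.X p))
        = c.onShell (k + 2) A (c.vert j (k + 1) (MvPolynomial.X p)) := by
      by_cases hp : p.2 + 1 = k + 2
      · have hne : p ≠ (j, k) := fun h => by
          rw [h] at hp
          omega
        rw [onShell, MvPolynomial.aeval_X, if_pos hp, map_neg, vert_lowerPart, neg_zero,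
          vert_succ_X, if_neg hne, map_zero]
      · rw [onShell_X_of_ne A hp, vert_succ_X]
        split_ifs <;> simp
    rw [map_mul, Derivation.leibniz, Derivation.leibniz, hP, h, map_add, smul_eq_mul, smul_eq_mul,
      smul_eq_mul, smul_eq_mul, map_mul, map_mul]

section CharVert

variable (ξ : O) (η : Fin m → O) (i j : Fin m)

lemma vert_zero_char : c.vert j 0 (char ξ η i)
    = MvPolynomial.C (c.dy j (η i)) - MvPolynomial.C (c.dy j ξ) * MvPolynomial.X (i, 0) := by
  simp [char, Derivation.leibniz, mul_comm]

lemma vert_one_char : c.vert j 1 (char ξ η i) = MvPolynomial.C (if i = j then -ξ else 0) := by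
  rw [char, map_sub, vert_succ_C, vert_C_mul_succ, vert_succ_X]
  by_cases h : i = j <;> simp [h]

lemma vert_add_two_iterate (l r : ℕ) :
    c.vert j (l + r + 2) (c.D^[l] (char ξ η i)) = 0 := by
  induction l generalizing r with
  | zero =>
    rw [Function.iterate_zero, id, char, map_sub, vert_succ_C, vert_C_mul_succ, vert_succ_X]
    simp
  | succ l ih =>
    rw [Function.iterate_succ_apply', vert_succ_D,
      show l + 1 + r + 1 + 1 = l + (r + 1) + 2 by ring, ih, map_zero, zero_add,
      show l + 1 + r + 1 = l + r + 2 by ring, ih]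

lemma vert_add_one_iterate (l : ℕ) :
    c.vert j (l + 1) (c.D^[l] (char ξ η i)) = c.vert j 1 (char ξ η i) := by
  induction l with
  | zero => rfl
  | succ l ih =>
    rw [Function.iterate_succ_apply', vert_succ_D, ih,
      vert_add_two_iterate ξ η i j l 0, map_zero, zero_add]

lemma vert_self_iterate (l : ℕ) : c.vert j l (c.D^[l] (char ξ η i))
    = c.vert j 0 (char ξ η i) + (l : Jet O m) * c.D (c.vert j 1 (char ξ η i)) := by
  induction l with
  | zero => simp
  | succ l ih =>
    rw [Function.iterate_succ_apply', vert_succ_D, ih, vert_add_one_iterate]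
    push_cast
    ring

/-- Together with `vert_self_iterate` and `vert_add_one_iterate`: the terms of the characteristic
form that survive differentiation by `y_j^(n-1)`, by iteration of
`[∂/∂y_j^(k+1), D_x] = ∂/∂y_j^(k)`. -/
lemma vert_iterate_succ (hc : c.IsRegular) (l : ℕ) : c.vert j l (c.D^[l + 1] (char ξ η i))
    = ((l + 1 : ℕ) : Jet O m) * c.D (c.vert j 0 (char ξ η i))
      + ((l + 1).choose 2 : Jet O m) * c.D (c.D (c.vert j 1 (char ξ η i))) := by
  induction l with
  | zero => simp [vert_zero_D hc]
  | succ l ih =>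
    rw [Function.iterate_succ_apply', vert_succ_D, ih, vert_self_iterate]
    have h : (l + 1 + 1).choose 2 = (l + 1) + (l + 1).choose 2 := by
      rw [Nat.choose_succ_succ' (l + 1) 1, Nat.choose_one_right]
    rw [h, map_add, Derivation.leibniz, Derivation.map_natCast]
    simp only [smul_eq_mul]
    push_cast
    ring

/-- The derivative by `y_j^(n-1)` of the invariance condition. -/
lemma vert_prolong_equation (hc : c.IsRegular) {k : ℕ} (hk : k ≠ 0) {A : ℕ → O}
    (hA : ∀ j i, c.dy i (A j) = 0) :
    c.vert j (k + 1) (c.prolong ξ η (c.equation (k + 2) A i))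
      = ((k + 2 : ℕ) : Jet O m) * c.D (c.vert j 0 (char ξ η i))
        + ((k + 2).choose 2 : Jet O m) * c.D (c.D (c.vert j 1 (char ξ η i))) := by
  obtain ⟨k, rfl⟩ := Nat.exists_eq_succ_of_ne_zero hk
  have h1 : c.vert j (k + 1 + 1) (c.equation (k + 1 + 2) A i) = 0 := by
    rw [equation, map_add, vert_lowerPart, vert_jet_succ, if_neg (by omega), add_zero]
  have h2 : c.vert j (k + 1) (c.equation (k + 1 + 2) A i)
      = MvPolynomial.C (if i = j then A 2 else 0) := by
    rw [equation, map_add, vert_jet_succ, if_neg (by omega), zero_add, lowerPart, map_sum,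
      Finset.sum_eq_single_of_mem 2 (by simp)]
    · rw [vert_C_mul_succ, vert_jet_succ]
      by_cases h : i = j <;> simp [h]
    · intro l hl hl2
      rw [Finset.mem_Icc] at hl
      rw [vert_C_mul_succ, vert_jet_succ, if_neg (by omega), mul_zero]
  have h3 : c.vert j (k + 1 + 1) (∑ l ∈ Finset.Icc 2 (k + 1 + 2),
        MvPolynomial.C (A l) * c.D^[k + 1 + 2 - l] (char ξ η i))
      = MvPolynomial.C (A 2) * c.vert j 1 (char ξ η i) := by
    rw [map_sum, Finset.sum_eq_single_of_mem 2 (by simp)]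
    · rw [vert_C_mul_succ]
      exact congrArg _ (vert_add_one_iterate ξ η i j (k + 1))
    · intro l hl hl2
      rw [Finset.mem_Icc] at hl
      rw [vert_C_mul_succ, show k + 1 + 1 = (k + 1 + 2 - l) + (l - 3) + 2 by omega,
        vert_add_two_iterate, mul_zero]
  rw [prolong_equation hc _ hA, derivOp, map_add, map_add, h3, vert_C_mul_succ, vert_succ_D, h1,
    h2, map_zero, zero_add, vert_iterate_succ _ _ _ _ hc, vert_one_char]
  by_cases h : i = j
  · simp only [h, if_true, map_neg]
    ring
  · simp only [if_neg h, map_zero, mul_zero, add_zero]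

end CharVert

/-- The determining equations for the nonlinear dependence on `y`: the coefficient `ξ` of a point
symmetry depends on `x` only, and `η` is affine in `y` with linear part prescribed by `ξ` up to a
constant matrix. -/
theorem determining_equations [CharZero K] (hc : c.IsRegular) {k : ℕ} (hk : k ≠ 0) {A : ℕ → O}
    (hA : ∀ j i, c.dy i (A j) = 0) {ξ : O} {η : Fin m → O}
    (h : ∀ i, c.onShell (k + 2) A (c.prolong ξ η (c.equation (k + 2) A i)) = 0) :
    (∀ i, c.dy i ξ = 0) ∧ (∀ i j l, c.dy l (c.dy j (η i)) = 0) ∧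
      ∀ i j, c.dx (c.dy j (η i)) = if i = j then ((k + 1 : K) / 2) • c.dx (c.dx ξ) else 0 := by
  have hX0 (i : Fin m) : c.onShell (k + 2) A (MvPolynomial.X (i, 0)) = MvPolynomial.X (i, 0) :=
    onShell_X_of_ne A (by simp)
  -- `X (i, 1)` is `y_i''`; here the order has to be at least `3`.
  have hX1 (i : Fin m) : c.onShell (k + 2) A (MvPolynomial.X (i, 1)) = MvPolynomial.X (i, 1) :=
    onShell_X_of_ne A (by simpa using hk)
  have key (i j : Fin m) : ((k + 2 : ℕ) : Jet O m) * c.D (c.vert j 0 (char ξ η i))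
        + ((k + 2).choose 2 : Jet O m) * c.D (c.D (c.vert j 1 (char ξ η i))) = 0 := by
    have h1 := congrArg (c.vert j (k + 1)) (h i)
    rw [vert_onShell, vert_prolong_equation _ _ _ _ hc hk hA, map_zero] at h1
    rw [vert_zero_char, vert_one_char] at h1 ⊢
    simpa only [map_add, map_sub, map_mul, map_sum, map_natCast, map_zero, D_C, D_X,
      Derivation.leibniz, smul_eq_mul, onShell_C, hX0, hX1] using h1
  -- The coefficient of `y_i''` is `-(n + (n choose 2)) ∂ξ/∂y_i`.
  have hξ (i : Fin m) : c.dy i ξ = 0 := by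
    have h1 := congrArg (c.vert i 2) (key i i)
    rw [vert_zero_char, vert_one_char, if_pos rfl, map_add, Derivation.leibniz, Derivation.leibniz,
      Derivation.map_natCast, Derivation.map_natCast, vert_succ_D, vert_succ_D, vert_succ_D,
      vert_succ_D] at h1
    have h2 : ((k + 2 + (k + 2).choose 2 : ℕ) : O) * c.dy i ξ = 0 := by
      apply MvPolynomial.C_injective (Fin m × ℕ) O
      simp [vert_succ_X] at h1
      push_cast
      simp only [map_mul, map_add, map_natCast, map_ofNat, map_zero]
      linear_combination -h1
    exact eq_zero_of_natCast_mul K (by omega) h2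
  have hξ' (i : Fin m) : c.dy i (c.dx ξ) = 0 := by rw [← hc.dx_dy, hξ, map_zero]
  have key' (i j : Fin m) : ((k + 2 : ℕ) : Jet O m) * c.D (MvPolynomial.C (c.dy j (η i)))
      = MvPolynomial.C (((k + 2).choose 2 : O) * if i = j then c.dx (c.dx ξ) else 0) := by
    have h1 := key i j
    rw [vert_zero_char, vert_one_char, hξ, map_zero, zero_mul, sub_zero] at h1
    by_cases hij : i = j
    · rw [if_pos hij, D_C_of_base (f := -ξ) (by simp [hξ]),
        D_C_of_base (f := c.dx (-ξ)) (by simp [hξ'])] at h1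
      rw [if_pos hij]
      simp only [map_neg, map_mul, map_natCast] at h1 ⊢
      linear_combination h1
    · rw [if_neg hij] at h1 ⊢
      simpa using h1
  -- The coefficient of `y_l'` is `n ∂²η_i/∂y_l∂y_j`.
  have hηη (i j l : Fin m) : c.dy l (c.dy j (η i)) = 0 := by
    have h1 := congrArg (c.vert l 1) (key' i j)
    rw [vert_succ_C, Derivation.leibniz, Derivation.map_natCast, vert_succ_D, vert_succ_C,
      vert_zero_C, map_zero, zero_add, smul_zero, add_zero, smul_eq_mul] at h1
    exact MvPolynomial.C_injective (Fin m × ℕ) O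
      ((eq_zero_of_natCast_mul K (by omega) h1).trans (map_zero _).symm)
  refine ⟨hξ, hηη, fun i j => ?_⟩
  have h1 := key' i j
  rw [D_C_of_base (hηη i j), ← map_natCast (MvPolynomial.C : O →+* Jet O m), ← map_mul] at h1
  have h2 := MvPolynomial.C_injective (Fin m × ℕ) O h1
  have h3 : ((k + 2).choose 2 : O) = (k + 2 : ℕ) * algebraMap K O ((k + 1) / 2) := by
    rw [← map_natCast (algebraMap K O), ← map_natCast (algebraMap K O), ← map_mul,
      Nat.cast_choose_two]
    congr 1
    push_cast
    ring
  have h4 : ((k + 2 : ℕ) : O) * (c.dx (c.dy j (η i))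
      - if i = j then ((k + 1 : K) / 2) • c.dx (c.dx ξ) else 0) = 0 := by
    rw [mul_sub, h2, h3]
    split_ifs
    · rw [Algebra.smul_def]
      ring
    · simp
  exact sub_eq_zero.1 (eq_zero_of_natCast_mul K (by omega) h4)

end Coordinates

end DeterminingEquations

/-! ### Linear differential expressions with formal symbols -/

section LinearForms

variable {K B R : Type*} [Field K] [CommRing B] [Algebra K B] [CommRing R] [Algebra K R]

/-- The linear form `∑ l, φ (β_l) e_l` with coefficients `β`. It is used with `e_l` the jet
coordinates `y_i^(l)` and with `e_l` the derivatives `f^(l)` of a function. -/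
def linForm (φ : B →+* R) (e : ℕ → R) : (ℕ →₀ B) →+ R :=
  Finsupp.liftAddHom fun l => (AddMonoidHom.mulRight (e l)).comp (φ : B →+ R)

lemma linForm_single (φ : B →+* R) (e : ℕ → R) (l : ℕ) (b : B) :
    linForm φ e (Finsupp.single l b) = φ b * e l := by
  simp [linForm]

lemma linForm_smul (φ : B →+* R) (e : ℕ → R) (b : B) (β : ℕ →₀ B) :
    linForm φ e (b • β) = φ b * linForm φ e β := by
  induction β using Finsupp.induction_linear with
  | zero => simp
  | add f g hf hg => rw [smul_add, map_add, map_add, hf, hg, mul_add]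
  | single l a => rw [Finsupp.smul_single, linForm_single, linForm_single, smul_eq_mul, map_mul,
      mul_assoc]

lemma linForm_eq_sum_range (φ : B →+* R) (e : ℕ → R) {β : ℕ →₀ B} {n : ℕ}
    (hβ : ∀ l, n ≤ l → β l = 0) :
    linForm φ e β = ∑ l ∈ Finset.range n, φ (β l) * e l := by
  rw [linForm, Finsupp.liftAddHom_apply, Finsupp.sum_of_support_subset β (s := Finset.range n)]
  · rfl
  · intro l hl
    rw [Finset.mem_range]
    by_contra h
    exact Finsupp.mem_support_iff.1 hl (hβ l (not_lt.1 h))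
  · simp

variable (δ : Derivation K B B)

/-- The action of the total derivative on the coefficients of linear forms in jet coordinates:
`(∑ l, β_l y^(l))' = ∑ l, (β_l' + β_(l-1)) y^(l)`. -/
def formDeriv : (ℕ →₀ B) →+ (ℕ →₀ B) :=
  Finsupp.mapRange.addMonoidHom (δ : B →+ B) + Finsupp.mapDomain.addMonoidHom Nat.succ

lemma formDeriv_zero (β : ℕ →₀ B) : formDeriv δ β 0 = δ (β 0) := by
  have h : (Finsupp.mapDomain Nat.succ β) 0 = 0 :=
    Finsupp.mapDomain_of_notMem_range _ _ (by simp)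
  simp [formDeriv, h]

lemma formDeriv_succ (β : ℕ →₀ B) (l : ℕ) : formDeriv δ β (l + 1) = δ (β (l + 1)) + β l := by
  have h : (Finsupp.mapDomain Nat.succ β) (l + 1) = β l :=
    Finsupp.mapDomain_apply Nat.succ_injective _ _
  simp [formDeriv, h]

/-- The coefficients of the linear form obtained from the one with coefficients `β` by the
operator `derivOp`. -/
def formOp (n : ℕ) (A : ℕ → B) (β : ℕ →₀ B) : ℕ →₀ B :=
  (formDeriv δ)^[n] β + ∑ j ∈ Finset.Icc 2 n, A j • (formDeriv δ)^[n - j] β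

/-- The coefficients of the equation itself. -/
def symbol (n : ℕ) (A : ℕ → B) : ℕ →₀ B :=
  Finsupp.single n 1 + ∑ j ∈ Finset.Icc 2 n, Finsupp.single (n - j) (A j)

section Evaluation

variable {δ} {d : Derivation K R R} {φ : B →+* R} {e : ℕ → R}

lemma linForm_formDeriv (hφ : ∀ b, d (φ b) = φ (δ b)) (he : ∀ l, d (e l) = e (l + 1))
    (β : ℕ →₀ B) : linForm φ e (formDeriv δ β) = d (linForm φ e β) := by
  induction β using Finsupp.induction_linear with
  | zero => simp
  | add f g hf hg => simp only [map_add, hf, hg]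
  | single l a =>
    rw [linForm_single, Derivation.leibniz, hφ, he, formDeriv, AddMonoidHom.add_apply,
      Finsupp.mapRange.addMonoidHom_apply, Finsupp.mapRange_single,
      Finsupp.mapDomain.addMonoidHom_apply, Finsupp.mapDomain_single, map_add, linForm_single,
      linForm_single, smul_eq_mul, smul_eq_mul]
    change φ (δ a) * e l + φ a * e (l + 1) = _
    ring

lemma linForm_formDeriv_iterate (hφ : ∀ b, d (φ b) = φ (δ b)) (he : ∀ l, d (e l) = e (l + 1))
    (β : ℕ →₀ B) (k : ℕ) : linForm φ e ((formDeriv δ)^[k] β) = d^[k] (linForm φ e β) := by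
  induction k with
  | zero => rfl
  | succ k ih =>
    rw [Function.iterate_succ_apply', linForm_formDeriv hφ he, ih, Function.iterate_succ_apply']

lemma linForm_formOp (hφ : ∀ b, d (φ b) = φ (δ b)) (he : ∀ l, d (e l) = e (l + 1))
    (n : ℕ) (A : ℕ → B) (β : ℕ →₀ B) :
    linForm φ e (formOp δ n A β) = derivOp d n (fun j => φ (A j)) (linForm φ e β) := by
  simp only [formOp, derivOp, map_add, map_sum, linForm_smul, linForm_formDeriv_iterate hφ he]

lemma linForm_symbol (n : ℕ) (A : ℕ → B) : linForm φ e (symbol n A)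
    = e n + ∑ j ∈ Finset.Icc 2 n, φ (A j) * e (n - j) := by
  simp [symbol, linForm_single]

end Evaluation

section Coefficients

variable {β : ℕ →₀ B} (hβ : ∀ l, 2 ≤ l → β l = 0)
include hβ

lemma formDeriv_iterate_of_lt (k l : ℕ) (hl : k + 1 < l) : (formDeriv δ)^[k] β l = 0 := by
  induction k generalizing l with
  | zero => exact hβ l hl
  | succ k ih =>
    obtain ⟨l, rfl⟩ : ∃ l', l = l' + 1 := ⟨l - 1, by omega⟩
    rw [Function.iterate_succ_apply', formDeriv_succ, ih _ (by omega), ih _ (by omega), map_zero,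
      add_zero]

lemma formDeriv_iterate_add_one (k : ℕ) : (formDeriv δ)^[k] β (k + 1) = β 1 := by
  induction k with
  | zero => rfl
  | succ k ih =>
    rw [Function.iterate_succ_apply', formDeriv_succ, ih,
      formDeriv_iterate_of_lt δ hβ _ _ (by omega), map_zero, zero_add]

lemma formDeriv_iterate_self (k : ℕ) : (formDeriv δ)^[k] β k = β 0 + k * δ (β 1) := by
  induction k with
  | zero => simp
  | succ k ih =>
    rw [Function.iterate_succ_apply', formDeriv_succ, ih, formDeriv_iterate_add_one δ hβ]
    push_cast
    ring

lemma formDeriv_iterate_succ (k : ℕ) : (formDeriv δ)^[k + 1] β k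
    = ((k + 1 : ℕ) : B) * δ (β 0) + ((k + 1).choose 2 : B) * δ (δ (β 1)) := by
  induction k with
  | zero => simp [formDeriv_zero]
  | succ k ih =>
    rw [Function.iterate_succ_apply', formDeriv_succ, ih, formDeriv_iterate_self δ hβ,
      Nat.choose_succ_succ' (k + 1) 1, Nat.choose_one_right, map_add, Derivation.leibniz,
      Derivation.map_natCast]
    simp only [smul_eq_mul]
    push_cast
    ring

lemma formDeriv_iterate_add_two (k : ℕ) : (formDeriv δ)^[k + 2] β k
    = ((k + 2).choose 2 : B) * δ (δ (β 0)) + ((k + 2).choose 3 : B) * δ (δ (δ (β 1))) := by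
  induction k with
  | zero => simp [formDeriv_zero]
  | succ k ih =>
    rw [Function.iterate_succ_apply', formDeriv_succ, ih, formDeriv_iterate_succ δ hβ,
      Nat.choose_succ_succ' (k + 2) 1, Nat.choose_succ_succ' (k + 2) 2, Nat.choose_one_right,
      map_add, Derivation.leibniz, Derivation.leibniz, Derivation.map_natCast,
      Derivation.map_natCast]
    simp only [smul_eq_mul]
    push_cast
    ring

end Coefficients

section Symbol

variable (A : ℕ → B)

lemma symbol_apply (n l : ℕ) : symbol n A l
    = (if n = l then 1 else 0) + ∑ j ∈ Finset.Icc 2 n, if n - j = l then A j else 0 := by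
  classical
  simp only [symbol, Finsupp.add_apply, Finsupp.finsetSum_apply, Finsupp.single_apply]

lemma symbol_self (n : ℕ) : symbol n A n = 1 := by
  rw [symbol_apply, if_pos rfl, Finset.sum_eq_zero, add_zero]
  intro j hj
  rw [Finset.mem_Icc] at hj
  rw [if_neg (by omega)]

lemma symbol_of_lt {n l : ℕ} (h : n < l) : symbol n A l = 0 := by
  rw [symbol_apply, if_neg (by omega), Finset.sum_eq_zero, add_zero]
  intro j hj
  rw [if_neg (by omega)]

lemma symbol_pred (k : ℕ) : symbol (k + 1) A k = 0 := by
  rw [symbol_apply, if_neg (by omega), Finset.sum_eq_zero, add_zero]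
  intro j hj
  rw [Finset.mem_Icc] at hj
  rw [if_neg (by omega)]

lemma symbol_add (k j : ℕ) (hj : 2 ≤ j) : symbol (k + j) A k = A j := by
  rw [symbol_apply, if_neg (by omega), zero_add, Finset.sum_eq_single_of_mem j]
  · rw [if_pos (by omega)]
  · rw [Finset.mem_Icc]
    omega
  · intro i hi hij
    rw [Finset.mem_Icc] at hi
    rw [if_neg (by omega)]

end Symbol

/-- The coefficients `a, -ξ` of `a y - ξ y'` with `a = (n-1)/2 ξ'`. -/
def densityCoeff (n : ℕ) (ξ : B) : ℕ →₀ B :=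
  Finsupp.single 0 ((((n : K) - 1) / 2) • δ ξ) - Finsupp.single 1 ξ

/-- The coefficients of `L (a y - ξ y') + ξ (L y)'` reduced modulo the equation `L y = 0`. -/
def residue (n : ℕ) (A : ℕ → B) (ξ : B) : ℕ →₀ B :=
  let θ := formOp δ n A (densityCoeff δ n ξ) + ξ • formDeriv δ (symbol n A)
  θ - θ n • symbol n A

lemma densityCoeff_zero (n : ℕ) (ξ : B) :
    densityCoeff δ n ξ 0 = (((n : K) - 1) / 2) • δ ξ := by
  simp [densityCoeff]

lemma densityCoeff_one (n : ℕ) (ξ : B) : densityCoeff δ n ξ 1 = -ξ := by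
  simp [densityCoeff]

lemma densityCoeff_of_le (n : ℕ) (ξ : B) (l : ℕ) (hl : 2 ≤ l) : densityCoeff δ n ξ l = 0 := by
  classical
  simp [densityCoeff, show 0 ≠ l by omega, show 1 ≠ l by omega]

lemma formOp_apply (n : ℕ) (A : ℕ → B) (β : ℕ →₀ B) (l : ℕ) : formOp δ n A β l
    = (formDeriv δ)^[n] β l + ∑ j ∈ Finset.Icc 2 n, A j * (formDeriv δ)^[n - j] β l := by
  simp [formOp]

lemma residue_of_le {n : ℕ} (hn : n ≠ 0) (A : ℕ → B) (ξ : B) (l : ℕ) (hl : n ≤ l) :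
    residue δ n A ξ l = 0 := by
  have hβ := densityCoeff_of_le δ n ξ
  obtain ⟨k, rfl⟩ := Nat.exists_eq_succ_of_ne_zero hn
  rcases Nat.lt_or_eq_of_le hl with hlt | rfl
  · have h0 : formOp δ (k + 1) A (densityCoeff δ (k + 1) ξ) l
        = if l = k + 2 then -ξ else 0 := by
      rw [formOp_apply, Finset.sum_eq_zero, add_zero]
      · split_ifs with h
        · rw [h, formDeriv_iterate_add_one δ hβ, densityCoeff_one]
        · exact formDeriv_iterate_of_lt δ hβ _ _ (by omega)
      · intro j hj
        rw [Finset.mem_Icc] at hj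
        rw [formDeriv_iterate_of_lt δ hβ _ _ (by omega), mul_zero]
    have h1 : formDeriv δ (symbol (k + 1) A) l = if l = k + 2 then 1 else 0 := by
      obtain ⟨l, rfl⟩ : ∃ l', l = l' + 1 := ⟨l - 1, by omega⟩
      rw [formDeriv_succ, symbol_of_lt A hlt, map_zero, zero_add]
      split_ifs with h
      · rw [show l = k + 1 by omega, symbol_self A]
      · exact symbol_of_lt A (by omega)
    simp only [residue, Finsupp.sub_apply, Finsupp.add_apply, Finsupp.smul_apply, smul_eq_mul, h0,
      h1, symbol_of_lt A hlt]
    split_ifs <;> simp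
  · simp only [residue, Finsupp.sub_apply, Finsupp.smul_apply, smul_eq_mul, symbol_self A,
      mul_one, sub_self]

/-- The coefficient of order `n - 2` of the residue is a third order operator applied to `ξ`. -/
lemma residue_sub_two [CharZero K] {k : ℕ} (hk : k ≠ 0) (A : ℕ → B) (ξ : B) :
    residue δ (k + 2) A ξ k
      = (((k : K) + 2) * (k + 1) * (k + 3) / 12) • δ (δ (δ ξ)) + 2 * A 2 * δ ξ + δ (A 2) * ξ := by
  obtain ⟨k, rfl⟩ := Nat.exists_eq_succ_of_ne_zero hk
  have hβ := densityCoeff_of_le δ (k + 1 + 2) ξ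
  set β := densityCoeff δ (k + 1 + 2) ξ with hβ_def
  have hsum (l : ℕ) (hl : l ∈ Finset.Icc 2 (k + 1 + 2)) : (formDeriv δ)^[k + 1 + 2 - l] β (k + 1)
      = if l = 2 then β 0 + (k + 1 : ℕ) * δ (β 1) else if l = 3 then β 1 else 0 := by
    rw [Finset.mem_Icc] at hl
    split_ifs with h2 h3
    · rw [h2, show k + 1 + 2 - 2 = k + 1 by omega, formDeriv_iterate_self δ hβ]
    · rw [h3, show k + 1 + 2 - 3 = k by omega, formDeriv_iterate_add_one δ hβ]
    · exact formDeriv_iterate_of_lt δ hβ _ _ (by omega)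
  have hk1 : formOp δ (k + 1 + 2) A β (k + 1)
      = ((k + 1 + 2).choose 2 : B) * δ (δ (β 0)) + ((k + 1 + 2).choose 3 : B) * δ (δ (δ (β 1)))
        + (A 2 * (β 0 + (k + 1 : ℕ) * δ (β 1)) + A 3 * β 1) := by
    rw [formOp_apply, formDeriv_iterate_add_two δ hβ,
      Finset.sum_congr rfl fun l hl => by rw [hsum l hl],
      Finset.sum_eq_add_of_mem 2 3 (by simp) (by simp) (by norm_num)
        (fun l _ hl => by rw [if_neg hl.1, if_neg hl.2, mul_zero])]
    simp
  have hk3 : formOp δ (k + 1 + 2) A β (k + 1 + 2) = β 0 + (k + 1 + 2 : ℕ) * δ (β 1) := by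
    rw [formOp_apply, formDeriv_iterate_self δ hβ, Finset.sum_eq_zero, add_zero]
    intro j hj
    rw [Finset.mem_Icc] at hj
    rw [formDeriv_iterate_of_lt δ hβ _ _ (by omega), mul_zero]
  have hs1 : formDeriv δ (symbol (k + 1 + 2) A) (k + 1) = δ (A 2) + A 3 := by
    rw [formDeriv_succ, symbol_add A (k + 1) 2 le_rfl, show k + 1 + 2 = k + 3 by ring,
      symbol_add A k 3 (by norm_num)]
  have hs3 : formDeriv δ (symbol (k + 1 + 2) A) (k + 1 + 2) = 0 := by
    rw [show k + 1 + 2 = (k + 1 + 1) + 1 by ring, formDeriv_succ, symbol_self A,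
      symbol_pred, Derivation.map_one_eq_zero, add_zero]
  have h0 : β 0 = (((k : K) + 2) / 2) • δ ξ := by
    rw [hβ_def, densityCoeff_zero]
    push_cast
    congr 1
    ring
  have h1 : β 1 = -ξ := densityCoeff_one δ _ ξ
  have hc2 : ((k + 1 + 2).choose 2 : B) = algebraMap K B (((k : K) + 3) * (k + 2) / 2) := by
    rw [← map_natCast (algebraMap K B), Nat.cast_choose_two]
    congr 1
    push_cast
    ring
  have hc3 : ((k + 1 + 2).choose 3 : B)
      = algebraMap K B (((k : K) + 3) * (k + 2) * (k + 1) / 6) := by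
    have h6 : ((k + 1 + 2).choose 3 : K) * 6 = ((k : K) + 3) * (k + 2) * (k + 1) := by
      have := Nat.descFactorial_eq_factorial_mul_choose (k + 3) 3
      simp only [Nat.descFactorial, Nat.factorial] at this
      have h := congrArg (Nat.cast : ℕ → K) this
      simp only [show k + 3 - 2 = k + 1 by omega, show k + 3 - 1 = k + 2 by omega] at h
      push_cast at h
      have h' : ((k + 1 + 2).choose 3 : K) = ((k + 3).choose 3 : K) := rfl
      rw [h']
      linear_combination -h
    rw [← map_natCast (algebraMap K B)]
    congr 1
    rw [← h6]
    field_simp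
  simp only [residue, Finsupp.sub_apply, Finsupp.add_apply, Finsupp.smul_apply, smul_eq_mul, hk1,
    hk3, hs1, hs3, symbol_add A (k + 1) 2 le_rfl, ← hβ_def]
  rw [h0, h1, hc2, hc3]
  simp only [Derivation.map_smul, map_neg]
  simp only [Algebra.smul_def]
  have e1 : algebraMap K B (((k : K) + 3) * (k + 2) / 2) * algebraMap K B (((k : K) + 2) / 2)
      - algebraMap K B (((k : K) + 3) * (k + 2) * (k + 1) / 6)
      = algebraMap K B ((((k + 1 : ℕ) : K) + 2) * ((k + 1 : ℕ) + 1) * ((k + 1 : ℕ) + 3) / 12) := by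
    rw [← map_mul, ← map_sub]
    congr 1
    push_cast
    ring
  push_cast at e1 ⊢
  linear_combination (δ (δ (δ ξ))) * e1

end LinearForms

/-! ### Densities -/

section Symmetric

variable {K R : Type*} [Field K] [CommRing R] [Algebra K R]

/-- The span of the products `u^(n-1-k) v^k`, `0 ≤ k ≤ n - 1`. -/
def symSpan (K : Type*) {R : Type*} [Field K] [CommRing R] [Algebra K R] (n : ℕ) (u v : R) :
    Submodule K R :=
  Submodule.span K (Set.range fun k : Fin n => u ^ (n - 1 - (k : ℕ)) * v ^ (k : ℕ))

lemma pow_mul_pow_mem_symSpan {p q n : ℕ} (h : p + q + 1 = n) (u v : R) :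
    u ^ p * v ^ q ∈ symSpan K n u v :=
  Submodule.subset_span ⟨⟨q, by omega⟩, by
    dsimp only
    rw [show n - 1 - q = p by omega]⟩

/-- The Lie derivative `(n-1)/2 ξ' s - ξ s'` of a density `s` of weight `-(n-1)/2` along `-ξ`. -/
def density (d : Derivation K R R) (n : ℕ) (ξ s : R) : R :=
  (((n : K) - 1) / 2) • d ξ * s - ξ * d s

variable (d : Derivation K R R) {u v : R}

lemma mul_derivation_pow (p : ℕ) : u * d (u ^ p) = p * u ^ p * d u := by
  cases p with
  | zero => simp
  | succ p =>
    rw [Derivation.leibniz_pow, Nat.add_sub_cancel, nsmul_eq_mul, smul_eq_mul]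
    ring

/-- The Lie derivatives along `u²`, `uv` and `v²` preserve the span of the `u^(n-1-k) v^k`. -/
lemma density_mem_symSpan [CharZero K] (hW : u * d v - d u * v = 1) {n : ℕ} {ξ s : R}
    (hξ : ξ ∈ symSpan K 3 u v) (hs : s ∈ symSpan K n u v) :
    density d n ξ s ∈ symSpan K n u v := by
  have h2 : algebraMap K R (1 / 2) * 2 = 1 := by
    rw [← map_ofNat (algebraMap K R) 2, ← map_mul]
    norm_num
  induction hξ using Submodule.span_induction with
  | zero => simp [density]
  | add x y _ _ hx hy =>
    have : density d n (x + y) s = density d n x s + density d n y s := by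
      simp only [density, map_add, smul_add]
      ring
    rw [this]
    exact add_mem hx hy
  | smul r x _ hx =>
    have : density d n (r • x) s = r • density d n x s := by
      simp only [density, Derivation.map_smul, smul_sub, smul_mul_assoc, smul_comm r]
    rw [this]
    exact Submodule.smul_mem _ _ hx
  | mem ξ hξ =>
    induction hs using Submodule.span_induction with
    | zero => simp [density]
    | add x y _ _ hx hy =>
      have : density d n ξ (x + y) = density d n ξ x + density d n ξ y := by
        simp only [density, map_add]
        ring
      rw [this]
      exact add_mem hx hy
    | smul r x _ hx =>
      have : density d n ξ (r • x) = r • density d n ξ x := by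
        simp only [density, Derivation.map_smul, smul_sub, mul_smul_comm]
      rw [this]
      exact Submodule.smul_mem _ _ hx
    | mem s hs =>
      obtain ⟨⟨q, hq⟩, rfl⟩ := hs
      obtain ⟨p, rfl⟩ : ∃ p, n = p + q + 1 := ⟨n - 1 - q, by omega⟩
      have hn : (((p + q + 1 : ℕ) : K) - 1) / 2 = (p + q : ℕ) * (1 / 2) := by
        push_cast
        ring
      have hds : d (u ^ p * v ^ q) = u ^ p * d (v ^ q) + v ^ q * d (u ^ p) := by
        rw [Derivation.leibniz, smul_eq_mul, smul_eq_mul]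
      have hu := mul_derivation_pow d (u := u) p
      have hv := mul_derivation_pow d (u := v) q
      simp only [show p + q + 1 - 1 - q = p by omega]
      rw [density, hn, Algebra.smul_def, map_mul, map_natCast]
      obtain ⟨k, rfl⟩ := hξ
      fin_cases k
      · -- along `u²` the product `u^p v^q` goes to `-q u^(p+1) v^(q-1)`
        have h1 : ((p + q : ℕ) : R) * algebraMap K R (1 / 2) * d (u ^ 2 * v ^ 0) * (u ^ p * v ^ q)
            - u ^ 2 * v ^ 0 * d (u ^ p * v ^ q)
            = (q * u ^ p * v ^ q * d u - u ^ (p + 1) * d (v ^ q)) * u := by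
          have hu2 : d (u ^ 2 * v ^ 0) = 2 * u * d u := by
            simp [Derivation.leibniz_pow, mul_assoc]
          rw [hds, hu2]
          push_cast
          linear_combination (u * d u * (p + q) * (u ^ p * v ^ q)) * h2 - u * v ^ q * hu
        change ((p + q : ℕ) : R) * algebraMap K R (1 / 2) * d (u ^ 2 * v ^ 0) * (u ^ p * v ^ q)
            - u ^ 2 * v ^ 0 * d (u ^ p * v ^ q) ∈ _
        rw [h1]
        cases q with
        | zero => simp
        | succ q =>
          have h3 : (((q + 1 : ℕ) : R) * u ^ p * v ^ (q + 1) * d u - u ^ (p + 1) * d (v ^ (q + 1)))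
              * u = (-(q + 1 : ℕ) : K) • (u ^ (p + 1) * v ^ q) := by
            rw [Derivation.leibniz_pow, nsmul_eq_mul, smul_eq_mul, Nat.add_sub_cancel,
              Algebra.smul_def, map_neg, map_natCast]
            linear_combination (-(q + 1 : ℕ) * u ^ (p + 1) * v ^ q) * hW
          rw [h3]
          exact Submodule.smul_mem _ _ (pow_mul_pow_mem_symSpan (by ring) u v)
      · -- along `uv` it is an eigenvector of eigenvalue `(p - q) / 2`
        have h1 : ((p + q : ℕ) : R) * algebraMap K R (1 / 2) * d (u ^ 1 * v ^ 1) * (u ^ p * v ^ q)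
            - u ^ 1 * v ^ 1 * d (u ^ p * v ^ q)
            = (((p : K) - q) * (1 / 2)) • (u ^ p * v ^ q) := by
          have he : algebraMap K R (((p : K) - q) * (1 / 2))
              = ((p : R) - q) * algebraMap K R (1 / 2) := by
            rw [map_mul, map_sub, map_natCast, map_natCast]
          rw [hds, Algebra.smul_def, he]
          simp only [pow_one, Derivation.leibniz, smul_eq_mul]
          push_cast
          linear_combination (-v * v ^ q) * hu - (u * u ^ p) * hv
            + (q * u * u ^ p * v ^ q * d v + p * v * u ^ p * v ^ q * d u) * h2
            + ((p - q : R) * algebraMap K R (1 / 2) * u ^ p * v ^ q) * hW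
        change ((p + q : ℕ) : R) * algebraMap K R (1 / 2) * d (u ^ 1 * v ^ 1) * (u ^ p * v ^ q)
            - u ^ 1 * v ^ 1 * d (u ^ p * v ^ q) ∈ _
        rw [h1]
        exact Submodule.smul_mem _ _ (pow_mul_pow_mem_symSpan rfl u v)
      · -- along `v²` it goes to `p u^(p-1) v^(q+1)`
        have h1 : ((p + q : ℕ) : R) * algebraMap K R (1 / 2) * d (u ^ 0 * v ^ 2) * (u ^ p * v ^ q)
            - u ^ 0 * v ^ 2 * d (u ^ p * v ^ q)
            = (p * u ^ p * v ^ q * d v - v ^ (q + 1) * d (u ^ p)) * v := by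
          have hv2 : d (u ^ 0 * v ^ 2) = 2 * v * d v := by
            simp [Derivation.leibniz_pow, mul_assoc]
          rw [hds, hv2]
          push_cast
          linear_combination (v * d v * (p + q) * (u ^ p * v ^ q)) * h2 - v * u ^ p * hv
        change ((p + q : ℕ) : R) * algebraMap K R (1 / 2) * d (u ^ 0 * v ^ 2) * (u ^ p * v ^ q)
            - u ^ 0 * v ^ 2 * d (u ^ p * v ^ q) ∈ _
        rw [h1]
        cases p with
        | zero => simp
        | succ p =>
          have h3 : (((p + 1 : ℕ) : R) * u ^ (p + 1) * v ^ q * d v - v ^ (q + 1) * d (u ^ (p + 1)))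
              * v = ((p + 1 : ℕ) : K) • (u ^ p * v ^ (q + 1)) := by
            rw [Derivation.leibniz_pow, nsmul_eq_mul, smul_eq_mul, Nat.add_sub_cancel,
              Algebra.smul_def, map_natCast]
            linear_combination ((p + 1 : ℕ) * u ^ p * v ^ (q + 1)) * hW
          rw [h3]
          exact Submodule.smul_mem _ _ (pow_mul_pow_mem_symSpan (by ring) u v)

end Symmetric

/-! ### Classification of the point symmetries -/

section Classification

variable {K O : Type*} [Field K] [CommRing O] [Algebra K O] {m : ℕ}

namespace Coordinates

/-- The functions of `x` alone: those with vanishing derivatives `∂/∂y_i`. -/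
def base (c : Coordinates K O m) : Subalgebra K O where
  carrier := {f | ∀ i, c.dy i f = 0}
  mul_mem' {f g} hf hg i := by rw [Derivation.leibniz, hf i, hg i, smul_zero, smul_zero, add_zero]
  add_mem' {f g} hf hg i := by rw [map_add, hf i, hg i, add_zero]
  algebraMap_mem' r i := Derivation.map_algebraMap _ _

variable {c : Coordinates K O m}

lemma dx_mem_base (hc : c.IsRegular) {f : O} (hf : f ∈ c.base) : c.dx f ∈ c.base := fun i => by
  rw [← hc.dx_dy, hf i, map_zero]

lemma iterate_dx_mem_base (hc : c.IsRegular) {f : O} (hf : f ∈ c.base) (l : ℕ) :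
    c.dx^[l] f ∈ c.base := by
  induction l with
  | zero => exact hf
  | succ l ih =>
    rw [Function.iterate_succ_apply']
    exact dx_mem_base hc ih

lemma derivOp_mem_base (hc : c.IsRegular) {n : ℕ} {A : ℕ → O} (hA : ∀ j, A j ∈ c.base) {f : O}
    (hf : f ∈ c.base) : derivOp c.dx n A f ∈ c.base :=
  add_mem (iterate_dx_mem_base hc hf _)
    (sum_mem fun j _ => mul_mem (hA j) (iterate_dx_mem_base hc hf _))

/-- The derivation `d/dx` of the functions of `x` alone. -/
def baseDeriv (hc : c.IsRegular) : Derivation K c.base c.base :=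
  Derivation.mk'
    { toFun := fun f => ⟨c.dx f, dx_mem_base hc f.2⟩
      map_add' := fun f g => Subtype.ext (by simp)
      map_smul' := fun r f => Subtype.ext (by simp) }
    (fun f g => Subtype.ext (by simp))

lemma D_iterate_C (hc : c.IsRegular) {f : O} (hf : f ∈ c.base) (l : ℕ) :
    c.D^[l] (MvPolynomial.C f) = MvPolynomial.C (c.dx^[l] f) := by
  induction l with
  | zero => rfl
  | succ l ih =>
    rw [Function.iterate_succ_apply', ih, D_C_of_base (iterate_dx_mem_base hc hf l),
      Function.iterate_succ_apply']

lemma derivOp_C (hc : c.IsRegular) (n : ℕ) (A : ℕ → O) {f : O} (hf : f ∈ c.base) :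
    derivOp c.D n (fun j => MvPolynomial.C (A j)) (MvPolynomial.C f)
      = MvPolynomial.C (derivOp c.dx n A f) := by
  simp only [derivOp, D_iterate_C hc hf, map_add, map_sum, map_mul]

/-- For a field `ξ ∂/∂x + (n-1)/2 ξ' ∑ i, y_i ∂/∂y_i` with `ξ = ξ(x)`, the invariance condition
reduces to the vanishing of the coefficients `ρ_l` of a linear form in the jet coordinates of order
less than `n`, the same form describes the action of the scalar operator on `(n-1)/2 ξ' f - ξ f'`
for solutions `f`, and `ρ_(n-2)` is explicit. -/
lemma exists_residue [CharZero K] (hc : c.IsRegular) {k : ℕ} (hk : k ≠ 0) {A : ℕ → O}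
    (hA : ∀ j, A j ∈ c.base) {ξ : O} (hξ : ξ ∈ c.base) :
    ∃ ρ : ℕ → O, (∀ l, ρ l ∈ c.base) ∧
      (∀ i, c.onShell (k + 2) A
          (derivOp c.D (k + 2) (fun j => MvPolynomial.C (A j))
            (MvPolynomial.C (((((k + 2 : ℕ) : K) - 1) / 2) • c.dx ξ * c.y i)
              - MvPolynomial.C ξ * MvPolynomial.X (i, 0))
          + MvPolynomial.C ξ * c.D (c.equation (k + 2) A i))
        = ∑ l ∈ Finset.range (k + 2), MvPolynomial.C (ρ l) * c.jet i l) ∧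
      (∀ f, derivOp c.dx (k + 2) A f = 0 →
        ∑ l ∈ Finset.range (k + 2), ρ l * c.dx^[l] f
          = derivOp c.dx (k + 2) A (density c.dx (k + 2) ξ f)) ∧
      ρ k = (((k : K) + 2) * (k + 1) * (k + 3) / 12) • c.dx (c.dx (c.dx ξ))
        + 2 * A 2 * c.dx ξ + c.dx (A 2) * ξ := by
  let δ := baseDeriv hc
  let B : ℕ → c.base := fun j => ⟨A j, hA j⟩
  let x : c.base := ⟨ξ, hξ⟩
  let r := residue δ (k + 2) B x
  let θ := formOp δ (k + 2) B (densityCoeff δ (k + 2) x) + x • formDeriv δ (symbol (k + 2) B)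
  have hr : r = θ - θ (k + 2) • symbol (k + 2) B := rfl
  have hr0 : ∀ l, k + 2 ≤ l → r l = 0 := residue_of_le δ (by omega) B x
  refine ⟨fun l => r l, fun l => (r l).2, fun i => ?_, fun f hf => ?_, ?_⟩
  · let φ : c.base →+* Jet O m := MvPolynomial.C.comp c.base.val.toRingHom
    have hφ : ∀ b, c.D (φ b) = φ (δ b) := fun b => D_C_of_base b.2
    have he : ∀ l, c.D (c.jet i l) = c.jet i (l + 1) := D_jet hc i
    have hΛ : linForm φ (c.jet i) (symbol (k + 2) B) = c.equation (k + 2) A i :=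
      linForm_symbol _ _
    have hβ : linForm φ (c.jet i) (densityCoeff δ (k + 2) x)
        = MvPolynomial.C (((((k + 2 : ℕ) : K) - 1) / 2) • c.dx ξ * c.y i)
          - MvPolynomial.C ξ * MvPolynomial.X (i, 0) := by
      rw [densityCoeff, map_sub, linForm_single, linForm_single, map_mul]
      rfl
    have hθ := linForm_formOp hφ he (k + 2) B (densityCoeff δ (k + 2) x)
    have hlin : linForm φ (c.jet i) r
        = derivOp c.D (k + 2) (fun j => MvPolynomial.C (A j))
            (MvPolynomial.C (((((k + 2 : ℕ) : K) - 1) / 2) • c.dx ξ * c.y i)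
              - MvPolynomial.C ξ * MvPolynomial.X (i, 0))
          + MvPolynomial.C ξ * c.D (c.equation (k + 2) A i)
          - φ (θ (k + 2)) * c.equation (k + 2) A i := by
      rw [hr, map_sub, linForm_smul, hΛ, map_add, linForm_smul, linForm_formDeriv hφ he, hΛ, hθ, hβ]
      rfl
    have hsum := linForm_eq_sum_range φ (c.jet i) hr0
    rw [sub_eq_iff_eq_add.1 hlin.symm, map_add, map_mul, onShell_equation (by omega), mul_zero,
      add_zero, hsum, map_sum]
    refine Finset.sum_congr rfl fun l hl => ?_
    rw [map_mul, onShell_jet_of_lt A i (Finset.mem_range.1 hl)]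
    exact congrArg (· * _) (onShell_C _ _ _)
  · let φ : c.base →+* O := c.base.val.toRingHom
    let e : ℕ → O := fun l => c.dx^[l] f
    have hφ : ∀ b, c.dx (φ b) = φ (δ b) := fun b => rfl
    have he : ∀ l, c.dx (e l) = e (l + 1) := fun l => (Function.iterate_succ_apply' _ _ _).symm
    have hΛ : linForm φ e (symbol (k + 2) B) = 0 := (linForm_symbol _ _).trans hf
    have hβ : linForm φ e (densityCoeff δ (k + 2) x) = density c.dx (k + 2) ξ f := by
      rw [densityCoeff, map_sub, linForm_single, linForm_single]
      rfl
    have hθ := linForm_formOp hφ he (k + 2) B (densityCoeff δ (k + 2) x)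
    have hlin : linForm φ e r = derivOp c.dx (k + 2) A (density c.dx (k + 2) ξ f) := by
      rw [hr, map_sub, linForm_smul, hΛ, map_add, linForm_smul, linForm_formDeriv hφ he, hΛ, hθ, hβ,
        map_zero, mul_zero, mul_zero, add_zero, sub_zero]
      rfl
    rw [← hlin, linForm_eq_sum_range φ e hr0]
    rfl
  · exact congrArg Subtype.val (residue_sub_two δ hk B x)

/-- The restricted invariance condition of a field whose coefficient `ξ` depends on `x` only and
whose coefficients `η_i` are affine in `y`. -/
lemma onShell_prolong_affine (hc : c.IsRegular) {n : ℕ} (hn : n ≠ 0) {A : ℕ → O}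
    (hA : ∀ j, A j ∈ c.base) {ξ a : O} {b : Fin m → O} (hb : ∀ i, b i ∈ c.base)
    (M : Matrix (Fin m) (Fin m) K) (i : Fin m) :
    c.onShell n A (c.prolong ξ (fun i => a * c.y i + ∑ j, M j i • c.y j + b i) (c.equation n A i))
      = c.onShell n A
          (derivOp c.D n (fun j => MvPolynomial.C (A j))
            (MvPolynomial.C (a * c.y i) - MvPolynomial.C ξ * MvPolynomial.X (i, 0))
          + MvPolynomial.C ξ * c.D (c.equation n A i))
        + MvPolynomial.C (derivOp c.dx n A (b i)) := by
  have hchar : char ξ (fun i => a * c.y i + ∑ j, M j i • c.y j + b i) i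
      = (MvPolynomial.C (a * c.y i) - MvPolynomial.C ξ * MvPolynomial.X (i, 0))
        + ∑ j, M j i • (MvPolynomial.C (c.y j) : Jet O m) + MvPolynomial.C (b i) := by
    have h (r : K) (f : O) : (MvPolynomial.C (r • f) : Jet O m) = r • MvPolynomial.C f := by
      rw [Algebra.smul_def, map_mul, Algebra.smul_def]
      rfl
    simp only [char, map_add, map_sum, h]
    ring
  have hM (j : Fin m) : derivOp c.D n (fun j => MvPolynomial.C (A j)) (MvPolynomial.C (c.y j))
      = c.equation n A j := (equation_eq_derivOp hc n A j).symm
  rw [prolong_equation hc n hA, hchar]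
  have hadd (P Q : Jet O m) : derivOp c.D n (fun j => MvPolynomial.C (A j)) (P + Q)
      = derivOp c.D n (fun j => MvPolynomial.C (A j)) P
        + derivOp c.D n (fun j => MvPolynomial.C (A j)) Q := by
    simp only [← derivOpₗ_apply, map_add]
  have hsum : derivOp c.D n (fun j => MvPolynomial.C (A j))
      (∑ j, M j i • (MvPolynomial.C (c.y j) : Jet O m)) = ∑ j, M j i • c.equation n A j := by
    simp only [← derivOpₗ_apply, map_sum, map_smul] at hM ⊢
    simp only [hM]
  rw [hadd, hadd, hsum, derivOp_C hc n A (hb i)]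
  simp only [map_add, map_sum, onShell_C]
  have h0 (j : Fin m) : c.onShell n A (M j i • c.equation n A j) = 0 := by
    rw [Algebra.smul_def, map_mul, onShell_equation hn, mul_zero]
  simp only [h0, Finset.sum_const_zero, add_zero]
  ring

lemma vert_jet (hc : c.IsRegular) (i : Fin m) (l l' : ℕ) :
    c.vert i l (c.jet i l') = if l' = l then 1 else 0 := by
  cases l with
  | zero =>
    cases l' with
    | zero => simp [jet, hc.dy_y]
    | succ l' => simp [jet]
  | succ l => simp [vert_jet_succ]

lemma vert_C_of_base {f : O} (hf : f ∈ c.base) (i : Fin m) (l : ℕ) :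
    c.vert i l (MvPolynomial.C f) = 0 := by
  cases l with
  | zero => rw [vert_zero_C, hf i, map_zero]
  | succ l => exact vert_succ_C _ _ _

/-- The functions `y_i, y_i^(1), …` and `1` are linearly independent over the functions of `x`. -/
lemma eq_zero_of_jet_relation (hc : c.IsRegular) (i : Fin m) {n : ℕ} {ρ : ℕ → O}
    (hρ : ∀ l, ρ l ∈ c.base) {b : O} (hb : b ∈ c.base)
    (h : ∑ l ∈ Finset.range n, MvPolynomial.C (ρ l) * c.jet i l + MvPolynomial.C b = 0) :
    (∀ l < n, ρ l = 0) ∧ b = 0 := by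
  have h1 : ∀ l < n, ρ l = 0 := fun l hl => by
    have h2 := congrArg (c.vert i l) h
    rw [map_add, vert_C_of_base hb, map_sum, Finset.sum_eq_single_of_mem l (Finset.mem_range.2 hl)
      (fun l' _ hl' => by
        rw [Derivation.leibniz, vert_C_of_base (hρ l'), vert_jet hc, if_neg hl', smul_zero,
          smul_zero, add_zero]), Derivation.leibniz, vert_C_of_base (hρ l), vert_jet hc, if_pos rfl,
      smul_zero, smul_eq_mul, mul_one, add_zero, add_zero, map_zero] at h2
    exact MvPolynomial.C_injective _ _ (h2.trans (map_zero _).symm)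
  refine ⟨h1, ?_⟩
  rw [Finset.sum_eq_zero fun l hl => by rw [h1 l (Finset.mem_range.1 hl), map_zero, zero_mul],
    zero_add] at h
  exact MvPolynomial.C_injective _ _ (h.trans (map_zero _).symm)

/-- The hypotheses from which the structure of the symmetry algebra is derived: `u`, `v` are
functions of `x` with Wronskian `1`, and the products `u^(n-1-k) v^k` solve the scalar equation. -/
structure IsCanonical (c : Coordinates K O m) (n : ℕ) (A : ℕ → O) (u v : O) : Prop where
  regular : c.IsRegular
  nontrivial : Nontrivial O
  coeff_mem : ∀ j, A j ∈ c.base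
  u_mem : u ∈ c.base
  v_mem : v ∈ c.base
  wronskian : u * c.dx v - c.dx u * v = 1
  solution : ∀ k : Fin n, derivOp c.dx n A (u ^ (n - 1 - (k : ℕ)) * v ^ (k : ℕ)) = 0

namespace IsCanonical

variable {n : ℕ} {A : ℕ → O} {u v : O}

lemma symSpan_le_base (h : c.IsCanonical n A u v) (N : ℕ) {s : O} (hs : s ∈ symSpan K N u v) :
    s ∈ c.base := by
  have : symSpan K N u v ≤ Subalgebra.toSubmodule c.base := by
    rw [symSpan, Submodule.span_le]
    rintro _ ⟨k, rfl⟩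
    exact c.base.mul_mem (pow_mem h.u_mem _) (pow_mem h.v_mem _)
  exact this hs

lemma derivOp_eq_zero (h : c.IsCanonical n A u v) {s : O} (hs : s ∈ symSpan K n u v) :
    derivOp c.dx n A s = 0 := by
  have : symSpan K n u v ≤ LinearMap.ker (derivOpₗ c.dx n A) := by
    rw [symSpan, Submodule.span_le]
    rintro _ ⟨k, rfl⟩
    exact (derivOpₗ_apply _ _ _ _).trans (h.solution k)
  exact (derivOpₗ_apply _ _ _ _).symm.trans (this hs)

/-- A function of `x` solving a linear equation that is solved by all `u^(N-1-k) v^k` is a linear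
combination of these. -/
lemma mem_symSpan [CharZero K] (h : c.IsCanonical n A u v) {N : ℕ} (hN : N ≠ 0) (a : ℕ → O)
    (hs : ∀ k : Fin N, derivOp c.dx N a (u ^ (N - 1 - (k : ℕ)) * v ^ (k : ℕ)) = 0) {f : O}
    (hf : f ∈ c.base) (hf0 : derivOp c.dx N a f = 0) : f ∈ symSpan K N u v := by
  obtain ⟨N, rfl⟩ := Nat.exists_eq_succ_of_ne_zero hN
  obtain ⟨φ, hφ, hdx, hdy⟩ := exists_coefficients h.wronskian N a hs hf0
  rw [hφ]
  refine sum_mem fun k _ => ?_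
  obtain ⟨r, hr⟩ := h.regular.exists_const (φ k) (hdx k) fun i =>
    hdy (c.dy i) (h.regular.dx_dy i) (h.u_mem i) (h.v_mem i) (hf i) k
  rw [hr, ← Algebra.smul_def]
  exact Submodule.smul_mem _ _ (Submodule.subset_span ⟨k, rfl⟩)

/-- The residue of an element of the span of `u²`, `uv`, `v²` vanishes, because as a differential
operator it annihilates the solutions `u^(n-1-k) v^k`. -/
lemma residue_eq_zero [CharZero K] {k : ℕ} (h : c.IsCanonical (k + 2) A u v) {ξ : O}
    (hξ : ξ ∈ symSpan K 3 u v) {ρ : ℕ → O}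
    (hρ : ∀ f, derivOp c.dx (k + 2) A f = 0 →
        ∑ l ∈ Finset.range (k + 2), ρ l * c.dx^[l] f
          = derivOp c.dx (k + 2) A (density c.dx (k + 2) ξ f)) (l : ℕ) (hl : l < k + 2) :
    ρ l = 0 := by
  have h1 := eq_zero_of_annihilates h.wronskian (k + 1) (fun l => ρ l) fun j => by
    have hs : u ^ (k + 2 - 1 - (j : ℕ)) * v ^ (j : ℕ) ∈ symSpan K (k + 2) u v :=
      Submodule.subset_span ⟨j, rfl⟩
    have h2 := hρ _ (h.derivOp_eq_zero hs)
    rw [h.derivOp_eq_zero (density_mem_symSpan c.dx h.wronskian hξ hs),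
      ← Fin.sum_univ_eq_sum_range (fun l => ρ l * c.dx^[l] _)] at h2
    exact h2
  exact congrFun h1 ⟨l, hl⟩

/-- The solutions `ξ` of the third order equation are the combinations of `u²`, `uv`, `v²`, which
solve it by `residue_eq_zero`. -/
lemma mem_symSpan_three [CharZero K] {k : ℕ} (hk : k ≠ 0) (h : c.IsCanonical (k + 2) A u v) {ξ : O}
    (hξ : ξ ∈ c.base)
    (h3 : (((k : K) + 2) * (k + 1) * (k + 3) / 12) • c.dx (c.dx (c.dx ξ))
        + 2 * A 2 * c.dx ξ + c.dx (A 2) * ξ = 0) : ξ ∈ symSpan K 3 u v := by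
  set κ : K := ((k : K) + 2) * (k + 1) * (k + 3) / 12 with hκ_def
  have hκ : κ ≠ 0 := by
    rw [hκ_def]
    have h1 : ((k : K) + 2) ≠ 0 := by exact_mod_cast (by omega : k + 2 ≠ 0)
    have h2 : ((k : K) + 1) ≠ 0 := by exact_mod_cast (by omega : k + 1 ≠ 0)
    have h3 : ((k : K) + 3) ≠ 0 := by exact_mod_cast (by omega : k + 3 ≠ 0)
    exact div_ne_zero (mul_ne_zero (mul_ne_zero h1 h2) h3) (by norm_num)
  let a : ℕ → O := fun j => if j = 2 then κ⁻¹ • (2 * A 2) else κ⁻¹ • c.dx (A 2)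
  have ha (f : O) : derivOp c.dx 3 a f
      = κ⁻¹ • (κ • c.dx (c.dx (c.dx f)) + 2 * A 2 * c.dx f + c.dx (A 2) * f) := by
    have : Finset.Icc 2 3 = {2, 3} := rfl
    rw [derivOp, this, Finset.sum_pair (by norm_num)]
    simp only [a, if_true, smul_add, smul_smul, inv_mul_cancel₀ hκ, one_smul]
    simp [add_assoc]
  refine h.mem_symSpan (by norm_num) a (fun j => ?_) hξ (by rw [ha, h3, smul_zero])
  have hj : u ^ (3 - 1 - (j : ℕ)) * v ^ (j : ℕ) ∈ symSpan K 3 u v :=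
    Submodule.subset_span ⟨j, rfl⟩
  obtain ⟨ρ, -, -, h1, h2⟩ := exists_residue h.regular hk h.coeff_mem (h.symSpan_le_base 3 hj)
  rw [ha, ← h2, h.residue_eq_zero hj h1 k (by omega), smul_zero]

/-- The invariance condition holds exactly for the fields
`ξ ∂/∂x + ∑ i, ((n-1)/2 ξ' y_i + ∑ j, M_ji y_j + b_i) ∂/∂y_i` with a constant matrix `M`, with `ξ`
in the span of `u²`, `uv`, `v²` and with `b_i` in the span of the `u^(n-1-k) v^k`. -/
theorem invariance_iff [CharZero K] (hm : 0 < m) {k : ℕ} (hk : k ≠ 0)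
    (h : c.IsCanonical (k + 2) A u v) (ξ : O) (η : Fin m → O) :
    (∀ i, c.onShell (k + 2) A (c.prolong ξ η (c.equation (k + 2) A i)) = 0) ↔
      ξ ∈ symSpan K 3 u v ∧ ∃ (M : Matrix (Fin m) (Fin m) K) (b : Fin m → O),
        (∀ i, b i ∈ symSpan K (k + 2) u v) ∧
        η = fun i => ((((k + 2 : ℕ) : K) - 1) / 2) • c.dx ξ * c.y i + ∑ j, M j i • c.y j + b i := by
  have hc := h.regular
  constructor
  · intro hinv
    obtain ⟨hξ, hηη, hηx⟩ := determining_equations hc hk h.coeff_mem hinv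
    set a : O := ((((k + 2 : ℕ) : K) - 1) / 2) • c.dx ξ with ha
    have ha' : a = ((k + 1 : K) / 2) • c.dx ξ := by
      rw [ha]
      push_cast
      congr 2
      ring
    have hdya (l : Fin m) : c.dy l a = 0 := by
      rw [ha', Derivation.map_smul, ← hc.dx_dy, hξ, map_zero, smul_zero]
    -- the constant matrix is the linear part of `η` minus its isotropic part
    have hM (i j : Fin m) :
        ∃ r : K, c.dy j (η i) - (if i = j then a else 0) = algebraMap K O r := by
      refine hc.exists_const _ ?_ fun l => ?_
      · rw [map_sub, hηx, ha']
        split_ifs <;> simp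
      · rw [map_sub, hηη]
        split_ifs <;> simp [hdya]
    choose r hr using hM
    let b : Fin m → O := fun i => η i - ∑ j, c.dy j (η i) * c.y j
    have hb (i : Fin m) : b i ∈ c.base := fun l => by
      simp only [b, map_sub, map_sum, Derivation.leibniz, hηη, hc.dy_y, smul_eq_mul, mul_zero,
        add_zero, mul_ite, mul_one]
      simp
    have hη : η = fun i => a * c.y i + ∑ j, (Matrix.of fun j i => r i j) j i • c.y j + b i := by
      funext i
      have h1 (j : Fin m) : c.dy j (η i) * c.y j
          = (if i = j then a * c.y j else 0) + r i j • c.y j := by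
        rw [Algebra.smul_def, ← hr]
        split_ifs <;> ring
      simp only [b, h1, Finset.sum_add_distrib, Finset.sum_ite_eq, Finset.mem_univ, if_true,
        Matrix.of_apply]
      ring
    obtain ⟨ρ, hρ, h1, -, h3⟩ := exists_residue hc hk h.coeff_mem hξ
    have hrel (i : Fin m) := by
      have h4 := hinv i
      rw [hη, onShell_prolong_affine hc (by omega) h.coeff_mem hb, h1] at h4
      exact eq_zero_of_jet_relation hc i hρ (derivOp_mem_base hc h.coeff_mem (hb i)) h4
    refine ⟨h.mem_symSpan_three hk hξ ?_, _, b, fun i => ?_, hη⟩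
    · rw [← h3]
      exact (hrel ⟨0, hm⟩).1 k (by omega)
    · exact h.mem_symSpan (by omega) A h.solution (hb i) (hrel i).2
  · rintro ⟨hξ, M, b, hb, rfl⟩ i
    obtain ⟨ρ, -, h1, h2, -⟩ := exists_residue hc hk h.coeff_mem (h.symSpan_le_base 3 hξ)
    rw [onShell_prolong_affine hc (by omega) h.coeff_mem fun i => h.symSpan_le_base _ (hb i), h1,
      h.derivOp_eq_zero (hb i), map_zero, add_zero]
    refine Finset.sum_eq_zero fun l hl => ?_
    rw [h.residue_eq_zero hξ h2 l (Finset.mem_range.1 hl), map_zero, zero_mul]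

end IsCanonical

end Coordinates

end Classification

/-! ### The Lie algebra of point symmetries -/

section SymmetryAlgebra

open LieAlgebra.SpecialLinear

-- The bracket of matrices is the commutator.
attribute [local instance 100] LieRing.ofAssociativeRing

variable {K O : Type*} [Field K] [CommRing O] [Algebra K O] {m : ℕ}

namespace Coordinates

variable {c : Coordinates K O m}

lemma lie_field (hc : c.IsRegular) (ξ ζ : O) (η θ : Fin m → O) :
    ⁅c.field ξ η, c.field ζ θ⁆ = c.field (c.field ξ η ζ - c.field ζ θ ξ)
      (fun i => c.field ξ η (θ i) - c.field ζ θ (η i)) := by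
  have expand (X : Derivation K O O) (ζ : O) (θ : Fin m → O) (f : O) :
      X (c.field ζ θ f) = c.field (X ζ) (fun i => X (θ i)) f
        + (ζ * X (c.dx f) + ∑ i, θ i * X (c.dy i f)) := by
    simp only [field_apply, map_add, map_sum, Derivation.leibniz, smul_eq_mul,
      Finset.sum_add_distrib]
    simp only [mul_comm (c.dx f), mul_comm (c.dy _ f)]
    ring
  -- The second order terms, which are symmetric in the two fields.
  have second (ξ ζ : O) (η θ : Fin m → O) (f : O) :
      ζ * c.field ξ η (c.dx f) + ∑ i, θ i * c.field ξ η (c.dy i f)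
        = ζ * ξ * c.dx (c.dx f) + ∑ i, ζ * η i * c.dx (c.dy i f) + ∑ i, ξ * θ i * c.dx (c.dy i f)
          + ∑ i, ∑ j, θ i * η j * c.dy j (c.dy i f) := by
    have h1 : ζ * ∑ i, η i * c.dy i (c.dx f) = ∑ i, ζ * η i * c.dx (c.dy i f) := by
      rw [Finset.mul_sum]
      exact Finset.sum_congr rfl fun i _ => by rw [hc.dx_dy, mul_assoc]
    have h2 : ∑ i, θ i * c.field ξ η (c.dy i f)
        = ∑ i, ξ * θ i * c.dx (c.dy i f) + ∑ i, ∑ j, θ i * η j * c.dy j (c.dy i f) := by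
      rw [← Finset.sum_add_distrib]
      refine Finset.sum_congr rfl fun i _ => ?_
      rw [field_apply, mul_add, Finset.mul_sum]
      simp only [mul_assoc]
      ring
    rw [h2, field_apply, mul_add, h1]
    ring
  have symm (f : O) : ζ * c.field ξ η (c.dx f) + ∑ i, θ i * c.field ξ η (c.dy i f)
      = ξ * c.field ζ θ (c.dx f) + ∑ i, η i * c.field ζ θ (c.dy i f) := by
    have h1 : ∑ i, ∑ j, θ i * η j * c.dy j (c.dy i f)
        = ∑ i, ∑ j, η i * θ j * c.dy j (c.dy i f) := by
      rw [Finset.sum_comm]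
      refine Finset.sum_congr rfl fun i _ => Finset.sum_congr rfl fun j _ => ?_
      rw [hc.dy_dy, mul_comm (θ j)]
    rw [second, second, h1]
    ring
  ext f
  rw [Derivation.commutator_apply, expand, expand, symm]
  simp only [field_apply, sub_mul, Finset.sum_sub_distrib]
  ring

lemma field_of_base {f : O} (hf : f ∈ c.base) (ξ : O) (η : Fin m → O) :
    c.field ξ η f = ξ * c.dx f := by
  simp [field_apply, show ∀ i, c.dy i f = 0 from hf]

variable (c) in
/-- The vector field `ξ ∂/∂x + (n-1)/2 ξ' ∑ i, y_i ∂/∂y_i`, as a linear function of `ξ`. -/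
def densityField (n : ℕ) : O →ₗ[K] Derivation K O O where
  toFun ξ := c.field ξ fun i => ((((n : K) - 1) / 2) • c.dx ξ) * c.y i
  map_add' ξ ζ := by
    ext f
    simp only [field_apply, Derivation.add_apply, map_add, smul_add, add_mul,
      Finset.sum_add_distrib]
    ring
  map_smul' r ξ := by
    ext f
    simp only [field_apply, Derivation.smul_apply, Derivation.map_smul,
      smul_comm (((n : K) - 1) / 2) r, smul_mul_assoc, RingHom.id_apply, smul_add, Finset.smul_sum]

variable (c) in
/-- The linear vector field `∑ i, ∑ j, M_ij y_i ∂/∂y_j`. -/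
def linearField : Matrix (Fin m) (Fin m) K →ₗ[K] Derivation K O O where
  toFun M := c.field 0 fun j => ∑ i, M i j • c.y i
  map_add' M N := by
    ext f
    simp only [field_apply, Derivation.add_apply, Matrix.add_apply, add_smul, add_mul,
      Finset.sum_add_distrib]
    ring
  map_smul' r M := by
    ext f
    simp only [field_apply, Derivation.smul_apply, Matrix.smul_apply, smul_assoc, zero_mul,
      zero_add, RingHom.id_apply, Finset.smul_sum, ← smul_mul_assoc]

variable (c) in
/-- The vertical vector field `∑ i, b_i ∂/∂y_i`. -/
def verticalField : (Fin m → O) →ₗ[K] Derivation K O O where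
  toFun b := c.field 0 b
  map_add' b b' := by
    ext f
    simp only [field_apply, Derivation.add_apply, Pi.add_apply, add_mul, Finset.sum_add_distrib]
    ring
  map_smul' r b := by
    ext f
    simp only [field_apply, Derivation.smul_apply, Pi.smul_apply, zero_mul, zero_add,
      RingHom.id_apply, Finset.smul_sum, smul_mul_assoc]

lemma densityField_apply (n : ℕ) (ξ : O) : c.densityField n ξ
    = c.field ξ fun i => ((((n : K) - 1) / 2) • c.dx ξ) * c.y i := rfl

lemma linearField_apply (M : Matrix (Fin m) (Fin m) K) :
    c.linearField M = c.field 0 fun j => ∑ i, M i j • c.y i := rfl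

lemma verticalField_apply (b : Fin m → O) : c.verticalField b = c.field 0 b := rfl

lemma densityField_add_linearField_add_verticalField (n : ℕ) (ξ : O)
    (M : Matrix (Fin m) (Fin m) K) (b : Fin m → O) :
    c.densityField n ξ + c.linearField M + c.verticalField b
      = c.field ξ fun i => ((((n : K) - 1) / 2) • c.dx ξ) * c.y i + ∑ j, M j i • c.y j + b i := by
  ext f
  simp only [densityField_apply, linearField_apply, verticalField_apply, field_apply,
    Derivation.add_apply, add_mul, Finset.sum_add_distrib]
  ring

lemma lie_densityField (hc : c.IsRegular) (n : ℕ) {ξ ζ : O} (hξ : ξ ∈ c.base) (hζ : ζ ∈ c.base) :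
    ⁅c.densityField n ξ, c.densityField n ζ⁆ = c.densityField n (ξ * c.dx ζ - c.dx ξ * ζ) := by
  rw [densityField_apply, densityField_apply, densityField_apply, lie_field hc, field_of_base hξ,
    field_of_base hζ]
  congr 1
  · ring
  · funext i
    simp only [Derivation.leibniz, Derivation.map_smul, field_of_base (dx_mem_base hc hξ),
      field_of_base (dx_mem_base hc hζ), field_y hc, map_sub, smul_eq_mul]
    simp only [Algebra.smul_def]
    ring

lemma lie_densityField_linearField (hc : c.IsRegular) (n : ℕ) {ξ : O} (hξ : ξ ∈ c.base)
    (M : Matrix (Fin m) (Fin m) K) : ⁅c.densityField n ξ, c.linearField M⁆ = 0 := by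
  rw [densityField_apply, linearField_apply, lie_field hc]
  refine (congrArg₂ _ ?_ (funext fun i => ?_)).trans (map_zero c.verticalField)
  · rw [map_zero, field_of_base hξ, zero_mul, sub_zero]
  · simp only [Derivation.leibniz, Derivation.map_smul, field_of_base (dx_mem_base hc hξ),
      field_y hc, map_sum, smul_eq_mul, zero_mul, smul_zero, mul_zero, add_zero, Pi.zero_apply,
      Finset.mul_sum, mul_smul_comm, sub_self]

lemma lie_densityField_verticalField (hc : c.IsRegular) (n : ℕ) {ξ : O} (hξ : ξ ∈ c.base)
    {b : Fin m → O} (hb : ∀ i, b i ∈ c.base) :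
    ⁅c.densityField n ξ, c.verticalField b⁆
      = c.verticalField fun i => - density c.dx n ξ (b i) := by
  rw [densityField_apply, verticalField_apply, verticalField_apply, lie_field hc, field_of_base hξ]
  congr 1
  · simp
  · funext i
    simp only [Derivation.leibniz, Derivation.map_smul, field_of_base (dx_mem_base hc hξ),
      field_of_base (hb i), field_y hc, smul_eq_mul, density]
    simp

lemma lie_linearField (hc : c.IsRegular) (M N : Matrix (Fin m) (Fin m) K) :
    ⁅c.linearField M, c.linearField N⁆ = c.linearField (M * N - N * M) := by
  rw [linearField_apply, linearField_apply, linearField_apply, lie_field hc]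
  congr 1
  · simp
  · funext j
    simp only [map_sum, Derivation.map_smul, field_y hc, Finset.smul_sum, Matrix.sub_apply,
      Matrix.mul_apply, sub_smul, Finset.sum_smul, Finset.sum_sub_distrib, smul_smul]
    congr 1
    · rw [Finset.sum_comm]
      simp only [mul_comm]
    · rw [Finset.sum_comm]
      simp only [mul_comm]

lemma lie_linearField_verticalField (hc : c.IsRegular) (M : Matrix (Fin m) (Fin m) K)
    {b : Fin m → O} (hb : ∀ i, b i ∈ c.base) :
    ⁅c.linearField M, c.verticalField b⁆ = c.verticalField fun j => - ∑ i, M i j • b i := by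
  rw [linearField_apply, verticalField_apply, verticalField_apply, lie_field hc]
  congr 1
  · simp
  · funext j
    simp [field_of_base (hb j), field_y hc]

lemma lie_verticalField (hc : c.IsRegular) {b b' : Fin m → O} (hb : ∀ i, b i ∈ c.base)
    (hb' : ∀ i, b' i ∈ c.base) : ⁅c.verticalField b, c.verticalField b'⁆ = 0 := by
  rw [verticalField_apply, verticalField_apply, lie_field hc]
  refine (congrArg₂ _ ?_ (funext fun i => ?_)).trans (map_zero c.verticalField)
  · simp
  · simp [field_of_base (hb _), field_of_base (hb' _)]

/-- The quadratic form in `u`, `v` attached to an element of `sl₂`, whose standard basis `e`, `f`,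
`h` goes to `v²`, `-u²`, `2uv`. -/
def quadratic (K : Type*) {O : Type*} [Field K] [CommRing O] [Algebra K O] (u v : O) :
    sl (Fin 2) K →ₗ[K] O where
  toFun x := x.val 0 0 • (2 * u * v) + x.val 0 1 • v ^ 2 + x.val 1 0 • (- u ^ 2)
  map_add' x y := by
    change (x.val 0 0 + y.val 0 0) • _ + (x.val 0 1 + y.val 0 1) • _
      + (x.val 1 0 + y.val 1 0) • _ = _
    simp only [add_smul]
    abel
  map_smul' r x := by
    change (r * x.val 0 0) • _ + (r * x.val 0 1) • _ + (r * x.val 1 0) • _ = _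
    simp only [mul_smul, smul_add, RingHom.id_apply]

lemma mem_sl_two {a : Matrix (Fin 2) (Fin 2) K} (h : a 0 0 + a 1 1 = 0) : a ∈ sl (Fin 2) K :=
  (Matrix.trace_fin_two a).trans h

lemma quadratic_apply (u v : O) (x : sl (Fin 2) K) : quadratic K u v x
    = x.val 0 0 • (2 * u * v) + x.val 0 1 • v ^ 2 + x.val 1 0 • (- u ^ 2) := rfl

lemma sl_two_apply_one_one (x : sl (Fin 2) K) : x.val 1 1 = - x.val 0 0 := by
  have h : Matrix.trace x.val = 0 := x.2
  rw [Matrix.trace_fin_two] at h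
  exact (neg_eq_of_add_eq_zero_right h).symm

lemma quadratic_lie (d : Derivation K O O) {u v : O} (hW : u * d v - d u * v = 1)
    (x y : sl (Fin 2) K) :
    quadratic K u v x * d (quadratic K u v y) - d (quadratic K u v x) * quadratic K u v y
      = quadratic K u v ⁅x, y⁆ := by
  have h2 : d (2 * u * v) = 2 * (u * d v + d u * v) := by
    rw [mul_assoc, show (2 : O) * (u * v) = u * v + u * v by ring, map_add, Derivation.leibniz,
      smul_eq_mul, smul_eq_mul]
    ring
  have h3 (w : O) : d (w ^ 2) = 2 * (w * d w) := by
    simp [Derivation.leibniz_pow]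
  simp only [quadratic_apply, sl_bracket, Matrix.sub_apply, Matrix.mul_apply, Fin.sum_univ_two,
    sl_two_apply_one_one, map_add, map_neg, Derivation.map_smul, h2, h3]
  simp only [Algebra.smul_def, map_sub, map_add, map_mul, map_neg]
  generalize algebraMap K O (x.val 0 0) = a
  generalize algebraMap K O (x.val 0 1) = b
  generalize algebraMap K O (x.val 1 0) = e
  generalize algebraMap K O (y.val 0 0) = a'
  generalize algebraMap K O (y.val 0 1) = b'
  generalize algebraMap K O (y.val 1 0) = e'
  linear_combination (2 * (a * b' - b * a') * v ^ 2 + 2 * (a * e' - e * a') * u ^ 2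
    + 2 * (b * e' - e * b') * u * v) * hW

lemma range_quadratic [CharZero K] (u v : O) :
    LinearMap.range (quadratic K u v) = symSpan K 3 u v := by
  apply le_antisymm
  · rintro _ ⟨x, rfl⟩
    have h (w : O) (hw : w ∈ symSpan K 3 u v) (r : K) := Submodule.smul_mem (symSpan K 3 u v) r hw
    rw [quadratic_apply]
    refine add_mem (add_mem (h _ ?_ _) (h _ ?_ _)) (h _ (neg_mem ?_) _)
    · have := h _ (pow_mul_pow_mem_symSpan (p := 1) (q := 1) (n := 3) rfl u v) 2
      rwa [Algebra.smul_def, map_ofNat, pow_one, pow_one, ← mul_assoc] at this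
    · simpa using pow_mul_pow_mem_symSpan (K := K) (p := 0) (q := 2) (n := 3) rfl u v
    · simpa using pow_mul_pow_mem_symSpan (K := K) (p := 2) (q := 0) (n := 3) rfl u v
  · rw [symSpan, Submodule.span_le]
    rintro _ ⟨k, rfl⟩
    fin_cases k
    · exact ⟨⟨!![0, 0; -1, 0], mem_sl_two (by simp)⟩, by
        simp [quadratic_apply]⟩
    · refine ⟨⟨!![1 / 2, 0; 0, - (1 / 2)], mem_sl_two (by simp)⟩, ?_⟩
      have h2 : algebraMap K O (1 / 2) * 2 = 1 := by
        rw [← map_ofNat (algebraMap K O) 2, ← map_mul]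
        norm_num
      have : (1 / 2 : K) • (2 * u * v) = u * v := by
        rw [Algebra.smul_def]
        linear_combination (u * v) * h2
      simpa [quadratic_apply] using this
    · exact ⟨⟨!![0, 1; 0, 0], mem_sl_two (by simp)⟩, by
        simp [quadratic_apply]⟩

/-- The `m`-tuple of combinations of the `u^(n-1-k) v^k` with given coefficients. -/
def combination (n m : ℕ) (u v : O) : (Fin n → Fin m → K) →ₗ[K] (Fin m → O) where
  toFun w j := ∑ k, w k j • (u ^ (n - 1 - (k : ℕ)) * v ^ (k : ℕ))
  map_add' w w' := by
    funext j
    simp only [Pi.add_apply, add_smul, Finset.sum_add_distrib]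
  map_smul' r w := by
    funext j
    simp only [Pi.smul_apply, smul_assoc, Finset.smul_sum, RingHom.id_apply]

lemma combination_apply (n : ℕ) (u v : O) (w : Fin n → Fin m → K) (j : Fin m) :
    combination n m u v w j = ∑ k, w k j • (u ^ (n - 1 - (k : ℕ)) * v ^ (k : ℕ)) := rfl

lemma combination_mem (n : ℕ) (u v : O) (w : Fin n → Fin m → K) (j : Fin m) :
    combination n m u v w j ∈ symSpan K n u v := by
  rw [combination_apply, symSpan]
  exact sum_mem fun k _ => Submodule.smul_mem _ _ (Submodule.subset_span ⟨k, rfl⟩)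

lemma exists_combination_eq {n : ℕ} {u v : O} {b : Fin m → O} (hb : ∀ j, b j ∈ symSpan K n u v) :
    ∃ w : Fin n → Fin m → K, combination n m u v w = b := by
  choose w hw using fun j => (Submodule.mem_span_range_iff_exists_fun K).1 (hb j)
  exact ⟨fun k j => w j k, funext hw⟩

lemma densityField_eq_Fp [CharZero K] (n : ℕ) (v : O) :
    c.densityField n (v ^ 2) = c.Fp n v := by
  have h2 : algebraMap K O (1 / 2) * 2 = 1 := by
    rw [← map_ofNat (algebraMap K O) 2, ← map_mul]
    norm_num
  rw [densityField_apply, Fp]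
  congr 1
  funext i
  rw [Derivation.leibniz_pow, div_eq_mul_one_div, Algebra.smul_def, map_mul, map_sub, map_natCast,
    map_one]
  simp only [Nat.add_one_sub_one, pow_one, nsmul_eq_mul, smul_eq_mul, Nat.cast_ofNat]
  linear_combination (((n : O) - 1) * (v * c.dx v) * c.y i) * h2

lemma densityField_eq_Fm [CharZero K] (n : ℕ) (u : O) :
    c.densityField n (- u ^ 2) = c.Fm n u := by
  rw [map_neg, densityField_eq_Fp]
  ext f
  simp [Fp, Fm, field_apply]
  ring

lemma densityField_eq_Fz [CharZero K] (n : ℕ) (u v : O) :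
    c.densityField n (2 * u * v) = c.Fz n u v := by
  have h2 : algebraMap K O (1 / 2) * 2 = 1 := by
    rw [← map_ofNat (algebraMap K O) 2, ← map_mul]
    norm_num
  rw [densityField_apply, Fz]
  congr 1
  funext i
  have h3 : c.dx (2 * u * v) = 2 * (u * c.dx v + c.dx u * v) := by
    rw [mul_assoc, show (2 : O) * (u * v) = u * v + u * v by ring, map_add, Derivation.leibniz,
      smul_eq_mul, smul_eq_mul]
    ring
  rw [h3, div_eq_mul_one_div, Algebra.smul_def, map_mul, map_sub, map_natCast, map_one]
  linear_combination (((n : O) - 1) * (u * c.dx v + c.dx u * v) * c.y i) * h2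

lemma densityField_quadratic [CharZero K] (n : ℕ) (u v : O) (x : sl (Fin 2) K) :
    c.densityField n (quadratic K u v x)
      = x.val 0 0 • c.Fz n u v + x.val 0 1 • c.Fp n v + x.val 1 0 • c.Fm n u := by
  rw [quadratic_apply, map_add, map_add, map_smul, map_smul, map_smul, densityField_eq_Fz,
    densityField_eq_Fp, densityField_eq_Fm]

lemma range_densityField_quadratic [CharZero K] (n : ℕ) (u v : O) :
    LinearMap.range (c.densityField n ∘ₗ quadratic K u v)
      = Submodule.span K {c.Fp n v, c.Fm n u, c.Fz n u v} := by
  apply le_antisymm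
  · rintro _ ⟨x, rfl⟩
    rw [LinearMap.comp_apply, densityField_quadratic]
    refine add_mem (add_mem ?_ ?_) ?_ <;>
      exact Submodule.smul_mem _ _ (Submodule.subset_span (by simp))
  · rw [Submodule.span_le]
    rintro _ (rfl | rfl | rfl)
    · exact ⟨⟨!![0, 1; 0, 0], mem_sl_two (by simp)⟩, by
        rw [LinearMap.comp_apply, densityField_quadratic]; simp⟩
    · exact ⟨⟨!![0, 0; 1, 0], mem_sl_two (by simp)⟩, by
        rw [LinearMap.comp_apply, densityField_quadratic]; simp⟩
    · exact ⟨⟨!![1, 0; 0, -1], mem_sl_two (by simp)⟩, by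
        rw [LinearMap.comp_apply, densityField_quadratic]; simp⟩

lemma linearField_eq_sum (M : Matrix (Fin m) (Fin m) K) :
    c.linearField M = ∑ i, ∑ j, M i j • c.H i j := by
  ext f
  simp only [linearField_apply, field_apply, H, sum_derivation_apply, Derivation.smul_apply,
    Finset.sum_mul, zero_mul, zero_add, smul_eq_mul, smul_mul_assoc]
  exact Finset.sum_comm

lemma linearField_single (i j : Fin m) : c.linearField (Matrix.single i j (1 : K)) = c.H i j := by
  rw [linearField_eq_sum, Finset.sum_eq_single_of_mem i (Finset.mem_univ i),
    Finset.sum_eq_single_of_mem j (Finset.mem_univ j)]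
  · simp
  · intro j' _ hj
    simp [Matrix.single, hj.symm]
  · intro i' _ hi
    simp [Matrix.single, hi.symm]

lemma linearField_one : c.linearField (1 : Matrix (Fin m) (Fin m) K) = ∑ i, c.H i i := by
  rw [linearField_eq_sum]
  simp [Matrix.one_apply]

lemma range_linearField :
    LinearMap.range (c.linearField) = Submodule.span K {X | ∃ i j, X = c.H i j} := by
  apply le_antisymm
  · rintro _ ⟨M, rfl⟩
    rw [linearField_eq_sum]
    exact sum_mem fun i _ => sum_mem fun j _ =>
      Submodule.smul_mem _ _ (Submodule.subset_span ⟨i, j, rfl⟩)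
  · rw [Submodule.span_le]
    rintro _ ⟨i, j, rfl⟩
    exact ⟨_, linearField_single i j⟩

lemma map_sl_linearField (hm : 0 < m) : (sl (Fin m) K).toSubmodule.map c.linearField
    = Submodule.span K ({X | ∃ i j, i ≠ j ∧ X = c.H i j} ∪
        {X | ∃ i j : Fin m, (j : ℕ) = i + 1 ∧ X = c.H i i - c.H j j}) := by
  apply le_antisymm
  · rintro _ ⟨M, hM, rfl⟩
    set P := Submodule.span K ({X | ∃ i j, i ≠ j ∧ X = c.H i j} ∪
        {X | ∃ i j : Fin m, (j : ℕ) = i + 1 ∧ X = c.H i i - c.H j j}) with hP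
    have hM' : ∑ i, M i i = 0 := hM
    -- `H_ll - H_00` is a telescoping sum.
    have hdiag (l : ℕ) (hl : l < m) : c.H ⟨l, hl⟩ ⟨l, hl⟩ - c.H ⟨0, hm⟩ ⟨0, hm⟩ ∈ P := by
      induction l with
      | zero => simp
      | succ l ih =>
        have h1 : c.H ⟨l, by omega⟩ ⟨l, by omega⟩ - c.H ⟨l + 1, hl⟩ ⟨l + 1, hl⟩ ∈ P :=
          Submodule.subset_span (Or.inr ⟨⟨l, by omega⟩, ⟨l + 1, hl⟩, rfl, rfl⟩)
        have h2 := sub_mem (ih (by omega)) h1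
        rwa [sub_sub_sub_cancel_left] at h2
    have hsum : c.linearField M
        = ∑ i, ((∑ j ∈ Finset.univ.erase i, M i j • c.H i j)
          + M i i • (c.H i i - c.H ⟨0, hm⟩ ⟨0, hm⟩)) := by
      simp only [smul_sub, Finset.sum_add_distrib, Finset.sum_sub_distrib, ← Finset.sum_smul, hM',
        zero_smul, sub_zero]
      rw [← Finset.sum_add_distrib, linearField_eq_sum]
      exact Finset.sum_congr rfl fun i _ => (Finset.sum_erase_add _ _ (Finset.mem_univ i)).symm
    rw [hsum]
    refine sum_mem fun i _ => add_mem (sum_mem fun j hj => Submodule.smul_mem _ _ ?_)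
      (Submodule.smul_mem _ _ (hdiag i i.2))
    exact Submodule.subset_span (Or.inl ⟨i, j, (Finset.ne_of_mem_erase hj).symm, rfl⟩)
  · rw [Submodule.span_le]
    rintro _ (⟨i, j, hij, rfl⟩ | ⟨i, j, hij, rfl⟩)
    · exact ⟨Matrix.single i j 1, Matrix.trace_single_eq_of_ne i j 1 hij, linearField_single i j⟩
    · refine ⟨Matrix.single i i 1 - Matrix.single j j 1, ?_, by
        rw [map_sub, linearField_single, linearField_single]⟩
      refine LinearMap.mem_ker.2 ?_
      change Matrix.trace (Matrix.single i i (1 : K) - Matrix.single j j 1) = 0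
      rw [Matrix.trace_sub, Matrix.trace_single_eq_same, Matrix.trace_single_eq_same, sub_self]

lemma verticalField_combination (n : ℕ) (u v : O) (w : Fin n → Fin m → K) :
    c.verticalField (combination n m u v w) = ∑ k, ∑ j, w k j • c.S n u v k j := by
  ext f
  simp only [verticalField_apply, field_apply, S, combination_apply, sum_derivation_apply,
    Derivation.smul_apply, Finset.sum_mul, zero_mul, zero_add, smul_eq_mul, smul_mul_assoc]
  exact Finset.sum_comm

lemma range_verticalField_combination (n : ℕ) (u v : O) :
    LinearMap.range (c.verticalField ∘ₗ combination n m u v)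
      = Submodule.span K {X | ∃ k j, X = c.S n u v k j} := by
  apply le_antisymm
  · rintro _ ⟨w, rfl⟩
    rw [LinearMap.comp_apply, verticalField_combination]
    exact sum_mem fun i _ => sum_mem fun j _ =>
      Submodule.smul_mem _ _ (Submodule.subset_span ⟨i, j, rfl⟩)
  · rw [Submodule.span_le]
    rintro _ ⟨k, j, rfl⟩
    refine ⟨Pi.single k (Pi.single j 1), ?_⟩
    rw [LinearMap.comp_apply, verticalField_combination,
      Finset.sum_eq_single_of_mem k (Finset.mem_univ k) (fun k' _ hk => by simp [hk]),
      Finset.sum_eq_single_of_mem j (Finset.mem_univ j) (fun j' _ hj => by simp [hj])]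
    simp

namespace IsCanonical

variable {n : ℕ} {A : ℕ → O} {u v : O}

lemma quadratic_mem_base [CharZero K] (h : c.IsCanonical n A u v) (x : sl (Fin 2) K) :
    quadratic K u v x ∈ c.base :=
  h.symSpan_le_base 3 (range_quadratic (K := K) u v ▸ LinearMap.mem_range_self _ x)

lemma combination_mem_base (h : c.IsCanonical n A u v) (w : Fin n → Fin m → K) (j : Fin m) :
    combination n m u v w j ∈ c.base :=
  h.symSpan_le_base n (combination_mem n u v w j)

/-- The coefficient `ξ` is recovered from the action of the field on `u` and `v` as
`u (ξ v') - v (ξ u')`. -/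
lemma field_eq_zero (h : c.IsCanonical n A u v) {ξ : O} {η : Fin m → O} (h0 : c.field ξ η = 0) :
    ξ = 0 ∧ η = 0 := by
  have h1 : ξ * c.dx u = 0 := by rw [← field_of_base h.u_mem ξ η, h0, Derivation.zero_apply]
  have h2 : ξ * c.dx v = 0 := by rw [← field_of_base h.v_mem ξ η, h0, Derivation.zero_apply]
  refine ⟨by linear_combination (-ξ) * h.wronskian + u * h2 - v * h1, funext fun i => ?_⟩
  rw [← field_y h.regular ξ η i, h0, Derivation.zero_apply, Pi.zero_apply]

lemma quadratic_injective [CharZero K] (h : c.IsCanonical n A u v) {x : sl (Fin 2) K}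
    (hx : quadratic K u v x = 0) : x = 0 := by
  have := h.nontrivial
  have hinj := FaithfulSMul.algebraMap_injective K O
  have h1 := eq_zero_of_sum_eq_zero h.wronskian 2
    ![algebraMap K O (- x.val 1 0), algebraMap K O (2 * x.val 0 0), algebraMap K O (x.val 0 1)]
    (fun k => by fin_cases k <;> exact Derivation.map_algebraMap _ _) (by
      rw [← hx, quadratic_apply]
      refine (Fin.sum_univ_three _).trans ?_
      simp [Algebra.smul_def, map_ofNat (algebraMap K O) 2]
      ring)
  have e0 : x.val 1 0 = 0 := by
    have := congrFun h1 0
    simpa [map_eq_zero_iff _ hinj] using this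
  have e1 : x.val 0 0 = 0 := by
    have : algebraMap K O (2 * x.val 0 0) = 0 := congrFun h1 1
    rw [map_eq_zero_iff _ hinj] at this
    simpa using this
  have e2 : x.val 0 1 = 0 := by
    have : algebraMap K O (x.val 0 1) = 0 := congrFun h1 2
    rwa [map_eq_zero_iff _ hinj] at this
  apply Subtype.ext
  ext i j
  fin_cases i <;> fin_cases j
  · exact e1
  · exact e2
  · exact e0
  · exact (sl_two_apply_one_one x).trans (by rw [e1, neg_zero]; rfl)

lemma combination_injective [CharZero K] (hn : n ≠ 0) (h : c.IsCanonical n A u v)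
    {w : Fin n → Fin m → K} (hw : combination n m u v w = 0) : w = 0 := by
  have := h.nontrivial
  have hinj := FaithfulSMul.algebraMap_injective K O
  obtain ⟨N, rfl⟩ := Nat.exists_eq_succ_of_ne_zero hn
  funext k j
  have h1 := eq_zero_of_sum_eq_zero h.wronskian N (fun k => algebraMap K O (w k j))
    (fun k => Derivation.map_algebraMap _ _) (by
      have := congrFun hw j
      rw [combination_apply] at this
      refine Eq.trans (Finset.sum_congr rfl fun k _ => ?_) this
      rw [Algebra.smul_def, mul_comm]
      rfl)
  exact (map_eq_zero_iff _ hinj).1 (congrFun h1 k)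

/-- The vector fields attached to `sl₂`, to the matrices and to the solutions satisfy the bracket
relations of a semidirect product. -/
lemma bracketRelations [CharZero K] (hn : n ≠ 0) (h : c.IsCanonical n A u v) :
    BracketRelations (c.densityField n ∘ₗ quadratic K u v) c.linearField
      (c.verticalField ∘ₗ combination n m u v) where
  lie_ρ_ρ x y := by
    simp only [LinearMap.comp_apply]
    rw [lie_densityField h.regular n (h.quadratic_mem_base x) (h.quadratic_mem_base y),
      quadratic_lie _ h.wronskian]
  lie_σ_σ := lie_linearField h.regular
  lie_ρ_σ x a := lie_densityField_linearField h.regular n (h.quadratic_mem_base x) a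
  lie_ρ_τ x w := by
    obtain ⟨w', hw'⟩ := exists_combination_eq (K := K) (n := n) (u := u) (v := v)
      (b := fun i => - density c.dx n (quadratic K u v x) (combination n m u v w i)) fun i =>
      neg_mem (density_mem_symSpan c.dx h.wronskian
        (range_quadratic (K := K) u v ▸ LinearMap.mem_range_self _ x) (combination_mem n u v w i))
    refine ⟨w', ?_⟩
    simp only [LinearMap.comp_apply]
    rw [hw', lie_densityField_verticalField h.regular n (h.quadratic_mem_base x)
      (h.combination_mem_base w)]
  lie_σ_τ a w := by
    obtain ⟨w', hw'⟩ := exists_combination_eq (K := K) (n := n) (u := u) (v := v)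
      (b := fun j => - ∑ i, a i j • combination n m u v w i) fun j =>
      neg_mem (sum_mem fun i _ => Submodule.smul_mem _ _ (combination_mem n u v w i))
    refine ⟨w', ?_⟩
    simp only [LinearMap.comp_apply]
    rw [hw', lie_linearField_verticalField h.regular a (h.combination_mem_base w)]
  lie_τ_τ w w' := lie_verticalField h.regular (h.combination_mem_base w) (h.combination_mem_base w')
  injective x a w h0 := by
    have := h.nontrivial
    have hinj := FaithfulSMul.algebraMap_injective K O
    simp only [LinearMap.comp_apply] at h0
    rw [densityField_add_linearField_add_verticalField] at h0
    obtain ⟨h1, h2⟩ := h.field_eq_zero h0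
    have h3 (j : Fin m) : ∑ i, a i j • c.y i + combination n m u v w j = 0 := by
      simpa [h1] using congrFun h2 j
    have h4 : a = 0 := by
      ext l j
      have h5 := congrArg (c.dy l) (h3 j)
      rw [map_add, h.combination_mem_base w j l, map_sum] at h5
      simp only [Derivation.map_smul, h.regular.dy_y, smul_ite, smul_zero, Finset.sum_ite_eq,
        Finset.mem_univ, if_true, add_zero, map_zero] at h5
      rw [Algebra.smul_def, mul_one] at h5
      exact (map_eq_zero_iff _ hinj).1 h5
    refine ⟨h.quadratic_injective h1, h4, h.combination_injective hn (funext fun j => ?_)⟩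
    simpa [h4] using h3 j

/-- The point symmetries are the sums of the three kinds of vector fields. -/
lemma isPointSymmetry_iff [CharZero K] (hm : 0 < m) (hn : 3 ≤ n) (h : c.IsCanonical n A u v)
    (X : Derivation K O O) : c.IsPointSymmetry n A X ↔
      X ∈ LinearMap.range (BracketRelations.total (c.densityField n ∘ₗ quadratic K u v)
        c.linearField (c.verticalField ∘ₗ combination n m u v)) := by
  obtain ⟨k, rfl⟩ : ∃ k, n = k + 2 := ⟨n - 2, by omega⟩
  constructor
  · rintro ⟨ξ, η, rfl, hinv⟩
    obtain ⟨hξ, M, b, hb, rfl⟩ := (h.invariance_iff hm (by omega) ξ η).1 hinv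
    rw [← range_quadratic] at hξ
    obtain ⟨x, rfl⟩ := hξ
    obtain ⟨w, rfl⟩ := exists_combination_eq hb
    refine ⟨(x, M, w), ?_⟩
    rw [BracketRelations.total_apply]
    exact densityField_add_linearField_add_verticalField _ _ _ _
  · rintro ⟨⟨x, M, w⟩, rfl⟩
    rw [BracketRelations.total_apply]
    refine ⟨_, _, densityField_add_linearField_add_verticalField _ _ _ _, ?_⟩
    exact (h.invariance_iff hm (by omega) _ _).2
      ⟨range_quadratic (K := K) u v ▸ LinearMap.mem_range_self _ x, M, _,
        combination_mem (k + 2) u v w, rfl⟩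

/-- The structure of the symmetry algebra follows from the bracket relations and the description of
the point symmetries. -/
theorem symmetryAlgebraStructure [CharZero K] (hm : 0 < m) (hn : 3 ≤ n)
    (h : c.IsCanonical n A u v) : c.SymmetryAlgebraStructure n A u v := by
  obtain ⟨g, hg, hdim, gF, gH, sH, gHS, levi, gS, KH₀, h1, h2, h3, h4, h5, hrest⟩ :=
    (h.bracketRelations (by omega)).exists_levi_decomposition hm
  refine ⟨g, fun X => ?_, hdim, gF, gH, sH, gHS, levi, gS, KH₀, ?_, ?_, ?_, ?_, ?_, hrest⟩
  · rw [h.isPointSymmetry_iff hm hn, ← hg]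
    rfl
  · exact h1.trans (range_densityField_quadratic n u v)
  · exact h2.trans range_linearField
  · exact h3.trans (range_verticalField_combination n u v)
  · exact h4.trans (map_sl_linearField hm)
  · rw [h5, linearField_one]

end IsCanonical

end Coordinates

end SymmetryAlgebra

/-! ### Formal power series -/

section Affine

variable {K R : Type*} [Field K] [CommRing R] [Algebra K R] (d : Derivation K R R)

lemma iterate_succ_mul_of_affine {a : R} (ha : d (d a) = 0) (f : R) (j : ℕ) :
    d^[j + 1] (a * f) = a * d^[j + 1] f + (j + 1) * (d a * d^[j] f) := by
  induction j with
  | zero =>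
    simp
    ring
  | succ j ih =>
    have hj : d ((j : R) + 1) = 0 := by simp
    rw [Function.iterate_succ_apply', ih, map_add, Derivation.leibniz, Derivation.leibniz, hj,
      Derivation.leibniz, ha, ← Function.iterate_succ_apply' d, ← Function.iterate_succ_apply' d]
    push_cast
    simp only [smul_eq_mul]
    ring

/-- A product of `p + q` solutions of `w'' = 0` solves `w^(p+q+1) = 0`. -/
lemma iterate_pow_mul_pow_of_affine {a b : R} (ha : d (d a) = 0) (hb : d (d b) = 0) (p q : ℕ) :
    d^[p + q + 1] (a ^ p * b ^ q) = 0 := by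
  have step {a : R} (ha : d (d a) = 0) {f : R} {j : ℕ} (hf : d^[j] f = 0) :
      d^[j + 1] (a * f) = 0 := by
    rw [iterate_succ_mul_of_affine d ha, Function.iterate_succ_apply', hf]
    simp
  induction p with
  | zero =>
    induction q with
    | zero => simp
    | succ q ih =>
      have := step hb ih
      rwa [mul_left_comm, ← pow_succ'] at this
  | succ p ih =>
    have := step ha ih
    rw [← mul_assoc, ← pow_succ'] at this
    convert this using 2
    omega

end Affine

section Formal

open PowerSeries

variable {K : Type*} [Field K] {m : ℕ}

lemma formalCoordinates_isRegular [CharZero K] : (formalCoordinates K m).IsRegular where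
  dx_y i := MvPowerSeries.pderiv_X_of_ne (by simp)
  dy_y i j := by
    by_cases h : i = j
    · rw [if_pos h, h]
      exact MvPowerSeries.pderiv_X_self
    · rw [if_neg h]
      exact MvPowerSeries.pderiv_X_of_ne (by simpa using Ne.symm h)
  dx_dy i f := by
    change MvPowerSeries.pderiv K none (MvPowerSeries.pderiv K (some i) f)
      = MvPowerSeries.pderiv K (some i) (MvPowerSeries.pderiv K none f)
    ext e
    simp only [MvPowerSeries.coeff_pderiv]
    simp [add_right_comm e, mul_right_comm]
  dy_dy i j f := by
    change MvPowerSeries.pderiv K (some i) (MvPowerSeries.pderiv K (some j) f)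
      = MvPowerSeries.pderiv K (some j) (MvPowerSeries.pderiv K (some i) f)
    by_cases h : i = j
    · rw [h]
    ext e
    simp only [MvPowerSeries.coeff_pderiv]
    have h1 : (Finsupp.single (some i) 1 : Option (Fin m) →₀ ℕ) (some j) = 0 := by simp [h]
    have h2 : (Finsupp.single (some j) 1 : Option (Fin m) →₀ ℕ) (some i) = 0 := by
      simp [Ne.symm h]
    rw [add_right_comm e, Finsupp.add_apply, Finsupp.add_apply, h1, h2]
    simp only [add_zero, mul_right_comm]
  exists_const f hx hy := by
    refine ⟨MvPowerSeries.constantCoeff f, MvPowerSeries.pderiv.ext (fun i => ?_) ?_⟩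
    · rw [Derivation.map_algebraMap]
      cases i with
      | none => exact hx
      | some i => exact hy i
    · exact (MvPowerSeries.constantCoeff_C _).symm

/-- The embedding of the power series in `x` into those in `x, y_1, …, y_m`, as a ring
homomorphism. -/
def formalBaseHom (K : Type*) [Field K] (m : ℕ) : K⟦X⟧ →+* MvPowerSeries (Option (Fin m)) K :=
  (substAlgHom (R := K) (HasSubst.X (none : Option (Fin m)))).toRingHom

lemma formalBaseHom_apply (a : K⟦X⟧) : formalBaseHom K m a = ofFormalBase m a :=
  congrFun (coe_substAlgHom (HasSubst.X _)) a

lemma dx_formalBaseHom (a : K⟦X⟧) :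
    (formalCoordinates K m).dx (formalBaseHom K m a) = formalBaseHom K m (derivative K a) := by
  change MvPowerSeries.pderiv K none _ = _
  rw [formalBaseHom_apply, formalBaseHom_apply, ofFormalBase, ofFormalBase]
  ext e
  rw [MvPowerSeries.coeff_pderiv, coeff_subst_single, coeff_subst_single, coeff_derivative]
  have h : e + Finsupp.single none 1
        = Finsupp.single none ((e + Finsupp.single none 1 : Option (Fin m) →₀ ℕ) none)
      ↔ e = Finsupp.single none (e none) := by
    rw [Finsupp.add_apply, Finsupp.single_eq_same, Finsupp.single_add]
    exact add_left_inj _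
  rw [if_congr h rfl rfl, Finsupp.add_apply, Finsupp.single_eq_same]
  split_ifs
  · rfl
  · rw [zero_mul]

lemma dy_formalBaseHom (a : K⟦X⟧) (i : Fin m) :
    (formalCoordinates K m).dy i (formalBaseHom K m a) = 0 := by
  change MvPowerSeries.pderiv K (some i) _ = _
  rw [formalBaseHom_apply, ofFormalBase]
  ext e
  rw [MvPowerSeries.coeff_pderiv, coeff_subst_single, if_neg, zero_mul, map_zero]
  intro h
  have := DFunLike.congr_fun h (some i)
  simp at this

lemma iterate_dx_formalBaseHom (a : K⟦X⟧) (k : ℕ) : (formalCoordinates K m).dx^[k]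
    (formalBaseHom K m a) = formalBaseHom K m ((derivative K)^[k] a) := by
  induction k with
  | zero => rfl
  | succ k ih => rw [Function.iterate_succ_apply', ih, dx_formalBaseHom,
      Function.iterate_succ_apply']

/-- In the canonical class the products of solutions of the source equation are solutions: both
correspond to polynomials in the other variable. -/
lemma formalLinOp_pow_mul_pow {n : ℕ} {A : ℕ → K⟦X⟧} {q u v : K⟦X⟧}
    (h : InFormalCanonicalClass n A q) (hu : (derivative K)^[2] u + q * u = 0)
    (hv : (derivative K)^[2] v + q * v = 0) (k : Fin n) :
    formalLinOp n A (u ^ (n - 1 - (k : ℕ)) * v ^ (k : ℕ)) = 0 := by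
  obtain ⟨f, r, hf, hr, -, hA, hq⟩ := h
  have hf' : HasSubst f := HasSubst.of_constantCoeff_zero' hf
  have hrr : r * r⁻¹ = 1 := PowerSeries.mul_inv_cancel r hr
  have transform (w : K⟦X⟧) : w.subst f = r * (w.subst f * r⁻¹) := by
    rw [mul_left_comm, hrr, mul_one]
  have affine {w : K⟦X⟧} (hw : (derivative K)^[2] w + q * w = 0) :
      derivative K (derivative K (w.subst f * r⁻¹)) = 0 := by
    refine (hq w _ (by simpa using transform w)).2 ?_
    simpa [formalLinOp] using hw
  refine (hA _ ((u.subst f * r⁻¹) ^ (n - 1 - (k : ℕ)) * (v.subst f * r⁻¹) ^ (k : ℕ)) ?_).1 ?_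
  · rw [subst_mul hf', subst_pow hf', subst_pow hf']
    nth_rewrite 1 [transform u, transform v]
    have hk : n - 1 = (n - 1 - (k : ℕ)) + k := by omega
    have split (a b : K⟦X⟧) (p q : ℕ) :
        (r * a) ^ p * (r * b) ^ q = r ^ (p + q) * (a ^ p * b ^ q) := by ring
    exact (split _ _ _ _).trans (by rw [← hk])
  · have := iterate_pow_mul_pow_of_affine (derivative K) (affine hu) (affine hv) (n - 1 - (k : ℕ)) k
    rwa [show n - 1 - (k : ℕ) + k + 1 = n by omega] at this

lemma formalCoordinates_isCanonical [CharZero K] {n : ℕ} {A : ℕ → K⟦X⟧} {q u v : K⟦X⟧}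
    (h : InFormalCanonicalClass n A q) (hu : (derivative K)^[2] u + q * u = 0)
    (hv : (derivative K)^[2] v + q * v = 0)
    (hW : u * derivative K v - derivative K u * v = 1) :
    (formalCoordinates K m).IsCanonical n (fun j => ofFormalBase m (A j)) (ofFormalBase m u)
      (ofFormalBase m v) := by
  simp only [← formalBaseHom_apply]
  exact {
    regular := formalCoordinates_isRegular
    nontrivial := inferInstance
    coeff_mem := fun j i => dy_formalBaseHom _ _
    u_mem := fun i => dy_formalBaseHom _ _
    v_mem := fun i => dy_formalBaseHom _ _
    wronskian := by
      rw [dx_formalBaseHom, dx_formalBaseHom, ← map_mul, ← map_mul, ← map_sub, hW, map_one]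
    solution := fun k => by
      rw [← map_pow, ← map_pow, ← map_mul, derivOp]
      simp only [iterate_dx_formalBaseHom, ← map_mul, ← map_sum, ← map_add]
      exact (congrArg _ (formalLinOp_pow_mul_pow h hu hv k)).trans (map_zero _) }

end Formal

/-! ### Smooth functions -/

section Smooth

variable {K : Type*} [RCLike K] {m : ℕ} {M : TopologicalSpace.Opens (K × (Fin m → K))}

lemma dirDeriv_apply (a : smoothFunctions M) (F : K × (Fin m → K) → K)
    (h : ∀ p : M, (a : M → K) p = F p) (w : K × (Fin m → K)) (p : M) :
    (dirDeriv M w a : M → K) p = fderiv K F p w :=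
  congrArg (fun L : K × (Fin m → K) →L[K] K => L w) (extend_eventuallyEq _ F h p).fderiv_eq

lemma dirDeriv_comm (w w' : K × (Fin m → K)) (a : smoothFunctions M) :
    dirDeriv M w (dirDeriv M w' a) = dirDeriv M w' (dirDeriv M w a) := by
  ext p
  let F := Function.extend Subtype.val (a : M → K) 0
  have hF : ContDiffAt K ∞ F p := (a.2 : ContDiffOn K ∞ _ _).contDiffAt (M.isOpen.mem_nhds p.2)
  have hdiff : DifferentiableAt K (fderiv K F) p :=
    (hF.fderiv_right (m := ∞) (by simp)).differentiableAt (by simp)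
  have second (w w' : K × (Fin m → K)) :
      (dirDeriv M w (dirDeriv M w' a) : M → K) p = fderiv K (fderiv K F) p w w' := by
    rw [dirDeriv_apply _ (fun z => fderiv K F z w') (fun z => rfl),
      fderiv_clm_apply hdiff (differentiableAt_const _)]
    simp
  rw [second, second]
  exact hF.isSymmSndFDerivAt (by simpa using WithTop.coe_le_coe.2 (le_top : (2 : ℕ∞) ≤ ⊤)) w w'

lemma smoothCoordinates_isRegular (hM : IsConnected (M : Set (K × (Fin m → K)))) :
    (smoothCoordinates M).IsRegular where
  dx_y i := by
    ext p
    refine (dirDeriv_apply _ (fun p => p.2 i) (fun p => rfl) _ p).trans ?_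
    have : (fun p : K × (Fin m → K) => p.2 i)
      = (ContinuousLinearMap.proj i).comp (ContinuousLinearMap.snd K K (Fin m → K)) := rfl
    rw [this, ContinuousLinearMap.fderiv]
    simp
  dy_y i j := by
    ext p
    refine (dirDeriv_apply _ (fun p => p.2 j) (fun p => rfl) _ p).trans ?_
    have : (fun p : K × (Fin m → K) => p.2 j)
      = (ContinuousLinearMap.proj j).comp (ContinuousLinearMap.snd K K (Fin m → K)) := rfl
    rw [this, ContinuousLinearMap.fderiv]
    by_cases h : i = j
    · subst h
      simp
    · simp [h, Ne.symm h]
  dx_dy i f := dirDeriv_comm _ _ f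
  dy_dy i j f := dirDeriv_comm _ _ f
  exists_const f hx hy := by
    let F := Function.extend Subtype.val (f : M → K) 0
    have hzero : Set.EqOn (fderiv K F) 0 M := fun p hp => by
      have h1 : fderiv K F p (1, 0) = 0 :=
        congrFun (congrArg (Subtype.val : smoothFunctions M → M → K) hx) ⟨p, hp⟩
      have h2 (i : Fin m) : fderiv K F p (0, Pi.single i 1) = 0 :=
        congrFun (congrArg (Subtype.val : smoothFunctions M → M → K) (hy i)) ⟨p, hp⟩
      have h3 : (fderiv K F p).toLinearMap ∘ₗ LinearMap.inr K K (Fin m → K) = 0 :=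
        LinearMap.pi_ext' fun i => LinearMap.ext_ring (h2 i)
      ext x
      · simpa using h1
      · exact LinearMap.congr_fun h3 x
    have hd : DifferentiableOn K F M := (f.2 : ContDiffOn K ∞ F M).differentiableOn (by simp)
    obtain ⟨k, hk⟩ := M.isOpen.exists_is_const_of_fderiv_eq_zero hM.isPreconnected hd hzero
    refine ⟨k, ?_⟩
    ext p
    exact (extend_eq _ p).symm.trans (hk p p.2)

/-- The iterates of `∂/∂x` on a function of `x` are its iterated derivatives. -/
lemma iterate_dx_apply {I : Set K} (hI : IsOpen I) (hM : ∀ p ∈ M, p.1 ∈ I) (k : ℕ)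
    (a : smoothFunctions M) (g : K → K) (hg : ContDiffOn K ∞ g I)
    (h : ∀ p : M, (a : M → K) p = g p.1.1) (p : M) :
    ((smoothCoordinates M).dx^[k] a : M → K) p = iteratedDeriv k g p.1.1 := by
  induction k generalizing a g with
  | zero => rw [Function.iterate_zero_apply, iteratedDeriv_zero, h]
  | succ k ih =>
    rw [Function.iterate_succ_apply, iteratedDeriv_succ']
    refine ih _ _ (hg.deriv_of_isOpen hI (by simp)) fun p => ?_
    refine (dirDeriv_apply _ (fun p => g p.1) h _ p).trans ?_
    have hd : DifferentiableAt K g p.1.1 :=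
      (hg.contDiffAt (hI.mem_nhds (hM p p.2))).differentiableAt (by simp)
    have := (hd.hasDerivAt.hasFDerivAt.comp (p : K × (Fin m → K)) hasFDerivAt_fst).fderiv
    exact (congrArg (fun L : K × (Fin m → K) →L[K] K => L (1, 0)) this).trans (by simp)

lemma dy_eq_zero {I : Set K} (hI : IsOpen I) (hM : ∀ p ∈ M, p.1 ∈ I) {g : K → K}
    (hg : ContDiffOn K ∞ g I) (i : Fin m) :
    (smoothCoordinates M).dy i (ofBase M hM g hg) = 0 := by
  ext p
  refine (dirDeriv_apply _ (fun p => g p.1) (fun p => rfl) _ p).trans ?_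
  have hd : DifferentiableAt K g p.1.1 :=
    (hg.contDiffAt (hI.mem_nhds (hM p p.2))).differentiableAt (by simp)
  have := (hd.hasDerivAt.hasFDerivAt.comp (p : K × (Fin m → K)) hasFDerivAt_fst).fderiv
  exact (congrArg (fun L : K × (Fin m → K) →L[K] K => L (0, Pi.single i 1)) this).trans (by simp)

/-- A product of `p + q` solutions of `w'' = 0` solves `w^(p+q+1) = 0`. -/
lemma iteratedDeriv_pow_mul_pow_of_affine {J : Set K} (hJ : IsOpen J) {a b : K → K}
    (ha : ContDiffOn K ∞ a J) (hb : ContDiffOn K ∞ b J) (ha2 : ∀ z ∈ J, iteratedDeriv 2 a z = 0)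
    (hb2 : ∀ z ∈ J, iteratedDeriv 2 b z = 0) (p q : ℕ) :
    ∀ z ∈ J, iteratedDeriv (p + q + 1) (fun z => a z ^ p * b z ^ q) z = 0 := by
  intro z hz
  -- Functions of `z` alone are smooth functions on `J × K^0`.
  let N : TopologicalSpace.Opens (K × (Fin 0 → K)) := ⟨Prod.fst ⁻¹' J, hJ.preimage continuous_fst⟩
  have hN : ∀ p ∈ N, p.1 ∈ J := fun p hp => hp
  have affine {g : K → K} (hg : ContDiffOn K ∞ g J) (hg2 : ∀ z ∈ J, iteratedDeriv 2 g z = 0) :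
      (smoothCoordinates N).dx ((smoothCoordinates N).dx (ofBase N hN g hg)) = 0 := by
    ext t
    exact (iterate_dx_apply hJ hN 2 _ g hg (fun p => rfl) t).trans (hg2 _ (hN t t.2))
  have h := iterate_pow_mul_pow_of_affine (smoothCoordinates N).dx (affine ha ha2) (affine hb hb2)
    p q
  rw [← iterate_dx_apply hJ hN (p + q + 1) (ofBase N hN a ha ^ p * ofBase N hN b hb ^ q) _
    ((ha.pow p).mul (hb.pow q)) (fun p => rfl) ⟨(z, 0), hz⟩, h]
  rfl

/-- In the canonical class the products of solutions of the source equation are solutions: both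
correspond to polynomials in the other variable. -/
lemma linOp_pow_mul_pow {n : ℕ} {A : ℕ → K → K} {q u v : K → K} {I : Set K}
    (h : InCanonicalClass n A q I) (hu : ContDiffOn K ∞ u I) (hv : ContDiffOn K ∞ v I)
    (hu2 : ∀ x ∈ I, iteratedDeriv 2 u x + q x * u x = 0)
    (hv2 : ∀ x ∈ I, iteratedDeriv 2 v x + q x * v x = 0) (k : Fin n) {x : K} (hx : x ∈ I) :
    linOp n A (fun x => u x ^ (n - 1 - (k : ℕ)) * v x ^ (k : ℕ)) x = 0 := by
  obtain ⟨f, r, J, I', hxI', hI'I, hf, hA, hq⟩ := h x hx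
  have smooth {w : K → K} (hw : ContDiffOn K ∞ w I) :
      ContDiffOn K ∞ (fun z => w (f z) / r z) J :=
    ((hw.mono hI'I).comp hf.smooth hf.bijOn.mapsTo).div hf.smooth_root hf.root_ne_zero
  have transform (w : K → K) (z : K) (hz : z ∈ J) : w (f z) = r z * (w (f z) / r z) :=
    (mul_div_cancel₀ _ (hf.root_ne_zero z hz)).symm
  have affine {w : K → K} (hw : ContDiffOn K ∞ w I)
      (hw2 : ∀ x ∈ I, iteratedDeriv 2 w x + q x * w x = 0) :
      ∀ z ∈ J, iteratedDeriv 2 (fun z => w (f z) / r z) z = 0 := by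
    refine (hq w _ (hw.mono hI'I) (smooth hw) fun z hz => ?_).2 fun x hx => ?_
    · simpa using transform w z hz
    · simpa [linOp] using hw2 x (hI'I hx)
  have hpoly := iteratedDeriv_pow_mul_pow_of_affine hf.isOpen_source (smooth hu) (smooth hv)
    (affine hu hu2) (affine hv hv2) (n - 1 - (k : ℕ)) k
  have hk : n - 1 - (k : ℕ) + k = n - 1 := by omega
  rw [show n - 1 - (k : ℕ) + k + 1 = n by omega] at hpoly
  refine (hA _ _ (((hu.mono hI'I).pow _).mul ((hv.mono hI'I).pow _))
    (((smooth hu).pow _).mul ((smooth hv).pow _)) fun z hz => ?_).1 hpoly x hxI'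
  have split (c a b : K) (p q : ℕ) :
      (c * a) ^ p * (c * b) ^ q = c ^ (p + q) * (a ^ p * b ^ q) := by ring
  nth_rewrite 1 [transform u z hz, transform v z hz]
  rw [split, hk]

lemma smoothCoordinates_isCanonical (hconn : IsConnected (M : Set (K × (Fin m → K)))) {n : ℕ}
    {I : Set K} (hI : IsOpen I) (hM : ∀ p ∈ M, p.1 ∈ I) {A : ℕ → K → K} {q u v : K → K}
    (hA : ∀ j, ContDiffOn K ∞ (A j) I) (h : InCanonicalClass n A q I)
    (hu : ContDiffOn K ∞ u I) (hv : ContDiffOn K ∞ v I)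
    (hu2 : ∀ x ∈ I, iteratedDeriv 2 u x + q x * u x = 0)
    (hv2 : ∀ x ∈ I, iteratedDeriv 2 v x + q x * v x = 0)
    (hW : ∀ x ∈ I, u x * deriv v x - deriv u x * v x = 1) :
    (smoothCoordinates M).IsCanonical n (fun j => ofBase M hM (A j) (hA j)) (ofBase M hM u hu)
      (ofBase M hM v hv) where
  regular := smoothCoordinates_isRegular hconn
  nontrivial := by
    obtain ⟨p, hp⟩ := hconn.nonempty
    refine ⟨0, 1, fun h => ?_⟩
    exact zero_ne_one (congrFun (congrArg (Subtype.val : smoothFunctions M → M → K) h) ⟨p, hp⟩)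
  coeff_mem j i := dy_eq_zero hI hM (hA j) i
  u_mem i := dy_eq_zero hI hM hu i
  v_mem i := dy_eq_zero hI hM hv i
  wronskian := by
    ext p
    have hd {g : K → K} (hg : ContDiffOn K ∞ g I) :
        ((smoothCoordinates M).dx (ofBase M hM g hg) : M → K) p = deriv g p.1.1 :=
      (iterate_dx_apply hI hM 1 _ g hg (fun p => rfl) p).trans (by rw [iteratedDeriv_one])
    change u p.1.1 * _ - _ * v p.1.1 = 1
    rw [hd, hd]
    exact hW _ (hM p p.2)
  solution k := by
    ext p
    have hd := fun j => iterate_dx_apply hI hM j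
      (ofBase M hM u hu ^ (n - 1 - (k : ℕ)) * ofBase M hM v hv ^ (k : ℕ)) _
      ((hu.pow (n - 1 - (k : ℕ))).mul (hv.pow k)) (fun p => rfl) p
    refine Eq.trans ?_ (linOp_pow_mul_pow h hu hv hu2 hv2 k (hM p p.2))
    rw [linOp, derivOp]
    simp only [AddSubmonoidClass.coe_finsetSum, Subalgebra.coe_add, Subalgebra.coe_mul,
      Pi.add_apply, Finset.sum_apply, Pi.mul_apply]
    simp only [hd]
    rfl

end Smooth

end PointSym

end

theorem theorem1 (m n : ℕ) (hm : 1 ≤ m) (hn : 3 ≤ n) :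
    -- real or complex variables, smooth (holomorphic) functions
    (∀ (K : Type*) [RCLike K] (M : TopologicalSpace.Opens (K × (Fin m → K))) (I : Set K)
        (A : ℕ → K → K) (q u v : K → K)
        (_ : IsConnected (M : Set (K × (Fin m → K)))) (_ : IsOpen I) (hM : ∀ p ∈ M, p.1 ∈ I)
        (hA : ∀ j, ContDiffOn K ∞ (A j) I) (_ : ContDiffOn K ∞ q I)
        (_ : PointSym.InCanonicalClass n A q I)
        (hu : ContDiffOn K ∞ u I) (hv : ContDiffOn K ∞ v I)
        (_ : ∀ x ∈ I, iteratedDeriv 2 u x + q x * u x = 0)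
        (_ : ∀ x ∈ I, iteratedDeriv 2 v x + q x * v x = 0)
        (_ : ∀ x ∈ I, u x * deriv v x - deriv u x * v x = 1),
      (PointSym.smoothCoordinates M).SymmetryAlgebraStructure n
        (fun j => PointSym.ofBase M hM (A j) (hA j))
        (PointSym.ofBase M hM u hu) (PointSym.ofBase M hM v hv)) ∧
    -- an arbitrary field of characteristic zero, formal power series
    (∀ (K : Type*) [Field K] [CharZero K] (A : ℕ → PowerSeries K) (q u v : PowerSeries K)
        (_ : PointSym.InFormalCanonicalClass n A q)
        (_ : (PowerSeries.derivative K)^[2] u + q * u = 0)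
        (_ : (PowerSeries.derivative K)^[2] v + q * v = 0)
        (_ : u * PowerSeries.derivative K v - PowerSeries.derivative K u * v = 1),
      (PointSym.formalCoordinates K m).SymmetryAlgebraStructure n
        (fun j => PointSym.ofFormalBase m (A j))
        (PointSym.ofFormalBase m u) (PointSym.ofFormalBase m v)) := by
  constructor
  · intro K _ M I A q u v hconn hI hM hA _ h hu hv hu2 hv2 hW
    exact (PointSym.smoothCoordinates_isCanonical hconn hI hM hA h hu hv hu2 hv2
      hW).symmetryAlgebraStructure hm hn
  · intro K _ _ A q u v h hu hv hW
    exact (PointSym.formalCoordinates_isCanonical h hu hv hW).symmetryAlgebraStructure hm hn
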